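/- Let $p$ be an odd prime, let $K/L$ be a tame Galois extension of finite extensions of $\mathbb{Q}_p$ with residue fields $k\supseteq\ell$, and let $\pi$ be a uniformiser of $\mathcal{O}_K$ with $\pi^{e(K/L)}\in L$, where $e(K/L)$ is the ramification index of $K/L$. Let $e,f$ be the absolute ramification index and inertial degree of $K$, and $f'$ the absolute inertial degree of $L$. For $g\in\mathrm{Gal}(K/L)$ let $\bar\eta(g)\in k^\times$ be the reduction of $g(\pi)/\pi$. Let $k_E$ be a finite field of characteristic $p$ with embeddings $\sigma_i:k\hookrightarrow k_E$ ($i\in\mathbb{Z}$) such that $\sigma_{i+1}^p=\sigma_i$. (In particular $k_E$ may be the residue field of any finite extension $E/\mathbb{Q}_p$ that contains the images of all embeddings of $K$.) Put $R=(k\otimes_{\mathbb{F}_p}k_E)[u]/u^{ep}$. Let $\phi$ be the $k_E$-linear extension to $R$ of the $p$-th power map of $k[u]/u^{ep}$, and let $\mathrm{Gal}(K/L)$ act $k_E$-linearly on $R$ by $g((a\otimes1)u^i)=(g(a)\bar\eta(g)^i\otimes1)u^i$. Let $e_i\in k\otimes k_E$ be the primitive idempotent with $(x\otimes1)e_i=(1\otimes\sigma_i(x))e_i$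 for all $x\in k$. For a sequence $(x_i)$ put $\underline{x}=\sum_{i=0}^{f-1}x_ie_i$; similarly $u^{\underline{r}}=\sum_{i=0}^{f-1}u^{r_i}e_i$ and $\bar\eta(g)^{\underline{c}}\otimes1=\sum_{i=0}^{f-1}(\bar\eta(g)^{c_i}\otimes1)e_i$. A Breuil module (with $k_E$-coefficients and descent data from $K$ to $L$) is a finitely generated free $R$-module $\mathcal{M}$ with a submodule $\mathrm{Fil}^1\mathcal{M}\supseteq u^e\mathcal{M}$, a $\phi$-semilinear map $\phi_1:\mathrm{Fil}^1\mathcal{M}\to\mathcal{M}$ whose image generates $\mathcal{M}$, and additive bijections $\widehat g:\mathcal{M}\to\mathcal{M}$ for $g\in\mathrm{Gal}(K/L)$ that preserve $\mathrm{Fil}^1\mathcal{M}$, commute with $\phi_1$, and satisfy $\widehat{1}=\mathrm{id}$, $\widehat{g_1}\circ\widehat{g_2}=\widehat{g_1g_2}$ and $\widehat g(xm)=g(x)\widehat g(m)$ for $x\in R$. Morphisms are the $R$-linear maps that preserve $\mathrm{Fil}^1$ and commute with $\phi_1$ and the $\widehat g$. An extension of $\mathcal{M}$ by $\mathcal{N}$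 is a short exact sequence $0\to\mathcal{N}\to\mathcal{P}\to\mathcal{M}\to0$ of Breuil modules; an isomorphism of extensions induces the identity on $\mathcal{M}$ and on $\mathcal{N}$. Let $\mathrm{Ext}^1(\mathcal{M},\mathcal{N})$ be the set of isomorphism classes of extensions. Let $\mathcal{M}=\mathcal{M}(r,a,c)$ be a rank one Breuil module $R\cdot m$ with $\mathrm{Fil}^1\mathcal{M}=u^{\underline{r}}\mathcal{M}$, $\phi_1(u^{\underline{r}}m)=\underline{a}m$ and $\widehat g(m)=(\bar\eta(g)^{\underline{c}}\otimes1)m$, where $r_i\in\{0,\dots,e\}$, $a_i\in k_E^\times$ and $c_i\in\mathbb{Z}/e(K/L)$ are sequences indexed by $i\in\mathbb{Z}$, periodic with period dividing $f'$, with $c_{i+1}=p(c_i+r_i)$. Let $\mathcal{N}=\mathcal{M}(s,b,d)=R\cdot n$ be another one. Put $\alpha_i=p(p^{f-1}r_i+\cdots+r_{i+f-1})/(p^f-1)$ and $\beta_i=p(p^{f-1}s_i+\cdots+s_{i+f-1})/(p^f-1)$. **Theorem.** (1) Each extension of $\mathcal{M}$ by $\mathcal{N}$ is isomorphic to precisely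 one extension of the form - $\mathcal{P}=R\cdot m+R\cdot n$ (where, by abuse of notation, $m$ is a lift to $\mathcal{P}$ of the generator of $\mathcal{M}$, and $n$ is the image in $\mathcal{P}$ of the generator of $\mathcal{N}$), - $\mathrm{Fil}^1\mathcal{P}=\langle u^{\underline{s}}n,\ u^{\underline{r}}m+\underline{h}n\rangle$, - $\phi_1(u^{\underline{s}}n)=\underline{b}n$ and $\phi_1(u^{\underline{r}}m+\underline{h}n)=\underline{a}m$, - $\widehat g(n)=(\bar\eta(g)^{\underline{d}}\otimes1)n$ and $\widehat g(m)=(\bar\eta(g)^{\underline{c}}\otimes1)m$ for all $g\in\mathrm{Gal}(K/L)$, in which each $h_i\in k_E[u]/u^{ep}$ ($i\in\mathbb{Z}$) is a polynomial such that - $h_i$ is divisible by $u^{\max(0,\,r_i+s_i-e)}$, - the sequence $h_i$ is periodic with period dividing $f'$, - each nonzero term of $h_i$ has degree congruent to $r_i+c_i-d_i\pmod{e(K/L)}$, and - $\deg(h_i)<s_i$, except that when there exists a nonzero morphism $\mathcal{M}\to\mathcal{N}$, the polynomials $h_i$ for $f'\mid i$ may also have a term of degree $r_0+\beta_0-\alpha_0$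 in common. Conversely, for every such sequence $(h_i)$ an extension of this form exists, and it is unique up to isomorphism. (2) The Baer sum and the action of $k_E$ by pushout along the endomorphisms $t:\mathcal{N}\to\mathcal{N}$, $t\in k_E$, make $\mathrm{Ext}^1(\mathcal{M},\mathcal{N})$ a finite-dimensional $k_E$-vector space, and $$\dim_{k_E}\mathrm{Ext}^1(\mathcal{M},\mathcal{N})=\delta+\sum_{i=0}^{f'-1}\#\{j\in[\max(0,r_i+s_i-e),s_i):\ j\equiv r_i+c_i-d_i\pmod{e(K/L)}\},$$ where $\delta=1$ if there exists a nonzero morphism $\mathcal{M}\to\mathcal{N}$, and $\delta=0$ otherwise. -/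

import Mathlib

open Polynomial TensorProduct

universe u v t w

namespace BrMod

/-! ### Finite extensions of `ℚ_p` -/

section Fields

variable (p : ℕ) [Fact p.Prime]

/-- The ring of integers `𝒪_K` of a finite extension `K` of `ℚ_p`: the integral closure of `ℤ_p`
(`PadicInt.subring p`, the closed unit ball of `ℚ_p`) in `K`. -/
abbrev IntegerRing (K : Type*) [Field K] [Algebra ℚ_[p] K] : Type _ :=
  integralClosure (PadicInt.subring p) K

variable {p} in
theorem mem_integerRing_iff {K : Type*} [Field K] [Algebra ℚ_[p] K] [FiniteDimensional ℚ_[p] K]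
    (x : K) :
    x ∈ integralClosure (PadicInt.subring p) K ↔ spectralNorm ℚ_[p] K x ≤ 1 := by
  have hx : IsIntegral ℚ_[p] x := Algebra.IsIntegral.isIntegral x
  rw [mem_integralClosure_iff]
  have : IsIntegrallyClosed (PadicInt.subring p) := inferInstanceAs (IsIntegrallyClosed ℤ_[p])
  have : IsFractionRing (PadicInt.subring p) ℚ_[p] :=
    inferInstanceAs (IsFractionRing ℤ_[p] ℚ_[p])
  constructor
  · intro h
    have := minpoly.isIntegrallyClosed_eq_field_fractions' ℚ_[p] h
    rw [spectralNorm, spectralValue_le_one_iff (minpoly.monic hx), this]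
    intro n
    rw [coeff_map]
    exact ((minpoly (PadicInt.subring p) x).coeff n).2
  · intro h
    rw [spectralNorm, spectralValue_le_one_iff (minpoly.monic hx)] at h
    have hl : minpoly ℚ_[p] x ∈ Polynomial.lifts (algebraMap (PadicInt.subring p) ℚ_[p]) := by
      rw [Polynomial.lifts_iff_coeff_lifts]
      intro n
      exact ⟨⟨_, h n⟩, rfl⟩
    obtain ⟨q, hq, -, hqm⟩ := Polynomial.lifts_and_degree_eq_and_monic hl (minpoly.monic hx)
    refine ⟨q, hqm, ?_⟩
    have := minpoly.aeval ℚ_[p] x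
    rw [← hq, Polynomial.aeval_map_algebraMap] at this
    exact this

theorem isUnit_integerRing_iff {K : Type*} [Field K] [Algebra ℚ_[p] K] [FiniteDimensional ℚ_[p] K]
    (x : IntegerRing p K) : IsUnit x ↔ spectralNorm ℚ_[p] K (x : K) = 1 := by
  have hmul : ∀ y z : K, spectralNorm ℚ_[p] K (y * z) =
      spectralNorm ℚ_[p] K y * spectralNorm ℚ_[p] K z :=
    fun y z => map_mul (spectralMulAlgNorm ℚ_[p] K) y z
  have h1 : spectralNorm ℚ_[p] K 1 = 1 := map_one (spectralMulAlgNorm ℚ_[p] K)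
  constructor
  · rintro ⟨u, rfl⟩
    have ha := (mem_integerRing_iff _).1 (u : IntegerRing p K).2
    have hb := (mem_integerRing_iff _).1 ((u⁻¹ : (IntegerRing p K)ˣ) : IntegerRing p K).2
    have hc : ((u : IntegerRing p K) : K) * (((u⁻¹ : (IntegerRing p K)ˣ) : IntegerRing p K) : K)
        = 1 := by
      rw [← MulMemClass.coe_mul, Units.mul_inv]; rfl
    have hd := hmul ((u : IntegerRing p K) : K)
      (((u⁻¹ : (IntegerRing p K)ˣ) : IntegerRing p K) : K)
    rw [hc, h1] at hd
    have := spectralNorm_nonneg (K := ℚ_[p]) ((u : IntegerRing p K) : K)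
    nlinarith
  · intro h
    have hx0 : (x : K) ≠ 0 := by
      intro h0
      rw [h0, spectralNorm_zero] at h
      exact zero_ne_one h
    have hinv : spectralNorm ℚ_[p] K (x : K)⁻¹ = 1 := by
      have := hmul (x : K) (x : K)⁻¹
      rw [mul_inv_cancel₀ hx0, h1, h, one_mul] at this
      exact this.symm
    refine IsUnit.of_mul_eq_one (⟨(x : K)⁻¹, (mem_integerRing_iff _).2 hinv.le⟩ : IntegerRing p K)
      (Subtype.ext ?_)
    exact mul_inv_cancel₀ hx0

variable (K : Type*) [Field K] [Algebra ℚ_[p] K] [FiniteDimensional ℚ_[p] K]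

instance : IsLocalRing (IntegerRing p K) := by
  refine IsLocalRing.of_nonunits_add ?_
  intro a b ha hb
  rw [mem_nonunits_iff, isUnit_integerRing_iff] at ha hb ⊢
  have ha' := lt_of_le_of_ne ((mem_integerRing_iff _).1 a.2) ha
  have hb' := lt_of_le_of_ne ((mem_integerRing_iff _).1 b.2) hb
  have := isNonarchimedean_spectralNorm (K := ℚ_[p]) (L := K) (a : K) (b : K)
  exact (lt_of_le_of_lt this (max_lt ha' hb')).ne

/-- The residue field of `K`. -/
abbrev ResField : Type _ := IsLocalRing.ResidueField (IntegerRing p K)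

instance : CharP (ResField p K) p := by
  have hp : ((p : IntegerRing p K) : K) = algebraMap ℚ_[p] K p := by simp
  have h0 : (p : ResField p K) = 0 := by
    rw [← map_natCast (IsLocalRing.residue (IntegerRing p K)), IsLocalRing.residue_eq_zero_iff,
      IsLocalRing.mem_maximalIdeal, mem_nonunits_iff, isUnit_integerRing_iff, hp,
      spectralNorm_extends]
    exact Padic.norm_p_lt_one.ne
  exact ringChar.of_eq (CharP.ringChar_of_prime_eq_zero Fact.out h0)

noncomputable instance : Algebra (ZMod p) (ResField p K) := ZMod.algebra _ p

/-- The absolute inertial degree `[k : 𝔽_p]` of `K`. -/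
noncomputable def absInertiaDeg : ℕ := Module.finrank (ZMod p) (ResField p K)

/-- The absolute ramification index of `K`, i.e. the ramification index of `𝒪_K` over `ℤ_p`. -/
noncomputable def absRamificationIdx : ℕ :=
  (IsLocalRing.maximalIdeal (IntegerRing p K)).ramificationIdx (PadicInt.subring p)

variable (L : Type*) [Field L] [Algebra ℚ_[p] L] [FiniteDimensional ℚ_[p] L]
variable [Algebra L K] [IsScalarTower ℚ_[p] L K]

/-- The inclusion `𝒪_L → 𝒪_K`. -/
noncomputable def integerRingMap : IntegerRing p L →+* IntegerRing p K :=
  ((IsScalarTower.toAlgHom (PadicInt.subring p) L K).mapIntegralClosure).toRingHom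

/-- The relative ramification index `e(K/L)`. -/
noncomputable def relRamificationIdx : ℕ :=
  letI := (integerRingMap p K L).toAlgebra
  (IsLocalRing.maximalIdeal (IntegerRing p K)).ramificationIdx (IntegerRing p L)

/-- The action of `Gal(K/L)` on `𝒪_K`. -/
noncomputable def galInteger : Gal(K/L) →* RingAut (IntegerRing p K) where
  toFun g := ((g.restrictScalars (PadicInt.subring p)).mapIntegralClosure).toRingEquiv
  map_one' := rfl
  map_mul' _ _ := rfl

/-- The action of `Gal(K/L)` on the residue field of `K`. -/
noncomputable def galResidue : Gal(K/L) →* RingAut (ResField p K) :=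
  IsLocalRing.ResidueField.mapAut.comp (galInteger p K L)

variable {p K} in
/-- The function `η : Gal(K/L) → 𝒪_Kˣ`, `g ↦ g(π)/π`, for a uniformiser `π`. -/
noncomputable def eta (π : IntegerRing p K) (hπ : Irreducible π) (g : Gal(K/L)) :
    (IntegerRing p K)ˣ :=
  have hnorm : spectralNorm ℚ_[p] K (g (π : K)) = spectralNorm ℚ_[p] K (π : K) :=
    (spectralNorm_eq_of_equiv (g.restrictScalars ℚ_[p]) (π : K)).symm
  have h0 : (π : K) ≠ 0 := fun h => hπ.ne_zero (Subtype.ext h)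
  have h0' : g (π : K) ≠ 0 := fun h => h0 ((map_eq_zero g).1 h)
  have hdiv : ∀ y z : K, spectralNorm ℚ_[p] K (y / z) =
      spectralNorm ℚ_[p] K y / spectralNorm ℚ_[p] K z :=
    fun y z => map_div₀ (spectralMulAlgNorm ℚ_[p] K) y z
  { val := ⟨g (π : K) / π, (mem_integerRing_iff _).2 (by
      rw [hdiv, hnorm]; exact div_self_le_one _)⟩
    inv := ⟨π / g (π : K), (mem_integerRing_iff _).2 (by
      rw [hdiv, hnorm]; exact div_self_le_one _)⟩
    val_inv := Subtype.ext (by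
      change g (π : K) / π * (π / g (π : K)) = 1
      field_simp)
    inv_val := Subtype.ext (by
      change π / g (π : K) * (g (π : K) / π) = 1
      field_simp) }

variable {p K} in
/-- The reduction `ηbar : Gal(K/L) → kˣ` of `η`. -/
noncomputable def etaBar (π : IntegerRing p K) (hπ : Irreducible π) (g : Gal(K/L)) :
    (ResField p K)ˣ :=
  Units.map (IsLocalRing.residue (IntegerRing p K)).toMonoidHom (eta L π hπ g)

end Fields

/-! ### The ring `(k ⊗ k_E)[u]/u^{ep}` -/

section Ring

variable (p e : ℕ) [Fact p.Prime] (k kE : Type*) [Field k] [Field kE]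
variable [Algebra (ZMod p) k] [Algebra (ZMod p) kE]

/-- The ring `(k ⊗_{𝔽_p} k_E)[u]/u^{ep}`. -/
abbrev BreuilRing : Type _ :=
  (k ⊗[ZMod p] kE)[X] ⧸ Ideal.span {(X : (k ⊗[ZMod p] kE)[X]) ^ (e * p)}

/-- The class of `u`. -/
noncomputable def uElt : BreuilRing p e k kE := Ideal.Quotient.mk _ X

/-- The endomorphism `φ`: the `p`-th power map on `k[u]/u^{ep}`, extended `k_E`-linearly. -/
noncomputable def phi : BreuilRing p e k kE →+* BreuilRing p e k kE :=
  Ideal.quotientMap _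
    (eval₂RingHom
      (C.comp (Algebra.TensorProduct.map (FiniteField.frobeniusAlgHom (ZMod p) k)
        (AlgHom.id (ZMod p) kE)).toRingHom)
      ((X : (k ⊗[ZMod p] kE)[X]) ^ p))
    (by
      rw [Ideal.span_le, Set.singleton_subset_iff, SetLike.mem_coe, Ideal.mem_comap,
        Ideal.mem_span_singleton]
      simp only [map_pow, coe_eval₂RingHom, eval₂_X]
      rw [← pow_mul]
      exact pow_dvd_pow _ (Nat.le_mul_of_pos_left _ (Fact.out : p.Prime).pos))

variable {k} in
/-- An automorphism of `k` as an `𝔽_p`-algebra homomorphism. -/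
def autAlgHom (τ : RingAut k) : k →ₐ[ZMod p] k :=
  { (τ : k →+* k) with
    commutes' := fun x =>
      RingHom.congr_fun (Subsingleton.elim ((τ : k →+* k).comp (algebraMap (ZMod p) k))
        (algebraMap (ZMod p) k)) x }

variable {k} in
/-- For an automorphism `τ` of `k` and `z ∈ k`, the `k_E`-linear ring endomorphism
`(a ⊗ 1) u ^ i ↦ (τ a * z ^ i ⊗ 1) u ^ i`. -/
noncomputable def twist (τ : RingAut k) (z : k) : BreuilRing p e k kE →+* BreuilRing p e k kE :=
  Ideal.quotientMap _
    (eval₂RingHom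
      (C.comp (Algebra.TensorProduct.map (autAlgHom p τ) (AlgHom.id (ZMod p) kE)).toRingHom)
      (C (z ⊗ₜ[ZMod p] (1 : kE)) * X))
    (by
      rw [Ideal.span_le, Set.singleton_subset_iff, SetLike.mem_coe, Ideal.mem_comap,
        Ideal.mem_span_singleton]
      simp only [map_pow, coe_eval₂RingHom, eval₂_X, mul_pow]
      exact dvd_mul_left _ _)

end Ring

/-! ### Breuil modules with descent data -/

section Modules

variable (p e : ℕ) [Fact p.Prime] {k : Type u} (kE : Type v) [Field k] [Field kE]
variable [Algebra (ZMod p) k] [Algebra (ZMod p) kE]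
variable {G : Type t} [Group G] (act : G →* RingAut k) (η : G → kˣ)

/-- Breuil modules with `k_E`-coefficients and descent data, where `g ∈ G` acts on
`(k ⊗ k_E)[u]/u^{ep}` by `g((a ⊗ 1)u^i) = (g(a) η(g)^i ⊗ 1)u^i`. The maps `ĝ` commute with `k_E`
because they are semilinear for this action, which is `k_E`-linear. -/
structure BreuilModule where
  /-- the underlying module -/
  carrier : Type w
  [addCommGroup : AddCommGroup carrier]
  [module : Module (BreuilRing p e k kE) carrier]
  [free : Module.Free (BreuilRing p e k kE) carrier]
  [finite : Module.Finite (BreuilRing p e k kE) carrier]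
  /-- the submodule `Fil¹` -/
  fil : Submodule (BreuilRing p e k kE) carrier
  u_pow_smul_mem : ∀ x : carrier, uElt p e k kE ^ e • x ∈ fil
  /-- the map `φ₁` -/
  phi₁ : fil →ₛₗ[phi p e k kE] carrier
  span_range_phi₁ : Submodule.span (BreuilRing p e k kE) (Set.range phi₁) = ⊤
  /-- the descent data `ĝ` -/
  hat : G → carrier ≃+ carrier
  hat_one : ∀ x : carrier, hat 1 x = x
  hat_mul : ∀ (g₁ g₂ : G) (x : carrier), hat (g₁ * g₂) x = hat g₁ (hat g₂ x)
  hat_smul : ∀ (g : G) (a : BreuilRing p e k kE) (x : carrier),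
    hat g (a • x) = twist p e kE (act g) (η g) a • hat g x
  hat_mem : ∀ (g : G) (x : carrier), x ∈ fil → hat g x ∈ fil
  hat_phi₁ : ∀ (g : G) (x : fil), hat g (phi₁ x) = phi₁ ⟨hat g x, hat_mem g x x.2⟩

attribute [instance] BreuilModule.addCommGroup BreuilModule.module BreuilModule.free
  BreuilModule.finite

variable {p e kE act η}

/-- Morphisms of Breuil modules: linear maps that preserve `Fil¹` and commute with `φ₁` and with the
descent data. -/
structure IsMorphism (M N : BreuilModule p e kE act η)
    (F : M.carrier →ₗ[BreuilRing p e k kE] N.carrier) : Prop where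
  map_fil : ∀ x ∈ M.fil, F x ∈ N.fil
  map_phi₁ : ∀ (x : M.fil), F (M.phi₁ x) = N.phi₁ ⟨F x, map_fil x x.2⟩
  map_hat : ∀ (g : G) (x : M.carrier), F (M.hat g x) = N.hat g (F x)

/-! ### Extensions and `Ext¹` -/

/-- An extension of `M` by `N`: a short exact sequence `0 → N → P → M → 0` of Breuil modules. Exactness
is required of the underlying modules only; that of `0 → Fil¹ N → Fil¹ P → Fil¹ M → 0` follows. -/
structure Extension (M N : BreuilModule.{u, v, t, w} p e kE act η) where
  /-- the middle term -/
  mid : BreuilModule.{u, v, t, w} p e kE act η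
  /-- the inclusion -/
  incl : N.carrier →ₗ[BreuilRing p e k kE] mid.carrier
  /-- the projection -/
  proj : mid.carrier →ₗ[BreuilRing p e k kE] M.carrier
  incl_isMorphism : IsMorphism N mid incl
  proj_isMorphism : IsMorphism mid M proj
  incl_injective : Function.Injective incl
  proj_surjective : Function.Surjective proj
  exact : Function.Exact incl proj

variable {M N : BreuilModule.{u, v, t, w} p e kE act η}

/-- Isomorphism of extensions: an isomorphism of Breuil modules between the middle terms that induces
the identity on `N` and on `M`. -/
def Extension.Equivalent (E₁ E₂ : Extension M N) : Prop :=
  ∃ F : E₁.mid.carrier ≃ₗ[BreuilRing p e k kE] E₂.mid.carrier,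
    IsMorphism E₁.mid E₂.mid F.toLinearMap ∧ IsMorphism E₂.mid E₁.mid F.symm.toLinearMap ∧
    (∀ y, F (E₁.incl y) = E₂.incl y) ∧ ∀ x, E₂.proj (F x) = E₁.proj x

instance Extension.setoid (M N : BreuilModule.{u, v, t, w} p e kE act η) : Setoid (Extension M N) where
  r := Extension.Equivalent
  iseqv :=
    { refl := fun E => ⟨LinearEquiv.refl _ _, ⟨fun _ h => h, fun _ => rfl, fun _ _ => rfl⟩,
        ⟨fun _ h => h, fun _ => rfl, fun _ _ => rfl⟩, fun _ => rfl, fun _ => rfl⟩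
      symm := by
        rintro E₁ E₂ ⟨F, h₁, h₂, h₃, h₄⟩
        refine ⟨F.symm, h₂, by simpa using h₁, fun y => ?_, fun x => ?_⟩
        · rw [← h₃, F.symm_apply_apply]
        · rw [← h₄, F.apply_symm_apply]
      trans := by
        rintro E₁ E₂ E₃ ⟨F, h₁, h₂, h₃, h₄⟩ ⟨F', h₁', h₂', h₃', h₄'⟩
        refine ⟨F.trans F', ⟨fun x hx => h₁'.map_fil _ (h₁.map_fil x hx), fun x => ?_,
          fun g x => ?_⟩, ⟨fun x hx => h₂.map_fil _ (h₂'.map_fil x hx), fun x => ?_,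
          fun g x => ?_⟩, fun y => ?_, fun x => ?_⟩
        · exact (congrArg F' (h₁.map_phi₁ x)).trans (h₁'.map_phi₁ _)
        · exact (congrArg F' (h₁.map_hat g x)).trans (h₁'.map_hat g _)
        · exact (congrArg F.symm (h₂'.map_phi₁ x)).trans (h₂.map_phi₁ _)
        · exact (congrArg F.symm (h₂'.map_hat g x)).trans (h₂.map_hat g _)
        · exact (congrArg F' (h₃ y)).trans (h₃' y)
        · exact (h₄' _).trans (h₄ x) }

/-- The set `Ext¹(M, N)` of isomorphism classes of extensions of `M` by `N`. -/
def Ext1 (M N : BreuilModule.{u, v, t, w} p e kE act η) : Type _ := Quotient (Extension.setoid M N)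

/-- The class of an extension. -/
def Extension.cls (E : Extension M N) : Ext1 M N := Quotient.mk _ E

/-- The fibre product `P₁ ×_M P₂` of the middle terms of two extensions. -/
noncomputable def fibreProduct (E₁ E₂ : Extension M N) :
    Submodule (BreuilRing p e k kE) (E₁.mid.carrier × E₂.mid.carrier) :=
  LinearMap.eqLocus (E₁.proj ∘ₗ LinearMap.fst _ _ _) (E₂.proj ∘ₗ LinearMap.snd _ _ _)

/-- `E₃` is a Baer sum of `E₁` and `E₂`: there is a map `P₁ ×_M P₂ → P₃` over `M`, compatible with
`Fil¹`, `φ₁` and the descent data (taken componentwise on `P₁ ×_M P₂`), that restricts to the sum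
`N × N → N`. -/
def IsBaerSum (E₁ E₂ E₃ : Extension M N) : Prop :=
  ∃ F : fibreProduct E₁ E₂ →ₗ[BreuilRing p e k kE] E₃.mid.carrier,
    (∀ (x y : fibreProduct E₁ E₂) (h₁ : x.1.1 ∈ E₁.mid.fil) (h₂ : x.1.2 ∈ E₂.mid.fil),
      y.1 = (E₁.mid.phi₁ ⟨x.1.1, h₁⟩, E₂.mid.phi₁ ⟨x.1.2, h₂⟩) →
      ∃ h₃ : F x ∈ E₃.mid.fil, F y = E₃.mid.phi₁ ⟨F x, h₃⟩) ∧
    (∀ (g : G) (x y : fibreProduct E₁ E₂), y.1 = (E₁.mid.hat g x.1.1, E₂.mid.hat g x.1.2) →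
      F y = E₃.mid.hat g (F x)) ∧
    (∀ (x : fibreProduct E₁ E₂) (y₁ y₂ : N.carrier), x.1 = (E₁.incl y₁, E₂.incl y₂) →
      F x = E₃.incl (y₁ + y₂)) ∧
    ∀ x : fibreProduct E₁ E₂, E₃.proj (F x) = E₁.proj x.1.1

/-- The scalar `1 ⊗ t` of `(k ⊗ k_E)[u]/u^{ep}`, for `t ∈ k_E`. -/
noncomputable def scalar (p e : ℕ) [Fact p.Prime] (k : Type*) {kE : Type*} [Field k] [Field kE]
    [Algebra (ZMod p) k] [Algebra (ZMod p) kE] (t : kE) : BreuilRing p e k kE :=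
  Ideal.Quotient.mk _ (C ((1 : k) ⊗ₜ[ZMod p] t))

/-- `E₂` is the multiple of `E₁` by `t ∈ k_E`, i.e. the pushout of `E₁` along `t : N → N`: there is a
morphism of the middle terms inducing multiplication by `t` on `N` and the identity on `M`. -/
def IsScalarMultiple (t : kE) (E₁ E₂ : Extension M N) : Prop :=
  ∃ F : E₁.mid.carrier →ₗ[BreuilRing p e k kE] E₂.mid.carrier,
    IsMorphism E₁.mid E₂.mid F ∧ (∀ y, F (E₁.incl y) = E₂.incl (scalar p e k t • y)) ∧
    ∀ x, E₂.proj (F x) = E₁.proj x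

/-! ### Rank one modules and their extensions in normal form -/

/-- The idempotent `e_i ∈ k ⊗ k_E` attached to the embedding `s = σ_i : k → k_E`, characterized by
`(x ⊗ 1) e_i = (1 ⊗ σ_i(x)) e_i` and by being sent to `1` by `x ⊗ y ↦ σ_i(x) y` and to `0` by
`x ⊗ y ↦ σ(x) y` for each other embedding `σ`. Explicitly, it is `-∑ x ⊗ σ_i(x)⁻¹`, the sum being
over the elements `x ≠ 0` of the finite field `k`. -/
noncomputable def idem (p : ℕ) [Fact p.Prime] {k kE : Type*} [Field k] [Field kE]
    [Algebra (ZMod p) k] [Algebra (ZMod p) kE] (s : k →+* kE) : k ⊗[ZMod p] kE :=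
  -∑ᶠ x : kˣ, (x : k) ⊗ₜ[ZMod p] (s x)⁻¹

theorem tmul_one_mul_idem [Finite k] (s : k →+* kE) (x : k) :
    (x ⊗ₜ[ZMod p] (1 : kE)) * idem p s = ((1 : k) ⊗ₜ[ZMod p] s x) * idem p s := by
  have := Fintype.ofFinite kˣ
  rcases eq_or_ne x 0 with rfl | hx
  · simp
  · simp only [idem, finsum_eq_sum_of_fintype, mul_neg, Finset.mul_sum,
      Algebra.TensorProduct.tmul_mul_tmul, one_mul]
    congr 1
    refine Fintype.sum_equiv (Equiv.mulLeft (Units.mk0 x hx)) _ _ fun y => ?_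
    have : s x ≠ 0 := (map_ne_zero s).2 hx
    simp only [Equiv.coe_mulLeft, Units.val_mul, Units.val_mk0, map_mul, mul_inv]
    congr 1
    field_simp

theorem lift_idem [Finite k] (s t : k →ₐ[ZMod p] kE) :
    Algebra.TensorProduct.lift t (AlgHom.id (ZMod p) kE) (fun _ _ => Commute.all _ _)
      (idem p (s : k →+* kE)) = open Classical in if s = t then 1 else 0 := by
  classical
  have := Fintype.ofFinite kˣ
  have := Fintype.ofFinite k
  let ψ : kˣ →* kE :=
    { toFun := fun x => t x * (s x)⁻¹
      map_one' := by simp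
      map_mul' := fun x y => by simp only [Units.val_mul, map_mul, mul_inv]; ring }
  have h1 : ψ = 1 ↔ s = t := by
    constructor
    · intro h
      ext x
      rcases eq_or_ne x 0 with rfl | hx
      · simp
      · have := DFunLike.congr_fun h (Units.mk0 x hx)
        have hs : s x ≠ 0 := (map_ne_zero s).2 hx
        simp only [ψ, MonoidHom.coe_mk, OneHom.coe_mk, Units.val_mk0, MonoidHom.one_apply] at this
        exact (eq_of_mul_inv_eq_one this).symm
    · rintro rfl
      ext x
      exact mul_inv_cancel₀ ((map_ne_zero s).2 x.ne_zero)
  have h2 : Algebra.TensorProduct.lift t (AlgHom.id (ZMod p) kE) (fun _ _ => Commute.all _ _)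
      (idem p (s : k →+* kE)) = -∑ x, ψ x := by
    simp [idem, finsum_eq_sum_of_fintype, ψ]
  have h3 : (Fintype.card k : kE) = 0 := by
    have : (Fintype.card k : k) = 0 := FiniteField.cast_card_eq_zero k
    rw [← map_natCast s, this, map_zero]
  have h4 : (Fintype.card kˣ : kE) = -1 := by
    rw [← Nat.card_eq_fintype_card, Nat.card_units, Nat.card_eq_fintype_card,
      Nat.cast_sub Fintype.card_pos, h3]
    simp
  rw [h2, sum_hom_units]
  by_cases h : s = t
  · simp [h1.2 h, h, h4]
  · simp [h, mt h1.1 h]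

/-- The map `k_E[u] → (k ⊗ k_E)[u]/u^{ep}`. -/
noncomputable def ofPoly (p e : ℕ) [Fact p.Prime] (k : Type*) {kE : Type*} [Field k] [Field kE]
    [Algebra (ZMod p) k] [Algebra (ZMod p) kE] : kE[X] →+* BreuilRing p e k kE :=
  (Ideal.Quotient.mk _).comp
    (mapRingHom (Algebra.TensorProduct.includeRight : kE →ₐ[ZMod p] k ⊗[ZMod p] kE).toRingHom)

/-- The element `x̲ = ∑_{0 ≤ i < f} x_i e_i`, where `e_i` is the idempotent of `σ_i`. -/
noncomputable def under (p e f : ℕ) [Fact p.Prime] {k kE : Type*} [Field k] [Field kE]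
    [Algebra (ZMod p) k] [Algebra (ZMod p) kE] (σ : ℤ → k →+* kE)
    (x : ℤ → BreuilRing p e k kE) : BreuilRing p e k kE :=
  ∑ i ∈ Finset.range f, x i * Ideal.Quotient.mk _ (C (idem p (σ i)))

/-- The element `u^{r̲}`. -/
noncomputable def underU (p e f : ℕ) [Fact p.Prime] {k kE : Type*} [Field k] [Field kE]
    [Algebra (ZMod p) k] [Algebra (ZMod p) kE] (σ : ℤ → k →+* kE) (r : ℤ → ℕ) :
    BreuilRing p e k kE :=
  under p e f σ fun i => uElt p e k kE ^ r i

/-- The element `a̲`, for scalars `a_i ∈ k_Eˣ`. -/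
noncomputable def underA (p e f : ℕ) [Fact p.Prime] {k kE : Type*} [Field k] [Field kE]
    [Algebra (ZMod p) k] [Algebra (ZMod p) kE] (σ : ℤ → k →+* kE) (a : ℤ → kEˣ) :
    BreuilRing p e k kE :=
  under p e f σ fun i => scalar p e k (a i : kE)

/-- The element `h̲`, for polynomials `h_i ∈ k_E[u]`. -/
noncomputable def underH (p e f : ℕ) [Fact p.Prime] {k kE : Type*} [Field k] [Field kE]
    [Algebra (ZMod p) k] [Algebra (ZMod p) kE] (σ : ℤ → k →+* kE) (h : ℤ → kE[X]) :
    BreuilRing p e k kE :=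
  under p e f σ fun i => ofPoly p e k (h i)

/-- The element `z^{c̲} ⊗ 1`, for `z ∈ kˣ` and exponents `c_i ∈ ℤ/n` (where `z ^ n = 1`). -/
noncomputable def underZ (p e f : ℕ) [Fact p.Prime] {k kE : Type*} [Field k] [Field kE]
    [Algebra (ZMod p) k] [Algebra (ZMod p) kE] (σ : ℤ → k →+* kE) {n : ℕ} (z : kˣ)
    (c : ℤ → ZMod n) : BreuilRing p e k kE :=
  under p e f σ fun i => Ideal.Quotient.mk _ (C (((z : k) ^ (c i).val) ⊗ₜ[ZMod p] (1 : kE)))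

/-- The conditions on the parameters `(r, a, c)` of a rank one Breuil module, where `f'` is the
absolute inertial degree of `L` and `n = e(K/L)`. -/
structure RankOneParams (p e f' n : ℕ) {kE : Type*} [Field kE] (r : ℤ → ℕ) (a : ℤ → kEˣ)
    (c : ℤ → ZMod n) : Prop where
  r_le : ∀ i, r i ≤ e
  c_succ : ∀ i, c (i + 1) = p * (c i + r i)
  r_periodic : Function.Periodic r f'
  a_periodic : Function.Periodic a f'
  c_periodic : Function.Periodic c f'

/-- The Breuil module `M` is the rank one module `M(r, a, c)`, with standard generator `m`. -/
structure IsRankOne (M : BreuilModule.{u, v, t, w} p e kE act η) (f : ℕ) {n : ℕ}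
    (σ : ℤ → k →+* kE) (r : ℤ → ℕ) (a : ℤ → kEˣ) (c : ℤ → ZMod n) (m : M.carrier) : Prop where
  generator : Function.Bijective fun x : BreuilRing p e k kE => x • m
  fil_eq : M.fil = Submodule.span _ {underU p e f σ r • m}
  phi₁_eq : ∀ h, M.phi₁ ⟨underU p e f σ r • m, h⟩ = underA p e f σ a • m
  hat_eq : ∀ g, M.hat g m = underZ p e f σ (η g) c • m

/-- The extension `E` of `M = M(r, a, c)` (with generator `m`) by `N = M(s, b, d)` (with generator
`n₀`) is isomorphic to `P(r, a, c; s, b, d; h)`: it has the indicated shape with respect to some lift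
`m'` of `m` and the image `n'` of `n₀`. -/
def Extension.HasNormalForm (E : Extension M N) (f : ℕ) {n : ℕ} (σ : ℤ → k →+* kE)
    (r : ℤ → ℕ) (a : ℤ → kEˣ) (c : ℤ → ZMod n) (m : M.carrier)
    (s : ℤ → ℕ) (b : ℤ → kEˣ) (d : ℤ → ZMod n) (n₀ : N.carrier) (h : ℤ → kE[X]) : Prop :=
  ∃ m' n' : E.mid.carrier, E.proj m' = m ∧ n' = E.incl n₀ ∧
    Submodule.span (BreuilRing p e k kE) {m', n'} = ⊤ ∧
    E.mid.fil = Submodule.span (BreuilRing p e k kE)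
      {underU p e f σ s • n', underU p e f σ r • m' + underH p e f σ h • n'} ∧
    (∀ hn, E.mid.phi₁ ⟨underU p e f σ s • n', hn⟩ = underA p e f σ b • n') ∧
    (∀ hm, E.mid.phi₁ ⟨underU p e f σ r • m' + underH p e f σ h • n', hm⟩ =
      underA p e f σ a • m') ∧
    (∀ g, E.mid.hat g n' = underZ p e f σ (η g) d • n') ∧
    ∀ g, E.mid.hat g m' = underZ p e f σ (η g) c • m'

/-- There is a nonzero morphism `M → N`. -/
def HasNonzeroMorphism (M N : BreuilModule.{u, v, t, w} p e kE act η) : Prop :=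
  ∃ F : M.carrier →ₗ[BreuilRing p e k kE] N.carrier, IsMorphism M N F ∧ F ≠ 0

end Modules

/-- The rational number `α_i = p (p^{f-1} r_i + ⋯ + r_{i+f-1}) / (p^f - 1)`. -/
def alpha (p f : ℕ) (r : ℤ → ℕ) (i : ℤ) : ℚ :=
  p * (∑ j ∈ Finset.range f, (p : ℚ) ^ (f - 1 - j) * r (i + j)) / ((p : ℚ) ^ f - 1)

/-- The conditions on `h` in the normal form `P(r, a, c; s, b, d; h)`; `nonzeroMap` stands for the
existence of a nonzero morphism `M → N`. Elements of `k_E[u]/u^{ep}` are represented by polynomials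
of degree `< ep`; the difference `r_i + s_i - e` is truncated at `0`. -/
structure Admissible (p e f f' n : ℕ) {kE : Type*} [Field kE] (nonzeroMap : Prop)
    (r : ℤ → ℕ) (c : ℤ → ZMod n) (s : ℤ → ℕ) (d : ℤ → ZMod n) (h : ℤ → kE[X]) : Prop where
  degree_lt : ∀ i, (h i).degree < (e * p : ℕ)
  dvd : ∀ i, X ^ (r i + s i - e) ∣ h i
  periodic : Function.Periodic h f'
  congr : ∀ i j, (h i).coeff j ≠ 0 → (j : ZMod n) = r i + c i - d i
  degree : ∀ i j, (h i).coeff j ≠ 0 → j < s i ∨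
    (nonzeroMap ∧ (f' : ℤ) ∣ i ∧ (j : ℚ) = r 0 + alpha p f s 0 - alpha p f r 0)

end BrMod

/-! Everything is computed in coordinates. The idempotents e_i split k ⊗ k_E into f copies of k_E,
so an element x of R = (k ⊗ k_E)[u]/u^{ep} is a table of coefficients `coef (σ i) j x`. The map φ
carries position (i, j) to (i + 1, pj) (`coef_phi`), and a Galois element shifts i by a multiple of
f' and multiplies by a power of η (`coef_twist`).

An extension P has a lift m' of m on which the group acts through η^c: average a lift of u^r m in
Fil¹ P against an element of trace one, which exists by tameness, and apply φ₁
(`PhiModule.IsExtension.exists_isForm`, `IsTameDatum.exists_trace_one`). Then P is determined by one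
h ∈ R with u^r m' + h n ∈ Fil¹ P mapped by φ₁ to a m'. Here h can be taken equivariant. The
condition u^e P ⊆ Fil¹ P amounts to divisibility of h by u^{max(0, r+s-e)}
(`Extension.HasForm.coef_eq_zero`, `exists_extension`). Changing the lift replaces h by h + z u^s -
u^r a⁻¹ b φ(z) with a⁻¹ b φ(z) equivariant (`PhiModule.IsForm.exists_form_iff`). The z for which the
correction vanishes describe the morphisms M → N (`PhiModule.IsStandard.exists_hom_iff`).

On the coefficients ζ of z the correction at degree w + s_i is ζ - Sζ, where S is the operator
`shift`, moving (i - 1, w') to (i, w) with w + s_i = r_i + p w'. Reaching a normal form means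
solving ζ - Sζ = -h at all degrees ≥ s_i, except at the exceptional positions. On a
finite-dimensional space of periodic families, 1 minus (S followed by deletion of the exceptional
positions) is injective, hence surjective (`exists_solution`). The reason is rigidity: along an
infinite chain of S-preimages, (p^f - 1) times the deviation of w + s_i from r_i + β_i - α_i is an
integer divisible by every power of p, hence 0 (`eq_of_chain`). So a nonzero S-fixed family is
carried by a single periodic chain (`exists_isCycle`). Such cycles exist exactly when there is a
nonzero morphism M → N (`hasNonzeroMorphism_iff_exists_isCycle`), and then the exceptional position
meets the cycle once per period. For odd p the cycles stay in degrees below e, so truncation at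
u^{ep} does no harm (`IsCycle.lt`). The same rigidity gives uniqueness (`Admissible.eq_of_hasForm`).

Normal forms make up a k_E-space with coordinates indexed by the allowed positions. The elements h
add up under Baer sums and scale under pushouts (`PhiModule.IsForm.baer`, `PhiModule.IsForm.map`),
so the dimension is a count of positions (`card_isAllowed`). The facts about Gal(K/L) come from tame
ramification theory (`isTameDatum`). -/

set_option linter.unusedSectionVars false

namespace BrMod

/-! ### Coordinates on `(k ⊗ k_E)[u]/u^{ep}` -/

section Coordinates

variable {p : ℕ} [Fact p.Prime] {k kE : Type*} [Field k] [Field kE]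
variable [Algebra (ZMod p) k] [Algebra (ZMod p) kE]

/-- A system of embeddings `σ_i` of the field with `p ^ f` elements, with `σ_{i+1}^p = σ_i`. -/
structure IsFrobeniusSystem (p f : ℕ) (σ : ℤ → k →+* kE) : Prop where
  card : Nat.card k = p ^ f
  pos : 0 < f
  frob : ∀ i x, σ (i + 1) x ^ p = σ i x

/-- An embedding as a homomorphism of `𝔽_p`-algebras. -/
def embAlgHom (p : ℕ) [Fact p.Prime] {k kE : Type*} [Field k] [Field kE]
    [Algebra (ZMod p) k] [Algebra (ZMod p) kE] (s : k →+* kE) : k →ₐ[ZMod p] kE :=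
  { s with
    commutes' := fun x =>
      RingHom.congr_fun (Subsingleton.elim (s.comp (algebraMap (ZMod p) k))
        (algebraMap (ZMod p) kE)) x }

/-- The projection `k ⊗ k_E → k_E` attached to an embedding of `k`. -/
noncomputable def component (p : ℕ) [Fact p.Prime] {k kE : Type*} [Field k] [Field kE]
    [Algebra (ZMod p) k] [Algebra (ZMod p) kE] (s : k →+* kE) : k ⊗[ZMod p] kE →+* kE :=
  (Algebra.TensorProduct.lift (embAlgHom p s) (AlgHom.id (ZMod p) kE)
    (fun _ _ => Commute.all _ _)).toRingHom

@[simp] theorem component_tmul (s : k →+* kE) (x : k) (y : kE) :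
    component p s (x ⊗ₜ[ZMod p] y) = s x * y := by
  simp [component, embAlgHom]

theorem component_idem [Finite k] (s t : k →+* kE) :
    component p t (idem p s) = open Classical in if s = t then 1 else 0 := by
  classical
  have h := lift_idem (p := p) (embAlgHom p s) (embAlgHom p t)
  have h2 : (embAlgHom p s = embAlgHom p t) ↔ s = t :=
    ⟨fun h => RingHom.ext fun x => DFunLike.congr_fun h x, fun h => by rw [h]⟩
  simp only [h2] at h
  exact h

namespace IsFrobeniusSystem

variable {f : ℕ} {σ : ℤ → k →+* kE} (hσ : IsFrobeniusSystem p f σ)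
include hσ

theorem finite : Finite k :=
  Nat.finite_of_card_ne_zero (by rw [hσ.card]; exact pow_ne_zero _ (Fact.out : p.Prime).ne_zero)

theorem pow_card (x : k) : x ^ p ^ f = x := by
  have := hσ.finite
  have := Fintype.ofFinite k
  rw [← hσ.card, Nat.card_eq_fintype_card, FiniteField.pow_card]

theorem frob_iter (i : ℤ) (j : ℕ) (x : k) : σ (i + j) x ^ p ^ j = σ i x := by
  induction j with
  | zero => simp
  | succ j ih =>
    rw [Nat.cast_succ, ← add_assoc, pow_succ', pow_mul, hσ.frob, ih]

theorem apply_pow (i : ℤ) (j : ℕ) (x : k) : σ (i + j) (x ^ p ^ j) = σ i x := by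
  rw [map_pow, hσ.frob_iter]

theorem periodic : Function.Periodic σ f := fun i => RingHom.ext fun x => by
  rw [← hσ.apply_pow i f x, hσ.pow_card]

/-- After reduction of n modulo f, all p^f elements of k would be roots of X^{p^{n mod f}} - X,
which has degree less than p^f unless f divides n. -/
theorem dvd_of_pow {n : ℕ} (hn : ∀ x : k, x ^ p ^ n = x) : f ∣ n := by
  have := hσ.finite
  have := Fintype.ofFinite k
  rw [Nat.dvd_iff_mod_eq_zero]
  by_contra h0
  have hp := (Fact.out : p.Prime)
  have h1 : ∀ q, ∀ x : k, x ^ p ^ (f * q) = x := by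
    intro q x
    induction q with
    | zero => simp
    | succ q ih => rw [mul_add, mul_one, pow_add, pow_mul, ih, hσ.pow_card]
  have h2 : ∀ x : k, x ^ p ^ (n % f) = x := by
    intro x
    have := hn x
    rw [← Nat.div_add_mod n f, pow_add, pow_mul, h1] at this
    exact this
  have h3 := Polynomial.card_roots' (X ^ p ^ (n % f) - X : k[X])
  have h4 : (X ^ p ^ (n % f) - X : k[X]) ≠ 0 :=
    FiniteField.X_pow_card_pow_sub_X_ne_zero k h0 hp.one_lt
  rw [FiniteField.X_pow_card_pow_sub_X_natDegree_eq k h0 hp.one_lt] at h3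
  have h5 : Fintype.card k ≤ Multiset.card (X ^ p ^ (n % f) - X : k[X]).roots := by
    classical
    refine le_trans ?_ (Multiset.toFinset_card_le _)
    rw [← Finset.card_univ]
    refine Finset.card_le_card fun x _ => ?_
    rw [Multiset.mem_toFinset, mem_roots h4]
    simp [h2 x]
  rw [← Nat.card_eq_fintype_card, hσ.card] at h5
  have h6 := Nat.pow_lt_pow_right hp.one_lt (Nat.mod_lt n hσ.pos)
  omega

/-- If σ_i = σ_j, injectivity of σ_i shows that the p^{j-i}-th power map is trivial on k, so
`dvd_of_pow` applies. The embeddings are thus indexed by ℤ/f. -/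
theorem eq_iff {i j : ℤ} : σ i = σ j ↔ (f : ℤ) ∣ j - i := by
  wlog hij : i ≤ j generalizing i j
  · rw [eq_comm, this (by omega), ← dvd_neg, neg_sub]
  obtain ⟨n, rfl⟩ := Int.le.dest hij
  rw [add_sub_cancel_left, Int.natCast_dvd_natCast]
  constructor
  · intro h
    refine hσ.dvd_of_pow fun x => ?_
    apply (σ i).injective
    nth_rw 1 [h]
    rw [hσ.apply_pow]
  · rintro ⟨q, rfl⟩
    have := (hσ.periodic.nat_mul q) i
    rw [← this]
    push_cast
    ring_nf

theorem mod_eq (i : ℤ) : σ ((i % f).toNat : ℕ) = σ i := by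
  have hf : (f : ℤ) ≠ 0 := by exact_mod_cast hσ.pos.ne'
  rw [Int.toNat_of_nonneg (Int.emod_nonneg _ hf), hσ.eq_iff]
  exact Int.dvd_self_sub_emod

theorem mod_lt (i : ℤ) : (i % f).toNat < f := by
  have hf : (0 : ℤ) < f := by exact_mod_cast hσ.pos
  have := Int.emod_lt_of_pos i hf
  have := Int.emod_nonneg i hf.ne'
  omega

theorem periodic_mod {α : Type*} {F : ℤ → α} (hF : Function.Periodic F f) (i : ℤ) :
    F ((i % f).toNat : ℕ) = F i := by
  have hf : (f : ℤ) ≠ 0 := by exact_mod_cast hσ.pos.ne'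
  rw [Int.toNat_of_nonneg (Int.emod_nonneg _ hf)]
  have := (hF.int_mul (i / f)) (i % f)
  rw [← this]
  congr 1
  simp only [Int.cast_id]
  rw [mul_comm]
  exact Int.emod_add_mul_ediv i f

theorem component_sum (F : ℕ → kE) (i : ℤ) :
    component p (σ i) (∑ j ∈ Finset.range f, (1 : k) ⊗ₜ[ZMod p] F j * idem p (σ j)) =
      F (i % f).toNat := by
  classical
  have := hσ.finite
  rw [map_sum, Finset.sum_eq_single (i % f).toNat]
  · rw [map_mul, component_idem, hσ.mod_eq, if_pos rfl]
    simp
  · intro j hj hne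
    rw [map_mul, component_idem, if_neg, mul_zero]
    rw [hσ.eq_iff]
    intro h
    apply hne
    have h1 : i % f = (j : ℤ) % f := Int.emod_eq_emod_iff_emod_sub_eq_zero.2
        (Int.emod_eq_zero_of_dvd h)
    rw [h1, Int.emod_eq_of_lt (by omega) (by exact_mod_cast Finset.mem_range.1 hj)]
    simp
  · intro h
    exact absurd (Finset.mem_range.2 (hσ.mod_lt i)) h

/-- The joint projection k ⊗ k_E → k_E^f is surjective because of the idempotents, and both sides
have 𝔽_p-dimension f · [k_E : 𝔽_p]. -/
theorem component_ext [Finite kE] {x y : k ⊗[ZMod p] kE}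
    (h : ∀ i, component p (σ i) x = component p (σ i) y) : x = y := by
  have := hσ.finite
  let Ψ : k ⊗[ZMod p] kE →ₗ[ZMod p] (Fin f → kE) := LinearMap.pi fun i =>
    (Algebra.TensorProduct.lift (embAlgHom p (σ (i : ℕ))) (AlgHom.id (ZMod p) kE)
    (fun _ _ => Commute.all _ _)).toLinearMap
  have hΨ : ∀ z i, Ψ z i = component p (σ (i : ℕ)) z := fun _ _ => rfl
  have hsurj : Function.Surjective Ψ := by
    intro F
    refine ⟨∑ j ∈ Finset.range f, (1 : k) ⊗ₜ[ZMod p] (if h : j < f then F ⟨j, h⟩ else 0) *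
      idem p (σ j), funext fun i => ?_⟩
    rw [hΨ, hσ.component_sum]
    have : (((i : ℕ) : ℤ) % (f : ℤ)).toNat = (i : ℕ) := by
      rw [Int.emod_eq_of_lt (by omega) (by exact_mod_cast i.2)]; simp
    simp [this]
  have hk : Module.finrank (ZMod p) k = f := by
    have := Fintype.ofFinite k
    have h1 := Module.card_eq_pow_finrank (K := ZMod p) (V := k)
    rw [← Nat.card_eq_fintype_card, ← Nat.card_eq_fintype_card, Nat.card_zmod, hσ.card] at h1
    exact (Nat.pow_right_injective (Fact.out : p.Prime).two_le h1).symm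
  have hinj : Function.Injective Ψ := by
    rw [LinearMap.injective_iff_surjective_of_finrank_eq_finrank]
    · exact hsurj
    · rw [Module.finrank_tensorProduct, hk, Module.finrank_pi_fintype]
      simp
  exact hinj (funext fun i => h _)

end IsFrobeniusSystem

variable {e : ℕ}

/-- The coefficient of `u ^ j` in the component of `x` at the embedding `s`. -/
noncomputable def coef (s : k →+* kE) (j : ℕ) (x : BreuilRing p e k kE) : kE :=
  if j < e * p then component p s ((Quotient.out x : (k ⊗[ZMod p] kE)[X]).coeff j) else 0

/-- Representatives of a class differ by a multiple of u^{ep}, so the coefficients below ep do not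
depend on the choice made by `Quotient.out`. -/
theorem coef_mk (s : k →+* kE) (j : ℕ) (q : (k ⊗[ZMod p] kE)[X]) :
    coef (e := e) s j (Ideal.Quotient.mk _ q) =
      if j < e * p then (q.map (component p s)).coeff j else 0 := by
  unfold coef
  split_ifs with h
  · have h1 : Ideal.Quotient.mk (Ideal.span {(X : (k ⊗[ZMod p] kE)[X]) ^ (e * p)})
        (Quotient.out (Ideal.Quotient.mk (Ideal.span {(X : (k ⊗[ZMod p] kE)[X]) ^ (e * p)}) q)) =
        Ideal.Quotient.mk _ q := Quotient.out_eq _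
    rw [Ideal.Quotient.eq, Ideal.mem_span_singleton, X_pow_dvd_iff] at h1
    have := h1 j h
    rw [coeff_sub, sub_eq_zero] at this
    rw [this, coeff_map]
  · rfl

theorem coef_of_le (s : k →+* kE) {j : ℕ} (hj : e * p ≤ j) (x : BreuilRing p e k kE) :
    coef s j x = 0 := if_neg (by omega)

theorem exists_mk (x : BreuilRing p e k kE) : ∃ q, Ideal.Quotient.mk _ q = x :=
  Ideal.Quotient.mk_surjective x

theorem coef_add (s : k →+* kE) (j : ℕ) (x y : BreuilRing p e k kE) :
    coef s j (x + y) = coef s j x + coef s j y := by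
  obtain ⟨a, rfl⟩ := exists_mk x
  obtain ⟨b, rfl⟩ := exists_mk y
  rw [← map_add, coef_mk, coef_mk, coef_mk]
  split_ifs <;> simp

@[simp] theorem coef_zero (s : k →+* kE) (j : ℕ) : coef s j (0 : BreuilRing p e k kE) = 0 := by
  rw [← map_zero (Ideal.Quotient.mk _), coef_mk]; simp

theorem coef_one (s : k →+* kE) (j : ℕ) : coef s j (1 : BreuilRing p e k kE) =
    if j = 0 ∧ 0 < e * p then 1 else 0 := by
  rw [← map_one (Ideal.Quotient.mk _), coef_mk, Polynomial.map_one, coeff_one]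
  by_cases h : j = 0 <;> simp [h]

/-- `coef` as an additive map. -/
noncomputable def coefHom (s : k →+* kE) (j : ℕ) : BreuilRing p e k kE →+ kE where
  toFun := coef s j
  map_zero' := coef_zero s j
  map_add' := coef_add s j

theorem coef_sub (s : k →+* kE) (j : ℕ) (x y : BreuilRing p e k kE) :
    coef s j (x - y) = coef s j x - coef s j y := map_sub (coefHom s j) x y

theorem coef_sum {ι : Type*} (s : k →+* kE) (j : ℕ) (T : Finset ι) (x : ι → BreuilRing p e k kE) :
    coef s j (∑ i ∈ T, x i) = ∑ i ∈ T, coef s j (x i) := map_sum (coefHom s j) x T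

theorem coef_C_mul (s : k →+* kE) (j : ℕ) (z : k ⊗[ZMod p] kE) (x : BreuilRing p e k kE) :
    coef s j (Ideal.Quotient.mk _ (C z) * x) = component p s z * coef s j x := by
  obtain ⟨q, rfl⟩ := exists_mk x
  rw [← map_mul, coef_mk, coef_mk, Polynomial.map_mul, map_C, coeff_C_mul]
  split_ifs <;> simp

theorem coef_u_pow_mul (s : k →+* kE) (r j : ℕ) (x : BreuilRing p e k kE) :
    coef s j (uElt p e k kE ^ r * x) = if r ≤ j ∧ j < e * p then coef s (j - r) x else 0 := by
  obtain ⟨q, rfl⟩ := exists_mk x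
  rw [uElt, ← map_pow, ← map_mul, coef_mk, coef_mk, Polynomial.map_mul, Polynomial.map_pow, map_X,
    coeff_X_pow_mul']
  by_cases h1 : r ≤ j <;> by_cases h2 : j < e * p
  · simp [h1, h2, show j - r < e * p by omega]
  all_goals simp [h1, h2]

theorem coef_zero_mul (s : k →+* kE) (x y : BreuilRing p e k kE) :
    coef s 0 (x * y) = coef s 0 x * coef s 0 y := by
  obtain ⟨a, rfl⟩ := exists_mk x
  obtain ⟨b, rfl⟩ := exists_mk y
  rw [← map_mul, coef_mk, coef_mk, coef_mk, Polynomial.map_mul, mul_coeff_zero]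
  split_ifs <;> simp

theorem coef_scalar_mul (s : k →+* kE) (j : ℕ) (t : kE) (x : BreuilRing p e k kE) :
    coef s j (scalar p e k t * x) = t * coef s j x := by
  rw [scalar, coef_C_mul]; simp

theorem map_component_comp (s : k →+* kE) (q : kE[X]) :
    (q.map (Algebra.TensorProduct.includeRight : kE →ₐ[ZMod p] k ⊗[ZMod p] kE).toRingHom).map
      (component p s) = q := by
  rw [Polynomial.map_map]
  convert Polynomial.map_id
  ext x
  simp

theorem coef_ofPoly (s : k →+* kE) (j : ℕ) (q : kE[X]) :
    coef s j (ofPoly p e k q) = if j < e * p then q.coeff j else 0 := by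
  rw [ofPoly, RingHom.comp_apply, coef_mk, coe_mapRingHom, map_component_comp]

namespace IsFrobeniusSystem

variable {f : ℕ} {σ : ℤ → k →+* kE} (hσ : IsFrobeniusSystem p f σ)
include hσ

theorem coef_ext [Finite kE] {x y : BreuilRing p e k kE}
    (h : ∀ i j, j < e * p → coef (σ i) j x = coef (σ i) j y) : x = y := by
  obtain ⟨a, rfl⟩ := exists_mk x
  obtain ⟨b, rfl⟩ := exists_mk y
  rw [Ideal.Quotient.eq, Ideal.mem_span_singleton, X_pow_dvd_iff]
  intro j hj
  rw [coeff_sub, sub_eq_zero]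
  refine hσ.component_ext fun i => ?_
  have := h i j hj
  rw [coef_mk, coef_mk, if_pos hj, if_pos hj, coeff_map, coeff_map] at this
  exact this

theorem coef_under_mul (x : ℤ → BreuilRing p e k kE) (i : ℤ) (j : ℕ) (y : BreuilRing p e k kE) :
    coef (σ i) j (under p e f σ x * y) = coef (σ i) j (x ((i % f).toNat : ℕ) * y) := by
  classical
  have := hσ.finite
  have h0 := fun z : ℕ → BreuilRing p e k kE => Finset.sum_mul (Finset.range f) z y
  have h1 := fun a b c : BreuilRing p e k kE => (mul_assoc a b c).trans (mul_left_comm a b c)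
  rw [under, h0, coef_sum, Finset.sum_eq_single (i % f).toNat]
  · rw [h1, coef_C_mul, component_idem, hσ.mod_eq, if_pos rfl, one_mul]
  · intro l hl hne
    rw [h1, coef_C_mul, component_idem, if_neg, zero_mul]
    rw [hσ.eq_iff]
    intro h
    apply hne
    have h1 : i % f = (l : ℤ) % f := Int.emod_eq_emod_iff_emod_sub_eq_zero.2
        (Int.emod_eq_zero_of_dvd h)
    rw [h1, Int.emod_eq_of_lt (by omega) (by exact_mod_cast Finset.mem_range.1 hl)]
    simp
  · intro h
    exact absurd (Finset.mem_range.2 (hσ.mod_lt i)) h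

theorem coef_underU_mul {r : ℤ → ℕ} (hr : Function.Periodic r f) (i : ℤ) (j : ℕ)
    (y : BreuilRing p e k kE) : coef (σ i) j (underU p e f σ r * y) =
      if r i ≤ j ∧ j < e * p then coef (σ i) (j - r i) y else 0 := by
  rw [underU, hσ.coef_under_mul, coef_u_pow_mul, hσ.periodic_mod hr]

theorem coef_underA_mul {a : ℤ → kEˣ} (ha : Function.Periodic a f) (i : ℤ) (j : ℕ)
    (y : BreuilRing p e k kE) : coef (σ i) j (underA p e f σ a * y) = a i * coef (σ i) j y := by
  rw [underA, hσ.coef_under_mul, coef_scalar_mul, hσ.periodic_mod ha]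

theorem coef_underZ_mul {n : ℕ} {c : ℤ → ZMod n} (hc : Function.Periodic c f) (z : kˣ) (i : ℤ)
    (j : ℕ) (y : BreuilRing p e k kE) :
    coef (σ i) j (underZ p e f σ z c * y) = σ i z ^ (c i).val * coef (σ i) j y := by
  rw [underZ, hσ.coef_under_mul, coef_C_mul, hσ.periodic_mod hc]
  simp

theorem coef_underH {h : ℤ → kE[X]} (hh : Function.Periodic h f) (i : ℤ) (j : ℕ) :
    coef (σ i) j (underH p e f σ h) = if j < e * p then (h i).coeff j else 0 := by
  rw [← mul_one (underH p e f σ h), underH, hσ.coef_under_mul, mul_one, coef_ofPoly,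
    hσ.periodic_mod hh]

/-- Since φ raises x ∈ k to its p-th power and σ_{i+1}(x^p) = σ_i(x), component i moves to component
i + 1; since φ(u) = u^p, degree j becomes pj. -/
theorem coef_phi (i : ℤ) (j : ℕ) (x : BreuilRing p e k kE) :
    coef (σ (i + 1)) j (phi p e k kE x) =
      if p ∣ j ∧ j < e * p then coef (σ i) (j / p) x else 0 := by
  have hp := (Fact.out : p.Prime)
  have := hσ.finite
  have := Fintype.ofFinite k
  obtain ⟨q, rfl⟩ := exists_mk x
  rw [phi, Ideal.quotientMap_mk, coef_mk, coef_mk]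
  have key : (eval₂RingHom (C.comp (Algebra.TensorProduct.map
      (FiniteField.frobeniusAlgHom (ZMod p) k) (AlgHom.id (ZMod p) kE)).toRingHom)
      ((X : (k ⊗[ZMod p] kE)[X]) ^ p) q).map (component p (σ (i + 1))) =
      expand kE p (q.map (component p (σ i))) := by
    have : (mapRingHom (component p (σ (i + 1)))).comp (eval₂RingHom (C.comp
      (Algebra.TensorProduct.map
      (FiniteField.frobeniusAlgHom (ZMod p) k) (AlgHom.id (ZMod p) kE)).toRingHom)
      ((X : (k ⊗[ZMod p] kE)[X]) ^ p)) = (expand kE p).toRingHom.comp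
        (mapRingHom (component p (σ i))) := by
      refine Polynomial.ringHom_ext' ?_ ?_
      · refine RingHom.ext fun z => ?_
        induction z with
        | zero => simp
        | add x y hx hy => rw [map_add, map_add, hx, hy]
        | tmul x y =>
          simp only [RingHom.comp_apply, coe_eval₂RingHom, eval₂_C, coe_mapRingHom, map_C]
          have h1 := hσ.apply_pow i 1 x
          rw [pow_one] at h1
          simp [← h1]
      · simp
    exact RingHom.congr_fun this q
  rw [key, coeff_expand hp.pos]
  by_cases h1 : p ∣ j <;> by_cases h2 : j < e * p
  · have : j / p < e * p := lt_of_le_of_lt (Nat.div_le_self _ _) h2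
    simp [h1, h2, this]
  all_goals simp [h1, h2]

/-- As for φ, the power map x ↦ x^{p^l} on k moves component i to component i + l. The variable is
only rescaled, so degrees stay in place. -/
theorem coef_twist (τ : RingAut k) (z : k) (l : ℕ) (hτ : ∀ x, τ x = x ^ p ^ l) (i : ℤ) (j : ℕ)
    (x : BreuilRing p e k kE) :
    coef (σ (i + l)) j (twist p e kE τ z x) = σ (i + l) z ^ j * coef (σ i) j x := by
  obtain ⟨q, rfl⟩ := exists_mk x
  rw [twist, Ideal.quotientMap_mk, coef_mk, coef_mk]
  have key : (eval₂RingHom (C.comp (Algebra.TensorProduct.map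
      (autAlgHom p τ) (AlgHom.id (ZMod p) kE)).toRingHom)
      (C (z ⊗ₜ[ZMod p] (1 : kE)) * X) q).map (component p (σ (i + l))) =
      (q.map (component p (σ i))).comp (C (σ (i + l) z) * X) := by
    have : (mapRingHom (component p (σ (i + l)))).comp (eval₂RingHom (C.comp
      (Algebra.TensorProduct.map (autAlgHom p τ) (AlgHom.id (ZMod p) kE)).toRingHom)
      (C (z ⊗ₜ[ZMod p] (1 : kE)) * X)) = (compRingHom (C (σ (i + l) z) * X)).comp
        (mapRingHom (component p (σ i))) := by
      refine Polynomial.ringHom_ext' ?_ ?_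
      · refine RingHom.ext fun y => ?_
        induction y with
        | zero => simp
        | add x y hx hy => rw [map_add, map_add, hx, hy]
        | tmul x y =>
          simp only [RingHom.comp_apply, coe_eval₂RingHom, eval₂_C, coe_mapRingHom, map_C]
          have h1 := hσ.apply_pow i l x
          have h2 : autAlgHom p τ x = x ^ p ^ l := hτ x
          simp [h2, h1]
      · simp
    exact RingHom.congr_fun this q
  rw [key, comp_C_mul_X_coeff]
  split_ifs <;> simp [mul_comm]

/-- The element of `(k ⊗ k_E)[u]/u^{ep}` with prescribed coefficients. -/
theorem exists_coef [Finite kE] {F : ℤ → ℕ → kE} (hF : Function.Periodic F f) :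
    ∃ x : BreuilRing p e k kE, ∀ i j, coef (σ i) j x = if j < e * p then F i j else 0 := by
  refine ⟨underH p e f σ fun i => ∑ j ∈ Finset.range (e * p), monomial j (F i j), fun i j => ?_⟩
  rw [hσ.coef_underH]
  · split_ifs with h
    · rw [finsetSum_coeff]
      simp [coeff_monomial, h]
    · rfl
  · intro i
    simp only [hF i]

end IsFrobeniusSystem

end Coordinates

/-! ### Filtered `φ`-modules with a semilinear group action over an arbitrary ring -/

section Abstract

universe u'

/-- Filtered `φ`-modules with a semilinear group action over a ring `R`. -/
structure PhiModule {R : Type u'} [CommRing R] (φ : R →+* R) {G : Type t} [Group G]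
    (tw : G → R →+* R) where
  /-- the underlying module -/
  carrier : Type w
  [addCommGroup : AddCommGroup carrier]
  [module : Module R carrier]
  /-- the filtration -/
  fil : Submodule R carrier
  /-- the semilinear map -/
  phi₁ : fil →ₛₗ[φ] carrier
  span_range_phi₁ : Submodule.span R (Set.range phi₁) = ⊤
  /-- the group action -/
  hat : G → carrier ≃+ carrier
  hat_one : ∀ x : carrier, hat 1 x = x
  hat_mul : ∀ (g₁ g₂ : G) (x : carrier), hat (g₁ * g₂) x = hat g₁ (hat g₂ x)
  hat_smul : ∀ (g : G) (a : R) (x : carrier), hat g (a • x) = tw g a • hat g x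
  hat_mem : ∀ (g : G) (x : carrier), x ∈ fil → hat g x ∈ fil
  hat_phi₁ : ∀ (g : G) (x : fil), hat g (phi₁ x) = phi₁ ⟨hat g x, hat_mem g x x.2⟩

attribute [instance] PhiModule.addCommGroup PhiModule.module

variable {R : Type u'} [CommRing R] {φ : R →+* R} {G : Type t} [Group G] {tw : G → R →+* R}

/-- Morphisms of filtered `φ`-modules with group action. -/
structure PhiModule.IsHom (M N : PhiModule.{t, w} φ tw) (F : M.carrier →ₗ[R] N.carrier) : Prop where
  map_fil : ∀ x ∈ M.fil, F x ∈ N.fil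
  map_phi₁ : ∀ (x : M.fil), F (M.phi₁ x) = N.phi₁ ⟨F x, map_fil x x.2⟩
  map_hat : ∀ (g : G) (x : M.carrier), F (M.hat g x) = N.hat g (F x)

/-- Short exact sequences of filtered `φ`-modules with group action. -/
structure PhiModule.IsExtension {M N P : PhiModule.{t, w} φ tw}
    (ι : N.carrier →ₗ[R] P.carrier) (π : P.carrier →ₗ[R] M.carrier) : Prop where
  hom_incl : N.IsHom P ι
  hom_proj : P.IsHom M π
  injective : Function.Injective ι
  surjective : Function.Surjective π
  exact : Function.Exact ι π

/-- Rank one objects with a standard generator. -/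
structure PhiModule.IsStandard (M : PhiModule.{t, w} φ tw) (U A : R) (Z : G → R) (m : M.carrier) :
    Prop where
  generator : Function.Bijective fun x : R => x • m
  fil_eq : M.fil = Submodule.span R {U • m}
  phi₁_eq : ∀ h, M.phi₁ ⟨U • m, h⟩ = A • m
  hat_eq : ∀ g, M.hat g m = Z g • m

/-- The properties of the coefficients of rank one objects that are used below. -/
structure IsCoefficients (φ : R →+* R) (tw : G → R →+* R) (U A : R) (Z Z' : G → R) : Prop where
  isUnit : IsUnit A
  tw_eq : ∀ g, tw g A = A
  -- `Z' g` is the scalar by which g acts on the generator U m of Fil¹, as `tw_U` expresses, while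
  -- `Z g` is the one for m. Compatibility with φ₁ is `phi_Z'`.
  isUnit_Z' : ∀ g, IsUnit (Z' g)
  phi_Z' : ∀ g, φ (Z' g) = Z g
  tw_U : ∀ g, tw g U * Z g = Z' g * U
  cocycle : ∀ g h, Z' (g * h) = tw g (Z' h) * Z' g
  phi_eq_zero : ∀ y, y * U = 0 → φ y = 0
  -- If x is not a multiple of U, the triple (y, ε, ω) obstructs any extension of φ₁ to x times the
  -- generator: its value, multiplied by φ(y), would have to be φ(ε) A times the generator, yet ω
  -- kills φ(y) and not φ(ε).
  saturated : ∀ x, (∃ z, x = z * U) ∨ ∃ y ε ω, y * x = ε * U ∧ ω * φ y = 0 ∧ ω * φ ε ≠ 0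

namespace PhiModule

variable {M N P P₁ P₂ P₃ : PhiModule.{t, w} φ tw}

theorem phi₁_smul (P : PhiModule.{t, w} φ tw) (y : R) (x : P.carrier) (hx : x ∈ P.fil)
    (h : y • x ∈ P.fil) : P.phi₁ ⟨y • x, h⟩ = φ y • P.phi₁ ⟨x, hx⟩ :=
  P.phi₁.map_smulₛₗ y ⟨x, hx⟩

theorem phi₁_add (P : PhiModule.{t, w} φ tw) (x y : P.carrier) (hx : x ∈ P.fil) (hy : y ∈ P.fil)
    (h : x + y ∈ P.fil) : P.phi₁ ⟨x + y, h⟩ = P.phi₁ ⟨x, hx⟩ + P.phi₁ ⟨y, hy⟩ :=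
  P.phi₁.map_add ⟨x, hx⟩ ⟨y, hy⟩

theorem phi₁_congr (P : PhiModule.{t, w} φ tw) {x y : P.carrier} (h : x = y) (hx : x ∈ P.fil)
    (hy : y ∈ P.fil) : P.phi₁ ⟨x, hx⟩ = P.phi₁ ⟨y, hy⟩ := by
  subst h; rfl

namespace IsStandard

variable {U A : R} {Z : G → R} {m : M.carrier} (hM : M.IsStandard U A Z m)
include hM

theorem smul_inj {x y : R} (h : x • m = y • m) : x = y := hM.generator.1 h

theorem exists_smul (z : M.carrier) : ∃ x : R, z = x • m :=
  (hM.generator.2 z).imp fun _ h => h.symm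

theorem mem_fil {x : R} : x • m ∈ M.fil ↔ ∃ z, x = z * U := by
  rw [hM.fil_eq, Submodule.mem_span_singleton]
  constructor
  · rintro ⟨z, hz⟩
    refine ⟨z, hM.smul_inj ?_⟩
    rw [← hz, mul_smul]
  · rintro ⟨z, rfl⟩
    exact ⟨z, by rw [mul_smul]⟩

theorem gen_mem : U • m ∈ M.fil := hM.mem_fil.2 ⟨1, by simp⟩

theorem phi₁_apply (z : R) (h : z • U • m ∈ M.fil) :
    M.phi₁ ⟨z • U • m, h⟩ = φ z • A • m := by
  rw [M.phi₁_smul z _ hM.gen_mem, hM.phi₁_eq]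

end IsStandard

section Extension

variable {U A V B : R} {Z Z' W W' : G → R} {m : M.carrier} {n : N.carrier}
variable {ι : N.carrier →ₗ[R] P.carrier} {π : P.carrier →ₗ[R] M.carrier}
variable {ι₁ : N.carrier →ₗ[R] P₁.carrier} {π₁ : P₁.carrier →ₗ[R] M.carrier}
variable {ι₂ : N.carrier →ₗ[R] P₂.carrier} {π₂ : P₂.carrier →ₗ[R] M.carrier}
variable {ι₃ : N.carrier →ₗ[R] P₃.carrier} {π₃ : P₃.carrier →ₗ[R] M.carrier}

/-- The extension `P` is given by `h`, with respect to the lift `m'` of the generator. -/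
structure IsForm (P : PhiModule.{t, w} φ tw) (ι : N.carrier →ₗ[R] P.carrier)
    (π : P.carrier →ₗ[R] M.carrier) (U A : R) (Z : G → R) (m : M.carrier) (n : N.carrier) (h : R)
    (m' : P.carrier) : Prop where
  proj_eq : π m' = m
  mem : U • m' + h • ι n ∈ P.fil
  phi₁_eq : ∀ hm, P.phi₁ ⟨U • m' + h • ι n, hm⟩ = A • m'
  hat_eq : ∀ g, P.hat g m' = Z g • m'

theorem IsExtension.proj_incl (hE : IsExtension ι π) (y : N.carrier) : π (ι y) = 0 :=
  (hE.exact (ι y)).2 ⟨y, rfl⟩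

theorem IsExtension.exists_incl (hE : IsExtension ι π) (hN : N.IsStandard V B W n)
    {x : P.carrier} (hx : π x = 0) : ∃ z : R, x = z • ι n := by
  obtain ⟨y, rfl⟩ := (hE.exact x).1 hx
  obtain ⟨z, rfl⟩ := hN.exists_smul y
  exact ⟨z, by rw [map_smul]⟩

theorem IsExtension.incl_smul_eq_zero (hE : IsExtension ι π) (hN : N.IsStandard V B W n) {x : R}
    (hx : x • ι n = 0) : x = 0 := by
  rw [← map_smul] at hx
  have := hE.injective (hx.trans (map_zero ι).symm)
  exact hN.smul_inj (by rw [this, zero_smul])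

theorem IsExtension.incl_gen_mem (hE : IsExtension ι π) (hN : N.IsStandard V B W n) :
    V • ι n ∈ P.fil := by
  rw [← map_smul]; exact hE.hom_incl.map_fil _ hN.gen_mem

theorem IsExtension.phi₁_incl (hE : IsExtension ι π) (hN : N.IsStandard V B W n)
    (h : V • ι n ∈ P.fil) : P.phi₁ ⟨V • ι n, h⟩ = B • ι n := by
  have := hE.hom_incl.map_phi₁ ⟨V • n, hN.gen_mem⟩
  rw [hN.phi₁_eq, map_smul] at this
  rw [this]
  exact P.phi₁_congr (map_smul ι V n).symm _ _

theorem IsExtension.hat_incl (hE : IsExtension ι π) (hN : N.IsStandard V B W n) (g : G) :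
    P.hat g (ι n) = W g • ι n := by
  rw [← hE.hom_incl.map_hat, hN.hat_eq, map_smul]

/-- `Fil¹ P ∩ N = Fil¹ N`. -/
theorem IsExtension.mem_fil_incl (hE : IsExtension ι π) (hN : N.IsStandard V B W n)
    (hb : IsCoefficients φ tw V B W W') {x : R} (hx : x • ι n ∈ P.fil) : ∃ z, x = z * V := by
  -- Otherwise φ₁(y x n) = φ₁(ε V n) is computed in two ways. Multiplied by ω, the first value
  -- vanishes, while the second is ω φ(ε) B n ≠ 0.
  refine (hb.saturated x).resolve_right ?_
  rintro ⟨y, ε, ω, h1, h2, h3⟩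
  apply h3
  have hV := hE.incl_gen_mem hN
  have h4 : y • x • ι n = ε • V • ι n := by rw [smul_smul, h1, mul_smul]
  have h5 := P.phi₁_congr h4 (P.fil.smul_mem _ hx) (P.fil.smul_mem _ hV)
  rw [P.phi₁_smul _ _ hx, P.phi₁_smul _ _ hV, hE.phi₁_incl hN] at h5
  have h6 : (ω * φ ε * B) • ι n = 0 := by
    rw [mul_smul, mul_smul, ← h5, smul_smul, h2, zero_smul]
  have h7 := hE.incl_smul_eq_zero hN h6
  exact (hb.isUnit.mul_left_eq_zero).1 h7

/-- `Fil¹ P → Fil¹ M` is surjective. -/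
theorem IsExtension.exists_lift_fil (hE : IsExtension ι π) (hM : M.IsStandard U A Z m)
    (hφ : ∀ J : Ideal R, Ideal.span (φ '' (J : Set R)) = ⊤ → J = ⊤) :
    ∃ x ∈ P.fil, π x = U • m := by
  -- J consists of the x with x U m ∈ π(Fil¹ P). Applying π to P = R · φ₁(Fil¹ P) shows that φ(J)
  -- generates the unit ideal, and `hφ` then forces J = R.
  let J : Ideal R := (P.fil.map π).comap (LinearMap.toSpanSingleton R M.carrier (U • m))
  have hJ : ∀ x, x ∈ J ↔ ∃ y ∈ P.fil, π y = x • U • m := fun x => Iff.rfl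
  suffices J = ⊤ by
    have h1 : (1 : R) ∈ J := this ▸ Submodule.mem_top
    simpa using (hJ 1).1 h1
  apply hφ
  have h2 : ∀ z : P.carrier, ∃ y ∈ Ideal.span (φ '' (J : Set R)), π z = y • A • m := by
    intro z
    have hz : z ∈ Submodule.span R (Set.range P.phi₁) := by
      rw [P.span_range_phi₁]; exact Submodule.mem_top
    induction hz using Submodule.span_induction with
    | mem x hx =>
      obtain ⟨x, rfl⟩ := hx
      have h3 := hE.hom_proj.map_fil _ x.2
      obtain ⟨q, hq⟩ := hM.exists_smul (π x)
      obtain ⟨q, rfl⟩ := hM.mem_fil.1 (hq ▸ h3)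
      refine ⟨φ q, Ideal.subset_span ⟨q, (hJ q).2 ⟨x, x.2, by rw [hq, mul_smul]⟩, rfl⟩, ?_⟩
      rw [hE.hom_proj.map_phi₁]
      have h4 : π x = q • U • m := by rw [hq, mul_smul]
      rw [M.phi₁_congr h4 _ (M.fil.smul_mem _ hM.gen_mem), hM.phi₁_apply]
    | zero => exact ⟨0, zero_mem _, by simp⟩
    | add x y _ _ hx hy =>
      obtain ⟨a, ha, hxa⟩ := hx
      obtain ⟨b, hb, hyb⟩ := hy
      exact ⟨a + b, add_mem ha hb, by rw [map_add, hxa, hyb, add_smul]⟩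
    | smul c x _ hx =>
      obtain ⟨a, ha, hxa⟩ := hx
      exact ⟨c * a, Ideal.mul_mem_left _ _ ha, by rw [map_smul, hxa, mul_smul]⟩
  obtain ⟨z, hz⟩ := hE.surjective m
  obtain ⟨y, hy, hyz⟩ := h2 z
  rw [hz] at hyz
  rw [Ideal.eq_top_iff_one]
  have h5 : (1 : R) = A * y := hM.smul_inj (by rw [one_smul, mul_comm, mul_smul]; exact hyz)
  rw [h5]
  exact Ideal.mul_mem_left _ _ hy

/-! ### Extensions described by a lift of the generator and an element h -/

section Form

variable {h h₁ h₂ : R} {m' : P.carrier} {m₁ : P₁.carrier} {m₂ : P₂.carrier} {m₃ : P₃.carrier}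

theorem IsForm.exists_repr (hF : IsForm P ι π U A Z m n h m') (hE : IsExtension ι π)
    (hM : M.IsStandard U A Z m) (hN : N.IsStandard V B W n) (x : P.carrier) :
    ∃ y z : R, x = y • m' + z • ι n := by
  obtain ⟨y, hy⟩ := hM.exists_smul (π x)
  obtain ⟨z, hz⟩ := hE.exists_incl hN (x := x - y • m')
    (by rw [map_sub, map_smul, hF.proj_eq, hy, sub_self])
  exact ⟨y, z, by rw [← hz, add_sub_cancel]⟩

theorem IsForm.repr_eq_zero (hF : IsForm P ι π U A Z m n h m') (hE : IsExtension ι π)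
    (hM : M.IsStandard U A Z m) (hN : N.IsStandard V B W n) {y z : R}
    (hx : y • m' + z • ι n = 0) : y = 0 ∧ z = 0 := by
  have h1 := congrArg π hx
  rw [map_add, map_smul, map_smul, hE.proj_incl, hF.proj_eq, smul_zero, add_zero, map_zero] at h1
  have h2 : y = 0 := hM.smul_inj (by rw [h1, zero_smul])
  subst h2
  rw [zero_smul, zero_add] at hx
  exact ⟨rfl, hE.incl_smul_eq_zero hN hx⟩

theorem IsForm.repr_inj (hF : IsForm P ι π U A Z m n h m') (hE : IsExtension ι π)
    (hM : M.IsStandard U A Z m) (hN : N.IsStandard V B W n) {y z y' z' : R}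
    (hx : y • m' + z • ι n = y' • m' + z' • ι n) : y = y' ∧ z = z' := by
  have h1 : (y - y') • m' + (z - z') • ι n = 0 := by
    rw [sub_smul, sub_smul, ← sub_eq_zero.2 hx]; abel
  have := hF.repr_eq_zero hE hM hN h1
  exact ⟨sub_eq_zero.1 this.1, sub_eq_zero.1 this.2⟩

/-- Subtracting a suitable multiple of the lift of U m leaves an element of N ∩ Fil¹ P = Fil¹ N. -/
theorem IsForm.mem_fil_iff (hF : IsForm P ι π U A Z m n h m') (hE : IsExtension ι π)
    (hM : M.IsStandard U A Z m) (hN : N.IsStandard V B W n)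
    (hb : IsCoefficients φ tw V B W W') {x : P.carrier} :
    x ∈ P.fil ↔ ∃ y z : R, x = y • (U • m' + h • ι n) + z • V • ι n := by
  constructor
  · intro hx
    obtain ⟨q, hq⟩ := hM.exists_smul (π x)
    obtain ⟨y, rfl⟩ := hM.mem_fil.1 (hq ▸ hE.hom_proj.map_fil _ hx)
    obtain ⟨z, hz⟩ := hE.exists_incl hN (x := x - y • (U • m' + h • ι n)) (by
      rw [map_sub, map_smul, map_add, map_smul, map_smul, hE.proj_incl, hF.proj_eq, smul_zero,
        add_zero, smul_smul, hq, sub_self])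
    obtain ⟨z, rfl⟩ := hE.mem_fil_incl hN hb
      (hz ▸ P.fil.sub_mem hx (P.fil.smul_mem y hF.mem))
    refine ⟨y, z, ?_⟩
    rw [← mul_smul, ← hz, add_sub_cancel]
  · rintro ⟨y, z, rfl⟩
    exact P.fil.add_mem (P.fil.smul_mem _ hF.mem) (P.fil.smul_mem _ (hE.incl_gen_mem hN))

theorem IsForm.phi₁_apply (hF : IsForm P ι π U A Z m n h m') (hE : IsExtension ι π)
    (hN : N.IsStandard V B W n) (y z : R)
    (hx : y • (U • m' + h • ι n) + z • V • ι n ∈ P.fil) :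
    P.phi₁ ⟨_, hx⟩ = (φ y * A) • m' + (φ z * B) • ι n := by
  have hV := hE.incl_gen_mem hN
  rw [P.phi₁_add _ _ (P.fil.smul_mem _ hF.mem) (P.fil.smul_mem _ hV), P.phi₁_smul _ _ hF.mem,
    P.phi₁_smul _ _ hV, hF.phi₁_eq, hE.phi₁_incl hN, mul_smul, mul_smul]

theorem IsForm.hat_apply (hF : IsForm P ι π U A Z m n h m') (hE : IsExtension ι π)
    (hN : N.IsStandard V B W n) (g : G) (y z : R) :
    P.hat g (y • m' + z • ι n) = (tw g y * Z g) • m' + (tw g z * W g) • ι n := by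
  rw [map_add, P.hat_smul, P.hat_smul, hF.hat_eq, hE.hat_incl hN, mul_smul, mul_smul]

/-- The basis of `P` given by a form. -/
noncomputable def IsForm.basis (hF : IsForm P ι π U A Z m n h m') (hE : IsExtension ι π)
    (hM : M.IsStandard U A Z m) (hN : N.IsStandard V B W n) : (R × R) ≃ₗ[R] P.carrier :=
  LinearEquiv.ofBijective (LinearMap.coprod (LinearMap.toSpanSingleton R _ m')
    (LinearMap.toSpanSingleton R _ (ι n))) <| by
    constructor
    · rw [injective_iff_map_eq_zero]
      rintro ⟨y, z⟩ hx
      obtain ⟨h1, h2⟩ := hF.repr_eq_zero hE hM hN hx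
      exact Prod.ext h1 h2
    · intro x
      obtain ⟨y, z, rfl⟩ := hF.exists_repr hE hM hN x
      exact ⟨(y, z), rfl⟩

theorem IsForm.basis_apply (hF : IsForm P ι π U A Z m n h m') (hE : IsExtension ι π)
    (hM : M.IsStandard U A Z m) (hN : N.IsStandard V B W n) (y z : R) :
    hF.basis hE hM hN (y, z) = y • m' + z • ι n := rfl

theorem IsForm.basis_symm (hF : IsForm P ι π U A Z m n h m') (hE : IsExtension ι π)
    (hM : M.IsStandard U A Z m) (hN : N.IsStandard V B W n) (y z : R) :
    (hF.basis hE hM hN).symm (y • m' + z • ι n) = (y, z) := by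
  rw [← hF.basis_apply hE hM hN, LinearEquiv.symm_apply_apply]

/-- An s fixed by φ and by the group defines an endomorphism of N, and the map sends m₁ to m₂ and n
to s n. The case s = 1 compares extensions with the same form; s ∈ k_E gives the pushouts. -/
theorem IsForm.exists_map (hF₁ : IsForm P₁ ι₁ π₁ U A Z m n h m₁) (hE₁ : IsExtension ι₁ π₁)
    {s : R} (hF₂ : IsForm P₂ ι₂ π₂ U A Z m n (s * h) m₂) (hE₂ : IsExtension ι₂ π₂)
    (hM : M.IsStandard U A Z m) (hN : N.IsStandard V B W n)
    (hb : IsCoefficients φ tw V B W W') (hφs : φ s = s) (htw : ∀ g, tw g s = s) :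
    ∃ F : P₁.carrier →ₗ[R] P₂.carrier, P₁.IsHom P₂ F ∧ (∀ y, F (ι₁ y) = ι₂ (s • y)) ∧
      (∀ x, π₂ (F x) = π₁ x) ∧ F m₁ = m₂ := by
  obtain ⟨F, hF⟩ : ∃ F : P₁.carrier →ₗ[R] P₂.carrier, ∀ y z : R,
      F (y • m₁ + z • ι₁ n) = y • m₂ + (s * z) • ι₂ n := by
    refine ⟨(LinearMap.coprod (LinearMap.toSpanSingleton R _ m₂)
      (LinearMap.toSpanSingleton R _ (s • ι₂ n))) ∘ₗ (hF₁.basis hE₁ hM hN).symm.toLinearMap,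
      fun y z => ?_⟩
    rw [LinearMap.comp_apply, LinearEquiv.coe_coe, hF₁.basis_symm]
    change y • m₂ + z • s • ι₂ n = _
    rw [smul_smul, mul_comm]
  have hFn : ∀ z : R, F (z • ι₁ n) = (s * z) • ι₂ n := fun z => by
    simpa using hF 0 z
  have hfil : ∀ y z : R, F (y • (U • m₁ + h • ι₁ n) + z • V • ι₁ n) =
      y • (U • m₂ + (s * h) • ι₂ n) + (s * z) • V • ι₂ n := by
    intro y z
    have : y • (U • m₁ + h • ι₁ n) + z • V • ι₁ n = (y * U) • m₁ + (y * h + z * V) • ι₁ n := by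
      module
    rw [this, hF]
    module
  refine ⟨F, ⟨?_, ?_, ?_⟩, ?_, ?_, ?_⟩
  · intro x hx
    obtain ⟨y, z, rfl⟩ := (hF₁.mem_fil_iff hE₁ hM hN hb).1 hx
    rw [hfil]
    exact (hF₂.mem_fil_iff hE₂ hM hN hb).2 ⟨_, _, rfl⟩
  · rintro ⟨x, hx⟩
    obtain ⟨y, z, rfl⟩ := (hF₁.mem_fil_iff hE₁ hM hN hb).1 hx
    rw [hF₁.phi₁_apply hE₁ hN, hF]
    have hx2 := (hF₂.mem_fil_iff hE₂ hM hN hb).2 ⟨y, s * z, rfl⟩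
    rw [P₂.phi₁_congr (hfil y z) _ hx2, hF₂.phi₁_apply hE₂ hN, map_mul, hφs, mul_assoc]
  · intro g x
    obtain ⟨y, z, rfl⟩ := hF₁.exists_repr hE₁ hM hN x
    rw [hF₁.hat_apply hE₁ hN, hF, hF, hF₂.hat_apply hE₂ hN, map_mul, htw, mul_assoc]
  · intro y
    obtain ⟨z, rfl⟩ := hN.exists_smul y
    rw [map_smul, hFn, map_smul, map_smul, mul_smul]
  · intro x
    obtain ⟨y, z, rfl⟩ := hF₁.exists_repr hE₁ hM hN x
    rw [hF, map_add, map_add, map_smul, map_smul, map_smul, map_smul, hE₁.proj_incl,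
      hE₂.proj_incl, hF₁.proj_eq, hF₂.proj_eq, smul_zero, smul_zero]
  · simpa using hF 1 0

/-- Extensions with the same form are isomorphic. -/
theorem IsForm.exists_equiv (hF₁ : IsForm P₁ ι₁ π₁ U A Z m n h m₁) (hE₁ : IsExtension ι₁ π₁)
    (hF₂ : IsForm P₂ ι₂ π₂ U A Z m n h m₂) (hE₂ : IsExtension ι₂ π₂)
    (hM : M.IsStandard U A Z m) (hN : N.IsStandard V B W n)
    (hb : IsCoefficients φ tw V B W W') :
    ∃ F : P₁.carrier ≃ₗ[R] P₂.carrier, P₁.IsHom P₂ F.toLinearMap ∧ P₂.IsHom P₁ F.symm.toLinearMap ∧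
      (∀ y, F (ι₁ y) = ι₂ y) ∧ ∀ x, π₂ (F x) = π₁ x := by
  obtain ⟨F, h1, h2, h3, h4⟩ := hF₁.exists_map hE₁ (s := 1) (by rwa [one_mul]) hE₂ hM hN hb
    (map_one _) (fun g => map_one _)
  obtain ⟨F', h1', h2', h3', h4'⟩ := hF₂.exists_map hE₂ (s := 1) (by rwa [one_mul]) hE₁ hM hN hb
    (map_one _) (fun g => map_one _)
  have h5 : F ∘ₗ F' = LinearMap.id := by
    refine LinearMap.ext fun x => ?_
    obtain ⟨y, z, rfl⟩ := hF₂.exists_repr hE₂ hM hN x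
    simp only [LinearMap.comp_apply, map_add, map_smul, h4', h4, h2', h2, one_smul,
      LinearMap.id_apply]
  have h6 : F' ∘ₗ F = LinearMap.id := by
    refine LinearMap.ext fun x => ?_
    obtain ⟨y, z, rfl⟩ := hF₁.exists_repr hE₁ hM hN x
    simp only [LinearMap.comp_apply, map_add, map_smul, h4', h4, h2', h2, one_smul,
      LinearMap.id_apply]
  refine ⟨LinearEquiv.ofLinearMap F F' h5 h6, h1, h1', fun y => ?_, h3⟩
  have := h2 y
  rwa [one_smul] at this

/-- Forms are transported along morphisms of extensions. -/
theorem IsForm.map (hF : IsForm P₁ ι₁ π₁ U A Z m n h m₁)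
    {s : R} {F : P₁.carrier →ₗ[R] P₂.carrier} (h1 : P₁.IsHom P₂ F)
    (h2 : ∀ y, F (ι₁ y) = ι₂ (s • y)) (h3 : ∀ x, π₂ (F x) = π₁ x) :
    IsForm P₂ ι₂ π₂ U A Z m n (s * h) (F m₁) := by
  have h4 : F (U • m₁ + h • ι₁ n) = U • F m₁ + (s * h) • ι₂ n := by
    rw [map_add, map_smul, map_smul, h2, map_smul, smul_smul, mul_comm]
  have h5 := h1.map_fil _ hF.mem
  refine ⟨by rw [h3, hF.proj_eq], h4 ▸ h5, fun hm => ?_, fun g => ?_⟩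
  · rw [P₂.phi₁_congr h4.symm hm h5, ← h1.map_phi₁ ⟨_, hF.mem⟩, hF.phi₁_eq, map_smul]
  · rw [← h1.map_hat, hF.hat_eq, map_smul]

/-- The filtration is saturated with respect to multiples `T * U` that kill `P / Fil¹ P`. -/
theorem IsForm.exists_mul_eq (hF : IsForm P ι π U A Z m n h m') (hE : IsExtension ι π)
    (hN : N.IsStandard V B W n) (hb : IsCoefficients φ tw V B W W') {T : R}
    (hT : ∀ x : P.carrier, (T * U) • x ∈ P.fil) : ∃ z, T * h = z * V := by
  apply hE.mem_fil_incl hN hb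
  have h1 : (T * h) • ι n = T • (U • m' + h • ι n) - (T * U) • m' := by module
  rw [h1]
  exact P.fil.sub_mem (P.fil.smul_mem _ hF.mem) (hT _)

/-- All forms of an extension. -/
theorem IsForm.exists_form_iff (hF : IsForm P ι π U A Z m n h m') (hE : IsExtension ι π)
    (hM : M.IsStandard U A Z m) (hN : N.IsStandard V B W n)
    (hb : IsCoefficients φ tw V B W W') {A' : R} (hA : A * A' = 1) (h' : R) :
    (∃ m'', IsForm P ι π U A Z m n h' m'') ↔
      ∃ z, h' = h + z * V - U * (A' * (B * φ z)) ∧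
        ∀ g, tw g (A' * (B * φ z)) * W g = Z g * (A' * (B * φ z)) := by
  constructor
  · rintro ⟨m'', hF'⟩
    -- With m'' = m' + x n, the new generator of Fil¹ must be the old one plus z V n. Comparing the
    -- values of φ₁ gives A x = B φ(z), so z determines x and the change in h.
    obtain ⟨x, hx⟩ := hE.exists_incl hN (x := m'' - m')
      (by rw [map_sub, hF.proj_eq, hF'.proj_eq, sub_self])
    have hx' : m'' = m' + x • ι n := by rw [← hx, add_sub_cancel]
    have h1 : (U * x + h' - h) • ι n = (U • m'' + h' • ι n) - (U • m' + h • ι n) := by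
      rw [hx']; module
    obtain ⟨z, hz⟩ := hE.mem_fil_incl hN hb (h1 ▸ P.fil.sub_mem hF'.mem hF.mem)
    have h2 : U • m'' + h' • ι n = (1 : R) • (U • m' + h • ι n) + z • V • ι n := by
      rw [smul_smul, ← hz, hx']; module
    have h3 := hF'.phi₁_eq hF'.mem
    rw [P.phi₁_congr h2 _ (h2 ▸ hF'.mem), hF.phi₁_apply hE hN, hx', map_one, one_mul, smul_add,
      smul_smul] at h3
    have h4 := (hF.repr_inj hE hM hN h3).2
    have h5 : A' * (B * φ z) = x := by
      rw [mul_comm B, h4, ← mul_assoc, mul_comm A', hA, one_mul]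
    refine ⟨z, ?_, fun g => ?_⟩
    · rw [h5, ← hz]; ring
    · rw [h5]
      have h6 := hF'.hat_eq g
      rw [hx'] at h6
      have h7 := hF.hat_apply hE hN g 1 x
      rw [one_smul, h6, smul_add, smul_smul] at h7
      exact (hF.repr_inj hE hM hN h7).2.symm
  · rintro ⟨z, rfl, hz⟩
    have h1 : U • (m' + (A' * (B * φ z)) • ι n) +
        (h + z * V - U * (A' * (B * φ z))) • ι n =
        (1 : R) • (U • m' + h • ι n) + z • V • ι n := by module
    have h2 : (1 : R) • (U • m' + h • ι n) + z • V • ι n ∈ P.fil :=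
      (hF.mem_fil_iff hE hM hN hb).2 ⟨_, _, rfl⟩
    refine ⟨m' + (A' * (B * φ z)) • ι n, ?_, h1 ▸ h2, fun hm => ?_, fun g => ?_⟩
    · rw [map_add, map_smul, hE.proj_incl, hF.proj_eq, smul_zero, add_zero]
    · rw [P.phi₁_congr h1 hm h2, hF.phi₁_apply hE hN, map_one, one_mul, smul_add, smul_smul,
        ← mul_assoc A, hA, one_mul, mul_comm B]
    · have h3 := hF.hat_apply hE hN g 1 (A' * (B * φ z))
      rw [one_smul, map_one, one_mul, hz] at h3
      rw [h3, smul_add, smul_smul]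

/-- Every extension has a form with an equivariant coefficient. -/
theorem IsExtension.exists_isForm [Fintype G] (hE : IsExtension ι π) (hM : M.IsStandard U A Z m)
    (hN : N.IsStandard V B W n) (ha : IsCoefficients φ tw U A Z Z')
    (hφ : ∀ J : Ideal R, Ideal.span (φ '' (J : Set R)) = ⊤ → J = ⊤)
    (htw : ∀ g h x, tw (g * h) x = tw g (tw h x))
    {ε : R} (hε : ∑ g, tw g ε = 1) :
    ∃ h m', IsForm P ι π U A Z m n h m' ∧ ∀ g, tw g h * W g = Z' g * h := by
  classical
  obtain ⟨A', hA⟩ := ha.isUnit.exists_right_inv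
  choose Y hY using fun g => (ha.isUnit_Z' g).exists_right_inv
  obtain ⟨x₀, hx₀, hπ₀⟩ := hE.exists_lift_fil hM hφ
  have hY' : ∀ g h, tw g (Y h) = Y (g * h) * Z' g := by
    intro g h
    have h1 : tw g (Z' h) * tw g (Y h) = 1 := by rw [← map_mul, hY, map_one]
    have h2 := hY (g * h)
    rw [ha.cocycle] at h2
    linear_combination (tw g (Y h)) * (-h2) + (Z' g * Y (g * h)) * h1
  -- A weighted average of the translates of x₀. The weights `Y g = (Z' g)⁻¹` make it transform by
  -- Z', and ε, of trace one, keeps its image in M equal to U m. No division by the order of the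
  -- group is needed.
  let x : P.carrier := ∑ g, (Y g * tw g ε) • P.hat g x₀
  have hx : x ∈ P.fil := P.fil.sum_mem fun g _ => P.fil.smul_mem _ (P.hat_mem _ _ hx₀)
  have hπ : π x = U • m := by
    simp only [x, map_sum, map_smul, hE.hom_proj.map_hat, hπ₀, M.hat_smul, hM.hat_eq, smul_smul]
    rw [← Finset.sum_smul]
    congr 1
    have h0 : U = ∑ g, tw g ε * U := by rw [← Finset.sum_mul, hε, one_mul]
    refine Eq.trans (Finset.sum_congr rfl fun g _ => ?_) h0.symm
    rw [mul_assoc, ha.tw_U]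
    linear_combination (tw g ε * U) * hY g
  have hhat : ∀ g, P.hat g x = Z' g • x := by
    intro g
    simp only [x, map_sum, P.hat_smul, Finset.smul_sum, map_mul, hY', smul_smul, ← htw,
      ← P.hat_mul]
    refine Fintype.sum_equiv (Equiv.mulLeft g) _ _ fun h => ?_
    rw [Equiv.coe_mulLeft]
    congr 1
    ring
  -- Taking φ₁ of the equivariant lift of U m yields a lift of m transforming by φ(Z') = Z; then h
  -- is read off from x - U m'.
  let m' : P.carrier := A' • P.phi₁ ⟨x, hx⟩
  have hAm : A • m' = P.phi₁ ⟨x, hx⟩ := by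
    simp only [m', smul_smul, hA, one_smul]
  have htA : ∀ g, tw g A' = A' := by
    intro g
    have h1 : A * tw g A' = 1 := by rw [← ha.tw_eq g, ← map_mul, hA, map_one]
    linear_combination A' * h1 - (tw g A') * hA
  have hπm : π m' = m := by
    simp only [m', map_smul, hE.hom_proj.map_phi₁]
    rw [M.phi₁_congr hπ _ hM.gen_mem, hM.phi₁_eq, smul_smul, mul_comm, hA, one_smul]
  obtain ⟨h, hh⟩ := hE.exists_incl hN (x := x - U • m')
    (by rw [map_sub, map_smul, hπm, hπ, sub_self])
  have hxh : U • m' + h • ι n = x := by rw [← hh, add_sub_cancel]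
  have hhatm : ∀ g, P.hat g m' = Z g • m' := by
    intro g
    simp only [m', P.hat_smul, P.hat_phi₁, htA]
    rw [P.phi₁_congr (hhat g) _ (P.fil.smul_mem _ hx), P.phi₁_smul _ _ hx, ha.phi_Z', smul_comm]
  have hF : IsForm P ι π U A Z m n h m' :=
    ⟨hπm, hxh ▸ hx, fun hm => by rw [hAm]; exact P.phi₁_congr hxh _ _, hhatm⟩
  refine ⟨h, m', hF, fun g => ?_⟩
  have h1 := hhat g
  rw [← hxh, hF.hat_apply hE hN, smul_add, smul_smul (Z' g) U, smul_smul (Z' g) h] at h1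
  exact (hF.repr_inj hE hM hN h1).2

/-- Forms add up under Baer sums. -/
theorem IsForm.baer (hF₁ : IsForm P₁ ι₁ π₁ U A Z m n h₁ m₁) (hF₂ : IsForm P₂ ι₂ π₂ U A Z m n h₂ m₂)
    {F : LinearMap.eqLocus (π₁ ∘ₗ LinearMap.fst R P₁.carrier P₂.carrier)
      (π₂ ∘ₗ LinearMap.snd R P₁.carrier P₂.carrier) →ₗ[R] P₃.carrier}
    (hFφ : ∀ (x y : LinearMap.eqLocus (π₁ ∘ₗ LinearMap.fst R P₁.carrier P₂.carrier)
      (π₂ ∘ₗ LinearMap.snd R P₁.carrier P₂.carrier)) (h₁ : x.1.1 ∈ P₁.fil) (h₂ : x.1.2 ∈ P₂.fil),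
      y.1 = (P₁.phi₁ ⟨x.1.1, h₁⟩, P₂.phi₁ ⟨x.1.2, h₂⟩) →
      ∃ h₃ : F x ∈ P₃.fil, F y = P₃.phi₁ ⟨F x, h₃⟩)
    (hFhat : ∀ (g : G) (x y : LinearMap.eqLocus (π₁ ∘ₗ LinearMap.fst R P₁.carrier P₂.carrier)
      (π₂ ∘ₗ LinearMap.snd R P₁.carrier P₂.carrier)), y.1 = (P₁.hat g x.1.1, P₂.hat g x.1.2) →
      F y = P₃.hat g (F x))
    (hFι : ∀ (x : LinearMap.eqLocus (π₁ ∘ₗ LinearMap.fst R P₁.carrier P₂.carrier)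
      (π₂ ∘ₗ LinearMap.snd R P₁.carrier P₂.carrier)) (y₁ y₂ : N.carrier),
      x.1 = (ι₁ y₁, ι₂ y₂) → F x = ι₃ (y₁ + y₂))
    (hFπ : ∀ x, π₃ (F x) = π₁ x.1.1) (hE₁ : IsExtension ι₁ π₁) (hE₂ : IsExtension ι₂ π₂) :
    ∃ m₃, IsForm P₃ ι₃ π₃ U A Z m n (h₁ + h₂) m₃ := by
  let x₀ : LinearMap.eqLocus (π₁ ∘ₗ LinearMap.fst R P₁.carrier P₂.carrier)
      (π₂ ∘ₗ LinearMap.snd R P₁.carrier P₂.carrier) := ⟨(m₁, m₂), by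
    change π₁ m₁ = π₂ m₂
    rw [hF₁.proj_eq, hF₂.proj_eq]⟩
  let x₁ : LinearMap.eqLocus (π₁ ∘ₗ LinearMap.fst R P₁.carrier P₂.carrier)
      (π₂ ∘ₗ LinearMap.snd R P₁.carrier P₂.carrier) := ⟨(h₁ • ι₁ n, h₂ • ι₂ n), by
    change π₁ (h₁ • ι₁ n) = π₂ (h₂ • ι₂ n)
    rw [map_smul, map_smul, hE₁.proj_incl, hE₂.proj_incl, smul_zero, smul_zero]⟩
  have h1 : F x₁ = (h₁ + h₂) • ι₃ n := by
    rw [hFι x₁ (h₁ • n) (h₂ • n) (by simp only [x₁, map_smul]), ← add_smul, map_smul]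
  have h2 : F (U • x₀ + x₁) = U • F x₀ + (h₁ + h₂) • ι₃ n := by rw [map_add, map_smul, h1]
  -- The components of U x₀ + x₁ are the generators U m_i + h_i n of the two filtrations, and φ₁
  -- maps this pair to A x₀.
  obtain ⟨h3, h4⟩ := hFφ (U • x₀ + x₁) (A • x₀) hF₁.mem hF₂.mem
    (Prod.ext (hF₁.phi₁_eq _).symm (hF₂.phi₁_eq _).symm)
  refine ⟨F x₀, ?_, h2 ▸ h3, fun hm => ?_, fun g => ?_⟩
  · rw [hFπ]; exact hF₁.proj_eq
  · rw [P₃.phi₁_congr h2.symm hm h3, ← h4, map_smul]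
  · rw [← hFhat g x₀ (Z g • x₀) (Prod.ext (hF₁.hat_eq g).symm (hF₂.hat_eq g).symm), map_smul]

/-- Extensions with forms `h₁`, `h₂` have the extension with form `h₁ + h₂` as Baer sum. -/
theorem IsForm.exists_baer (hF₁ : IsForm P₁ ι₁ π₁ U A Z m n h₁ m₁)
    (hF₂ : IsForm P₂ ι₂ π₂ U A Z m n h₂ m₂) (hF₃ : IsForm P₃ ι₃ π₃ U A Z m n (h₁ + h₂) m₃)
    (hE₁ : IsExtension ι₁ π₁) (hE₂ : IsExtension ι₂ π₂) (hE₃ : IsExtension ι₃ π₃)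
    (hM : M.IsStandard U A Z m) (hN : N.IsStandard V B W n)
    (ha : IsCoefficients φ tw U A Z Z') (hb : IsCoefficients φ tw V B W W') :
    ∃ F : LinearMap.eqLocus (π₁ ∘ₗ LinearMap.fst R P₁.carrier P₂.carrier)
      (π₂ ∘ₗ LinearMap.snd R P₁.carrier P₂.carrier) →ₗ[R] P₃.carrier,
    (∀ (x y : LinearMap.eqLocus (π₁ ∘ₗ LinearMap.fst R P₁.carrier P₂.carrier)
      (π₂ ∘ₗ LinearMap.snd R P₁.carrier P₂.carrier)) (h₁ : x.1.1 ∈ P₁.fil) (h₂ : x.1.2 ∈ P₂.fil),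
      y.1 = (P₁.phi₁ ⟨x.1.1, h₁⟩, P₂.phi₁ ⟨x.1.2, h₂⟩) →
      ∃ h₃ : F x ∈ P₃.fil, F y = P₃.phi₁ ⟨F x, h₃⟩) ∧
    (∀ (g : G) (x y : LinearMap.eqLocus (π₁ ∘ₗ LinearMap.fst R P₁.carrier P₂.carrier)
      (π₂ ∘ₗ LinearMap.snd R P₁.carrier P₂.carrier)), y.1 = (P₁.hat g x.1.1, P₂.hat g x.1.2) →
      F y = P₃.hat g (F x)) ∧
    (∀ (x : LinearMap.eqLocus (π₁ ∘ₗ LinearMap.fst R P₁.carrier P₂.carrier)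
      (π₂ ∘ₗ LinearMap.snd R P₁.carrier P₂.carrier)) (y₁ y₂ : N.carrier),
      x.1 = (ι₁ y₁, ι₂ y₂) → F x = ι₃ (y₁ + y₂)) ∧
    ∀ x, π₃ (F x) = π₁ x.1.1 := by
  -- The formula ignores y₂. This is harmless, since y₁ = y₂ on the fibre product.
  obtain ⟨F', hF'⟩ : ∃ F' : (P₁.carrier × P₂.carrier) →ₗ[R] P₃.carrier, ∀ y₁ z₁ y₂ z₂ : R,
      F' (y₁ • m₁ + z₁ • ι₁ n, y₂ • m₂ + z₂ • ι₂ n) = y₁ • m₃ + (z₁ + z₂) • ι₃ n := by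
    refine ⟨LinearMap.coprod
      (LinearMap.coprod (LinearMap.toSpanSingleton R _ m₃)
      (LinearMap.toSpanSingleton R _ (ι₃ n)) ∘ₗ (hF₁.basis hE₁ hM hN).symm.toLinearMap)
      (LinearMap.toSpanSingleton R _ (ι₃ n) ∘ₗ LinearMap.snd R R R ∘ₗ
        (hF₂.basis hE₂ hM hN).symm.toLinearMap), fun y₁ z₁ y₂ z₂ => ?_⟩
    rw [LinearMap.coprod_apply]
    simp only [LinearMap.comp_apply, LinearEquiv.coe_coe, hF₁.basis_symm, hF₂.basis_symm]
    change y₁ • m₃ + z₁ • ι₃ n + z₂ • ι₃ n = _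
    module
  have hrepr : ∀ x : LinearMap.eqLocus (π₁ ∘ₗ LinearMap.fst R P₁.carrier P₂.carrier)
      (π₂ ∘ₗ LinearMap.snd R P₁.carrier P₂.carrier), ∃ y z₁ z₂ : R,
      x.1 = (y • m₁ + z₁ • ι₁ n, y • m₂ + z₂ • ι₂ n) := by
    rintro ⟨⟨x₁, x₂⟩, hx⟩
    change π₁ x₁ = π₂ x₂ at hx
    obtain ⟨y₁, z₁, rfl⟩ := hF₁.exists_repr hE₁ hM hN x₁
    obtain ⟨y₂, z₂, rfl⟩ := hF₂.exists_repr hE₂ hM hN x₂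
    simp only [map_add, map_smul, hE₁.proj_incl, hE₂.proj_incl, smul_zero, add_zero, hF₁.proj_eq,
      hF₂.proj_eq] at hx
    obtain rfl := hM.smul_inj hx
    exact ⟨y₁, z₁, z₂, rfl⟩
  refine ⟨F' ∘ₗ Submodule.subtype _, ?_, ?_, ?_, ?_⟩
  · rintro ⟨⟨x₁, x₂⟩, hx⟩ y hx₁ hx₂ hy
    have hx0 := hx
    change π₁ x₁ = π₂ x₂ at hx
    obtain ⟨y₁, z₁, rfl⟩ := (hF₁.mem_fil_iff hE₁ hM hN hb).1 hx₁
    obtain ⟨y₂, z₂, rfl⟩ := (hF₂.mem_fil_iff hE₂ hM hN hb).1 hx₂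
    simp only [map_add, map_smul, hE₁.proj_incl, hE₂.proj_incl, smul_zero, add_zero, hF₁.proj_eq,
      hF₂.proj_eq, smul_smul] at hx
    -- Only y₁ U = y₂ U is known, as U is a zero divisor in general. The discrepancy (y₂ - y₁) h₂ n
    -- lies in Fil¹ N, hence equals z V n, and φ(y₂ - y₁) = 0 forces φ(z) B = 0, so φ₁ does not see
    -- it.
    have hU : (y₂ - y₁) * U = 0 := by rw [sub_mul, hM.smul_inj hx, sub_self]
    have h0 : (y₂ - y₁) • (U • m₂ + h₂ • ι₂ n) = ((y₂ - y₁) * h₂) • ι₂ n := by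
      rw [smul_add, smul_smul, hU, zero_smul, zero_add, smul_smul]
    have h0m := P₂.fil.smul_mem (y₂ - y₁) hF₂.mem
    obtain ⟨z, hz⟩ := hE₂.mem_fil_incl hN hb (h0 ▸ h0m)
    have hφy : φ (y₂ - y₁) = 0 := ha.phi_eq_zero _ hU
    have hφz : φ z * B = 0 := by
      have h3 : (y₂ - y₁) • (U • m₂ + h₂ • ι₂ n) =
          (0 : R) • (U • m₂ + h₂ • ι₂ n) + z • V • ι₂ n := by
        rw [h0, hz]; module
      have h4 := P₂.phi₁_congr h3 h0m (h3 ▸ h0m)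
      rw [P₂.phi₁_smul _ _ hF₂.mem, hφy, zero_smul, hF₂.phi₁_apply hE₂ hN, map_zero, zero_mul,
        zero_smul, zero_add] at h4
      exact hE₂.incl_smul_eq_zero hN h4.symm
    have h5 : F' (y₁ • (U • m₁ + h₁ • ι₁ n) + z₁ • V • ι₁ n,
        y₂ • (U • m₂ + h₂ • ι₂ n) + z₂ • V • ι₂ n) =
        y₁ • (U • m₃ + (h₁ + h₂) • ι₃ n) + (z₁ + z₂ + z) • V • ι₃ n := by
      have h6 : y₁ • (U • m₁ + h₁ • ι₁ n) + z₁ • V • ι₁ n =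
        (y₁ * U) • m₁ + (y₁ * h₁ + z₁ * V) • ι₁ n := by module
      have h7 : y₂ • (U • m₂ + h₂ • ι₂ n) + z₂ • V • ι₂ n =
        (y₂ * U) • m₂ + (y₁ * h₂ + z * V + z₂ * V) • ι₂ n := by
        rw [← hz]; module
      rw [h6, h7, hF']
      module
    have h8 : y₁ • (U • m₃ + (h₁ + h₂) • ι₃ n) + (z₁ + z₂ + z) • V • ι₃ n ∈ P₃.fil :=
      (hF₃.mem_fil_iff hE₃ hM hN hb).2 ⟨_, _, rfl⟩
    have h9 : (F' ∘ₗ Submodule.subtype _) ⟨_, hx0⟩ = _ := h5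
    refine ⟨h9 ▸ h8, ?_⟩
    rw [P₃.phi₁_congr h9 _ h8, hF₃.phi₁_apply hE₃ hN, LinearMap.comp_apply, Submodule.subtype_apply,
      hy, hF₁.phi₁_apply hE₁ hN, hF₂.phi₁_apply hE₂ hN, hF', map_add, map_add, add_mul, add_mul,
      hφz, add_zero]
  · rintro g x y hy
    obtain ⟨c, z₁, z₂, hx⟩ := hrepr x
    simp only [LinearMap.comp_apply, Submodule.subtype_apply]
    rw [hy, hx, hF', hF₁.hat_apply hE₁ hN, hF₂.hat_apply hE₂ hN, hF', hF₃.hat_apply hE₃ hN,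
      map_add, add_mul]
  · rintro x y₁ y₂ hx
    simp only [LinearMap.comp_apply, Submodule.subtype_apply]
    obtain ⟨a, rfl⟩ := hN.exists_smul y₁
    obtain ⟨b, rfl⟩ := hN.exists_smul y₂
    have := hF' 0 a 0 b
    simp only [zero_smul, zero_add] at this
    rw [hx, map_smul, map_smul, this, ← add_smul, map_smul]
  · rintro x
    obtain ⟨c, z₁, z₂, hx⟩ := hrepr x
    simp only [LinearMap.comp_apply, Submodule.subtype_apply]
    rw [hx, hF', map_add, map_add, map_smul, map_smul, map_smul, map_smul, hE₁.proj_incl,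
      hE₃.proj_incl, hF₁.proj_eq, hF₃.proj_eq, smul_zero, smul_zero]

end Form

end Extension

end PhiModule

end Abstract

/-! ### Construction of the extension attached to h -/

namespace PhiModule

universe u'

variable {R : Type u'} [CommRing R] {φ : R →+* R} {G : Type t} [Group G] {tw : G → R →+* R}
variable {M N : PhiModule.{t, w} φ tw}

section Construction

variable {U A V B : R} {Z Z' W W' : G → R} {m : M.carrier} {n : N.carrier}

/-- The parametrization of `Fil¹` in the extension given by `h`. -/
noncomputable def formMap (M N : PhiModule.{t, w} φ tw) (U V h : R) (m : M.carrier)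
    (n : N.carrier) : (R × R) →ₗ[R] (M.carrier × N.carrier) :=
  LinearMap.coprod (LinearMap.toSpanSingleton R _ (U • m, h • n))
    (LinearMap.toSpanSingleton R _ (0, V • n))

theorem formMap_apply (U V h : R) (m : M.carrier) (n : N.carrier) (x : R × R) :
    formMap M N U V h m n x = ((x.1 * U) • m, (x.1 * h + x.2 * V) • n) := by
  refine Prod.ext ?_ ?_
  · change x.1 • U • m + x.2 • (0 : M.carrier) = _
    rw [smul_zero, add_zero, mul_smul]
  · change x.1 • h • n + x.2 • V • n = _
    module

/-- The values of `φ₁` in the extension given by `h`. -/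
noncomputable def formPhi (φ : R →+* R) {tw : G → R →+* R} (M N : PhiModule.{t, w} φ tw) (A B : R)
    (m : M.carrier) (n : N.carrier) (x : R × R) : M.carrier × N.carrier :=
  ((φ x.1 * A) • m, (φ x.2 * B) • n)

/-- The parametrization of Fil¹ by R × R has a kernel because U and V may be zero divisors. The
hypotheses say that φ kills the coordinates of that kernel, so φ₁ is well defined. -/
theorem formPhi_eq {h : R} (hM : M.IsStandard U A Z m) (hN : N.IsStandard V B W n)
    (ha : IsCoefficients φ tw U A Z Z')
    (hh : ∀ y z, y * U = 0 → y * h + z * V = 0 → φ z = 0) {x y : R × R}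
    (hxy : formMap M N U V h m n x = formMap M N U V h m n y) :
    formPhi φ M N A B m n x = formPhi φ M N A B m n y := by
  rw [formMap_apply, formMap_apply, Prod.mk.injEq] at hxy
  have h1 : (x.1 - y.1) * U = 0 := by rw [sub_mul, hM.smul_inj hxy.1, sub_self]
  have h2 : (x.1 - y.1) * h + (x.2 - y.2) * V = 0 := by
    have := hN.smul_inj hxy.2
    linear_combination this
  have h3 := ha.phi_eq_zero _ h1
  have h4 := hh _ _ h1 h2
  rw [map_sub, sub_eq_zero] at h3 h4
  rw [formPhi, formPhi, h3, h4]

/-- The extension of `M` by `N` given by `h`. -/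
noncomputable def extensionOf (hM : M.IsStandard U A Z m) (hN : N.IsStandard V B W n)
    (ha : IsCoefficients φ tw U A Z Z') (hb : IsCoefficients φ tw V B W W')
    (hcomm : ∀ g x, φ (tw g x) = tw g (φ x)) (h : R)
    (hh : ∀ y z, y * U = 0 → y * h + z * V = 0 → φ z = 0)
    (heq : ∀ g, tw g h * W g = Z' g * h) : PhiModule.{t, w} φ tw :=
  have key : ∀ (x : LinearMap.range (formMap M N U V h m n)) (y : R × R),
      formMap M N U V h m n y = x →
      formPhi φ M N A B m n x.2.choose = formPhi φ M N A B m n y := fun x y hy =>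
    formPhi_eq hM hN ha hh (x.2.choose_spec.trans hy.symm)
  -- On the parameters of Fil¹ the group acts through Z' and W'; the equivariance of h is what makes
  -- the mixed term fit.
  have hat_form : ∀ g x, (M.hat g).prodCongr (N.hat g) (formMap M N U V h m n x) =
      formMap M N U V h m n (tw g x.1 * Z' g, tw g x.2 * W' g) := by
    intro g x
    rw [formMap_apply, formMap_apply]
    refine Prod.ext ?_ ?_
    · change M.hat g _ = _
      rw [M.hat_smul, hM.hat_eq, smul_smul, map_mul]
      congr 1
      linear_combination (tw g x.1) * ha.tw_U g
    · change N.hat g _ = _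
      rw [N.hat_smul, hN.hat_eq, smul_smul, map_add, map_mul, map_mul]
      congr 1
      linear_combination (tw g x.1) * heq g + (tw g x.2) * hb.tw_U g
  { carrier := M.carrier × N.carrier
    fil := LinearMap.range (formMap M N U V h m n)
    phi₁ :=
      { toFun := fun x => formPhi φ M N A B m n x.2.choose
        map_add' := fun x y => by
          rw [key (x + y) (x.2.choose + y.2.choose)
            (by rw [map_add, x.2.choose_spec, y.2.choose_spec]; rfl)]
          refine Prod.ext ?_ ?_
          · change (φ (_ + _) * A) • m = (φ _ * A) • m + (φ _ * A) • m
            rw [map_add, add_mul, add_smul]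
          · change (φ (_ + _) * B) • n = (φ _ * B) • n + (φ _ * B) • n
            rw [map_add, add_mul, add_smul]
        map_smul' := fun c x => by
          rw [key (c • x) (c • x.2.choose) (by rw [map_smul, x.2.choose_spec]; rfl)]
          refine Prod.ext ?_ ?_
          · change (φ (c * _) * A) • m = φ c • (φ _ * A) • m
            rw [map_mul, smul_smul, mul_assoc]
          · change (φ (c * _) * B) • n = φ c • (φ _ * B) • n
            rw [map_mul, smul_smul, mul_assoc] }
    span_range_phi₁ := by
      rw [eq_top_iff]
      rintro ⟨x, y⟩ -
      obtain ⟨a, rfl⟩ := hM.exists_smul x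
      obtain ⟨b, rfl⟩ := hN.exists_smul y
      obtain ⟨A', hA⟩ := ha.isUnit.exists_right_inv
      obtain ⟨B', hB⟩ := hb.isUnit.exists_right_inv
      have h1 := key ⟨_, ⟨(1, 0), rfl⟩⟩ (1, 0) rfl
      have h2 := key ⟨_, ⟨(0, 1), rfl⟩⟩ (0, 1) rfl
      have h3 : ((a • m, b • n) : M.carrier × N.carrier) =
          (a * A') • formPhi φ M N A B m n (1, 0) +
          (b * B') • formPhi φ M N A B m n (0, 1) := by
        refine Prod.ext ?_ ?_
        · change a • m = (a * A') • (φ 1 * A) • m + (b * B') • (φ 0 * A) • m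
          rw [map_one, map_zero, smul_smul, smul_smul, ← add_smul]
          congr 1
          linear_combination (-a) * hA
        · change b • n = (a * A') • (φ 0 * B) • n + (b * B') • (φ 1 * B) • n
          rw [map_one, map_zero, smul_smul, smul_smul, ← add_smul]
          congr 1
          linear_combination (-b) * hB
      rw [h3, ← h1, ← h2]
      exact Submodule.add_mem _ (Submodule.smul_mem _ _ (Submodule.subset_span ⟨_, rfl⟩))
        (Submodule.smul_mem _ _ (Submodule.subset_span ⟨_, rfl⟩))
    hat := fun g => (M.hat g).prodCongr (N.hat g)
    hat_one := fun x => Prod.ext (M.hat_one _) (N.hat_one _)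
    hat_mul := fun g₁ g₂ x => Prod.ext (M.hat_mul g₁ g₂ _) (N.hat_mul g₁ g₂ _)
    hat_smul := fun g a x => Prod.ext (M.hat_smul g a _) (N.hat_smul g a _)
    hat_mem := by
      rintro g _ ⟨x, rfl⟩
      exact ⟨_, (hat_form g x).symm⟩
    hat_phi₁ := by
      rintro g ⟨_, ⟨x, rfl⟩⟩
      change (M.hat g).prodCongr (N.hat g) (formPhi φ M N A B m n _) = formPhi φ M N A B m n _
      rw [key _ x rfl, key _ _ (hat_form g x).symm]
      refine Prod.ext ?_ ?_
      · change M.hat g ((φ x.1 * A) • m) = (φ (tw g x.1 * Z' g) * A) • m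
        rw [M.hat_smul, hM.hat_eq, smul_smul, map_mul, map_mul, ha.tw_eq, ha.phi_Z', hcomm]
        congr 1
        ring
      · change N.hat g ((φ x.2 * B) • n) = (φ (tw g x.2 * W' g) * B) • n
        rw [N.hat_smul, hN.hat_eq, smul_smul, map_mul, map_mul, hb.tw_eq, hb.phi_Z', hcomm]
        congr 1
        ring }

variable (hM : M.IsStandard U A Z m) (hN : N.IsStandard V B W n)
  (ha : IsCoefficients φ tw U A Z Z') (hb : IsCoefficients φ tw V B W W')
  (hcomm : ∀ g x, φ (tw g x) = tw g (φ x)) (h : R)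
  (hh : ∀ y z, y * U = 0 → y * h + z * V = 0 → φ z = 0)
  (heq : ∀ g, tw g h * W g = Z' g * h)

theorem extensionOf_phi₁ (x : R × R)
    (hx : formMap M N U V h m n x ∈ (extensionOf hM hN ha hb hcomm h hh heq).fil) :
    (extensionOf hM hN ha hb hcomm h hh heq).phi₁ ⟨formMap M N U V h m n x, hx⟩ =
      formPhi φ M N A B m n x :=
  formPhi_eq hM hN ha hh hx.choose_spec

theorem extensionOf_phi₁' (x : R × R) {y : M.carrier × N.carrier}
    (hy : formMap M N U V h m n x = y)
    (hx : y ∈ (extensionOf hM hN ha hb hcomm h hh heq).fil) :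
    (extensionOf hM hN ha hb hcomm h hh heq).phi₁ ⟨y, hx⟩ = formPhi φ M N A B m n x := by
  subst hy
  exact extensionOf_phi₁ hM hN ha hb hcomm h hh heq x hx

theorem extensionOf_isExtension : IsExtension
    (P := extensionOf hM hN ha hb hcomm h hh heq)
    (LinearMap.inr R M.carrier N.carrier) (LinearMap.fst R M.carrier N.carrier) where
  hom_incl :=
    { map_fil := fun x hx => by
        obtain ⟨z, rfl⟩ := hN.exists_smul x
        obtain ⟨y, rfl⟩ := hN.mem_fil.1 hx
        refine ⟨(0, y), ?_⟩
        rw [formMap_apply, zero_mul, zero_mul, zero_smul, zero_add]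
        rfl
      map_phi₁ := by
        rintro ⟨x, hx⟩
        obtain ⟨z, rfl⟩ := hN.exists_smul x
        obtain ⟨y, rfl⟩ := hN.mem_fil.1 hx
        refine Eq.trans ?_ (extensionOf_phi₁' hM hN ha hb hcomm h hh heq (0, y)
          (y := LinearMap.inr R M.carrier N.carrier ((y * V) • n)) ?_ _).symm
        · rw [N.phi₁_congr (mul_smul y V n) _ (N.fil.smul_mem _ hN.gen_mem), hN.phi₁_apply]
          refine Prod.ext ?_ ?_
          · change (0 : M.carrier) = (φ 0 * A) • m
            rw [map_zero, zero_mul, zero_smul]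
          · exact smul_smul _ _ _
        · rw [formMap_apply, zero_mul, zero_mul, zero_smul, zero_add]
          rfl
      map_hat := fun g x => Prod.ext (map_zero (M.hat g)).symm rfl }
  hom_proj :=
    { map_fil := by
        rintro _ ⟨x, rfl⟩
        rw [formMap_apply]
        exact hM.mem_fil.2 ⟨_, rfl⟩
      map_phi₁ := by
        rintro ⟨_, ⟨x, rfl⟩⟩
        refine Eq.trans (congrArg Prod.fst
          (extensionOf_phi₁ hM hN ha hb hcomm h hh heq x ⟨x, rfl⟩)) ?_
        have h1 : (LinearMap.fst R M.carrier N.carrier) (formMap M N U V h m n x) =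
          x.1 • U • m := by rw [formMap_apply, ← mul_smul]; rfl
        have h2 := M.fil.smul_mem x.1 hM.gen_mem
        refine Eq.trans ?_ (M.phi₁_congr h1 (h1 ▸ h2) h2).symm
        rw [hM.phi₁_apply]
        exact mul_smul _ _ _
      map_hat := fun g x => rfl }
  injective := fun x y hxy => congrArg Prod.snd hxy
  surjective := fun x => ⟨(x, 0), rfl⟩
  exact := fun x => by
    constructor
    · intro hx
      exact ⟨x.2, Prod.ext (Eq.symm hx) rfl⟩
    · rintro ⟨y, rfl⟩
      rfl

theorem extensionOf_isForm : IsForm (M := M) (N := N)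
    (extensionOf hM hN ha hb hcomm h hh heq)
    (LinearMap.inr R M.carrier N.carrier) (LinearMap.fst R M.carrier N.carrier)
    U A Z m n h ((m, 0) : M.carrier × N.carrier) := by
  have h1 : formMap M N U V h m n (1, 0) = U • ((m, 0) : M.carrier × N.carrier) +
      h • LinearMap.inr R M.carrier N.carrier n := by
    rw [formMap_apply]
    refine Prod.ext ?_ ?_
    · change (1 * U) • m = U • m + h • (0 : M.carrier)
      rw [one_mul, smul_zero, add_zero]
    · change (1 * h + 0 * V) • n = U • (0 : N.carrier) + h • n
      rw [one_mul, zero_mul, smul_zero, add_zero, zero_add]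
  refine ⟨rfl, ⟨(1, 0), h1⟩, fun hm => ?_, fun g => ?_⟩
  · refine (extensionOf_phi₁' hM hN ha hb hcomm h hh heq (1, 0) h1 hm).trans ?_
    refine Prod.ext ?_ ?_
    · change (φ 1 * A) • m = A • m
      rw [map_one, one_mul]
    · change (φ 0 * B) • n = A • (0 : N.carrier)
      rw [map_zero, zero_mul, zero_smul, smul_zero]
  · refine Prod.ext (hM.hat_eq g) ?_
    change N.hat g 0 = Z g • (0 : N.carrier)
    rw [map_zero, smul_zero]

/-- For T = u^{e-r} and S = u^{e-s} both T U and S V are u^e. Multiplying the generator U m + h n by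
T produces u^e m + q V n, whose second term lies in Fil¹ and can be subtracted. -/
theorem extensionOf_smul_mem {T S q : R} (hT : T * U = S * V) (hq : T * h = q * V)
    (x : M.carrier × N.carrier) :
    (T * U) • x ∈ (extensionOf hM hN ha hb hcomm h hh heq).fil := by
  obtain ⟨x, y⟩ := x
  obtain ⟨a, rfl⟩ := hM.exists_smul x
  obtain ⟨b, rfl⟩ := hN.exists_smul y
  refine ⟨(a * T, b * S - a * q), ?_⟩
  rw [formMap_apply]
  refine Prod.ext ?_ ?_
  · change (a * T * U) • m = (T * U) • a • m
    rw [smul_smul]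
    congr 1
    ring
  · change (a * T * h + (b * S - a * q) * V) • n = (T * U) • b • n
    rw [smul_smul, hT]
    congr 1
    linear_combination a * hq

end Construction

end PhiModule

/-! ### The Galois action in coordinates -/

section Descent

variable {p : ℕ} [Fact p.Prime] {k kE : Type*} [Field k] [Field kE]
variable [Algebra (ZMod p) k] [Algebra (ZMod p) kE]
variable {G : Type*} [Group G]

/-- The properties of the action of `Gal(K/L)` on the residue field `k` and of the function `η` that
hold in the tamely ramified case: `f` and `f'` are the degrees of `k` and `ℓ` over `𝔽_p`, and `n` is
the ramification index. -/
structure IsTameDatum (p f f' n : ℕ) (act : G →* RingAut k) (η : G → kˣ) : Prop where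
  pos : 0 < n
  not_dvd : ¬ p ∣ n
  deg_pos : 0 < f'
  deg_dvd : f' ∣ f
  exists_frob : ∀ g, ∃ l : ℕ, ∀ x, act g x = x ^ p ^ (f' * l)
  card_frob : ∀ l : ℕ, Nat.card {g : G // ∀ x, act g x = x ^ p ^ (f' * l)} = n
  eta_pow : ∀ g, η g ^ n = 1
  eta_mul : ∀ g h, (η (g * h) : k) = act g (η h) * η g
  dvd_of_inertia : ∀ j : ℕ, (∀ g, (∀ x, act g x = x) → η g ^ j = 1) → n ∣ j

variable {e f f' n : ℕ} {σ : ℤ → k →+* kE} (hσ : IsFrobeniusSystem p f σ)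
variable {act : G →* RingAut k} {η : G → kˣ} (hG : IsTameDatum p f f' n act η)

theorem IsTameDatum.pow_eq_pow (hG : IsTameDatum p f f' n act η) (g : G) (s : k →+* kE) {a b : ℕ}
    (h : (a : ZMod n) = b) : s (η g) ^ a = s (η g) ^ b := by
  rw [ZMod.natCast_eq_natCast_iff] at h
  rw [← map_pow, ← map_pow, ← Units.val_pow_eq_pow_val, ← Units.val_pow_eq_pow_val,
    pow_eq_pow_of_modEq h (hG.eta_pow g)]

theorem IsTameDatum.periodic (hG : IsTameDatum p f f' n act η) {α : Type*} {F : ℤ → α}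
    (hF : Function.Periodic F f') : Function.Periodic F f := by
  obtain ⟨q, rfl⟩ := hG.deg_dvd
  have := hF.nat_mul q
  push_cast
  rwa [mul_comm]

theorem IsTameDatum.exists_coef_twist (hG : IsTameDatum p f f' n act η)
    (hσ : IsFrobeniusSystem p f σ) (g : G) : ∃ l : ℕ, (∀ x, act g x = x ^ p ^ (f' * l)) ∧
    ∀ (i : ℤ) (j : ℕ) (x : BreuilRing p e k kE),
      coef (σ i) j (twist p e kE (act g) (η g) x) =
        σ i (η g) ^ j * coef (σ (i - f' * l)) j x := by
  obtain ⟨l, hl⟩ := hG.exists_frob g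
  refine ⟨l, hl, fun i j x => ?_⟩
  have := hσ.coef_twist (e := e) (act g) (η g) (f' * l) hl (i - f' * l) j x
  push_cast at this
  rwa [sub_add_cancel] at this

theorem IsTameDatum.neZero (hG : IsTameDatum p f f' n act η) : NeZero n := ⟨hG.pos.ne'⟩

variable [Finite kE]

theorem IsTameDatum.twist_mul (hG : IsTameDatum p f f' n act η) (hσ : IsFrobeniusSystem p f σ)
    (g h : G) (x : BreuilRing p e k kE) :
    twist p e kE (act (g * h)) (η (g * h)) x =
      twist p e kE (act g) (η g) (twist p e kE (act h) (η h) x) := by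
  refine hσ.coef_ext fun i j _ => ?_
  obtain ⟨a, ha, hat⟩ := hG.exists_coef_twist (e := e) hσ g
  obtain ⟨b, hb, hbt⟩ := hG.exists_coef_twist (e := e) hσ h
  have hab : ∀ y, act (g * h) y = y ^ p ^ (f' * (a + b)) := by
    intro y
    rw [map_mul, RingAut.mul_apply, hb, map_pow, ha, ← pow_mul, ← pow_add, mul_add]
  have := hσ.coef_twist (e := e) (act (g * h)) (η (g * h)) (f' * (a + b)) hab
    (i - f' * (a + b)) j x
  push_cast at this
  rw [sub_add_cancel] at this
  have h1 : σ i (act g (η h)) = σ (i - f' * a) (η h) := by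
    rw [ha]
    have := hσ.apply_pow (i - f' * a) (f' * a) (η h)
    push_cast at this
    rwa [sub_add_cancel] at this
  rw [this, hat, hbt, hG.eta_mul, map_mul, h1]
  have h2 : i - (f' : ℤ) * (a + b) = i - f' * a - f' * b := by ring
  rw [h2]
  ring

/-- A term of degree q at index i - 1 moves to degree pq at index i, and its factors agree because
σ_i(η)^{pq} = σ_{i-1}(η)^q. -/
theorem IsTameDatum.phi_twist (hG : IsTameDatum p f f' n act η) (hσ : IsFrobeniusSystem p f σ)
    (g : G) (x : BreuilRing p e k kE) :
    phi p e k kE (twist p e kE (act g) (η g) x) =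
      twist p e kE (act g) (η g) (phi p e k kE x) := by
  refine hσ.coef_ext fun i j _ => ?_
  obtain ⟨a, ha, hat⟩ := hG.exists_coef_twist (e := e) hσ g
  have h1 := hσ.coef_phi (i - 1) j (twist p e kE (act g) (η g) x)
  have h2 := hσ.coef_phi (i - 1 - f' * a) j x
  rw [sub_add_cancel] at h1
  rw [h1, hat, hat]
  have h3 : i - 1 - (f' : ℤ) * a + 1 = i - f' * a := by ring
  rw [h3] at h2
  rw [h2]
  split_ifs with h
  · obtain ⟨⟨q, rfl⟩, -⟩ := h
    rw [Nat.mul_div_cancel_left _ (Fact.out : p.Prime).pos, pow_mul]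
    have := hσ.frob (i - 1) (η g)
    rw [sub_add_cancel] at this
    rw [this]
  · rw [mul_zero]

theorem coef_scalar (s : k →+* kE) (j : ℕ) (t : kE) :
    coef s j (scalar p e k t) = if j = 0 ∧ 0 < e * p then t else 0 := by
  rw [scalar, coef_mk, map_C, coeff_C]
  by_cases h : j = 0 <;> simp [h]

theorem phi_scalar (hσ : IsFrobeniusSystem p f σ) (s : kE) :
    phi p e k kE (scalar p e k s) = scalar p e k s := by
  refine hσ.coef_ext fun i j hj => ?_
  have h1 := hσ.coef_phi (i - 1) j (scalar p e k s)
  rw [sub_add_cancel] at h1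
  rw [h1]
  have hp := (Fact.out : p.Prime)
  rw [coef_scalar, coef_scalar]
  rcases eq_or_ne j 0 with rfl | h
  · simp [hj]
  · rw [if_neg (show ¬ (j = 0 ∧ 0 < e * p) by simp [h])]
    by_cases h3 : p ∣ j
    · have h5 : j / p ≠ 0 := by
        rw [Ne, Nat.div_eq_zero_iff_lt hp.pos, not_lt]
        exact Nat.le_of_dvd (by omega) h3
      simp [h5]
    · simp [h3]

theorem IsTameDatum.twist_scalar (hG : IsTameDatum p f f' n act η)
    (hσ : IsFrobeniusSystem p f σ) (g : G) (s : kE) :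
    twist p e kE (act g) (η g) (scalar p e k s) = scalar p e k s := by
  refine hσ.coef_ext fun i j hj => ?_
  obtain ⟨a, ha, hat⟩ := hG.exists_coef_twist (e := e) hσ g
  rw [hat, coef_scalar, coef_scalar]
  rcases eq_or_ne j 0 with rfl | h
  · simp
  · simp [h]

theorem IsFrobeniusSystem.pow_eq_iff (hσ : IsFrobeniusSystem p f σ) (a b : ℕ) :
    (∀ x : k, x ^ p ^ a = x ^ p ^ b) ↔ (f : ℤ) ∣ a - b := by
  have h : ∀ (a : ℕ) (x : k), σ 0 (x ^ p ^ a) = σ (-a) x := fun a x => by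
    have := hσ.apply_pow (-a) a x
    rwa [neg_add_cancel] at this
  rw [show (a : ℤ) - b = -b - -a by ring, ← hσ.eq_iff]
  constructor
  · intro h1
    ext x
    rw [← h, h1, h]
  · intro h1 x
    apply (σ 0).injective
    rw [h, h, h1]

/-- Writing i = f' ⌊i/f'⌋ + (i mod f') turns the condition into one on blocks of length f'. It
identifies the group elements that contribute to the trace in `exists_trace_one`. -/
theorem emod_lt_iff {f' q : ℕ} (hf : 0 < f') (hq : 0 < q) (i l : ℤ) :
    (i - f' * l) % ((f' * q : ℕ) : ℤ) < f' ↔ (q : ℤ) ∣ l - i / f' := by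
  have hf0 : (0 : ℤ) < f' := by exact_mod_cast hf
  push_cast
  have h1 : (i - f' * l) = f' * (i / f' - l) + i % f' := by
    have := Int.mul_ediv_add_emod i f'
    linear_combination -this
  have h2 := Int.emod_nonneg i hf0.ne'
  have h3 := Int.emod_lt_of_pos i hf0
  rw [show l - i / f' = -(i / f' - l) by ring, dvd_neg]
  generalize i / (f' : ℤ) - l = m at *
  rw [h1]
  have hq0 : (0 : ℤ) < q := by exact_mod_cast hq
  have h6 := Int.emod_nonneg m hq0.ne'
  have h4 : (f' * m + i % f') % (f' * q) = f' * (m % q) + i % f' := by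
    have h5 := Int.mul_ediv_add_emod m q
    have h7 := Int.emod_lt_of_pos m hq0
    rw [show (f' : ℤ) * m + i % f' = (f' * (m % q) + i % f') + f' * q * (m / q) by
      linear_combination (-(f' : ℤ)) * h5, Int.add_mul_emod_self_left]
    apply Int.emod_eq_of_lt
    · positivity
    · nlinarith
  rw [h4]
  constructor
  · intro h
    apply Int.dvd_of_emod_eq_zero
    nlinarith
  · intro h
    rw [Int.emod_eq_zero_of_dvd h]
    omega

/-- Take ε = n⁻¹ (e_0 + ⋯ + e_{f'-1}). The translates of this block by multiples of f' partition the
indices modulo f, and each translate is produced by exactly n elements of G. Tameness makes n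
invertible in k_E. -/
theorem IsTameDatum.exists_trace_one [Fintype G] (hG : IsTameDatum p f f' n act η)
    (hσ : IsFrobeniusSystem p f σ) :
    ∃ ε : BreuilRing p e k kE, ∑ g, twist p e kE (act g) (η g) ε = 1 := by
  classical
  have hf0 : (0 : ℤ) < f' := by exact_mod_cast hG.deg_pos
  obtain ⟨q, hq⟩ := hG.deg_dvd
  have hq0 : 0 < q := by
    rcases Nat.eq_zero_or_pos q with h | h
    · have := hσ.pos
      simp [hq, h] at this
    · exact h
  have hq0' : (0 : ℤ) < q := by exact_mod_cast hq0
  have hn : (n : kE) ≠ 0 := by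
    have : CharP kE p := charP_of_injective_algebraMap (algebraMap (ZMod p) kE).injective p
    rw [Ne, CharP.cast_eq_zero_iff kE p]
    exact hG.not_dvd
  obtain ⟨ε, hε⟩ := hσ.exists_coef (e := e)
    (F := fun i j => if i % (f : ℤ) < f' ∧ j = 0 then (n : kE)⁻¹ else 0) (fun i => by simp)
  refine ⟨ε, hσ.coef_ext fun i j hj => ?_⟩
  rw [coef_sum, coef_one]
  choose l hl hlt using fun g => hG.exists_coef_twist (e := e) hσ g
  simp only [hlt, hε, hj, if_true]
  rcases eq_or_ne j 0 with rfl | h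
  · have h1 : ∀ g, (i - f' * (l g : ℤ)) % (f : ℤ) < f' ↔
        ∀ x, act g x = x ^ p ^ (f' * ((i / f') % q).toNat) := by
      intro g
      have h2 : (∀ x, act g x = x ^ p ^ (f' * ((i / f') % q).toNat)) ↔
          ∀ x : k, x ^ p ^ (f' * l g) = x ^ p ^ (f' * ((i / f') % q).toNat) :=
        forall_congr' fun x => by rw [hl]
      rw [h2, hσ.pow_eq_iff, hq, emod_lt_iff hG.deg_pos hq0]
      push_cast
      rw [Int.toNat_of_nonneg (Int.emod_nonneg _ hq0'.ne'), ← mul_sub,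
        mul_dvd_mul_iff_left hf0.ne']
      generalize i / (f' : ℤ) = m
      have := Int.mul_ediv_add_emod m q
      constructor
      · rintro ⟨c, hc⟩
        exact ⟨c + m / q, by linear_combination hc - this⟩
      · rintro ⟨c, hc⟩
        exact ⟨c - m / q, by linear_combination hc + this⟩
    simp only [h1, pow_zero, one_mul, and_true]
    rw [← Finset.sum_filter, Finset.sum_const, ← Fintype.card_subtype, ← Nat.card_eq_fintype_card,
      hG.card_frob, nsmul_eq_mul, mul_inv_cancel₀ hn, if_pos ⟨trivial, hj⟩]
  · simp [h]

/-- Inertia fixes the components and acts on degree j through η^j; the exponents on which η is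
trivial throughout inertia are multiples of n, whence the congruence. Given the congruence, the
powers of η cancel for every g, and what remains is invariance under index shifts by f'. -/
theorem IsTameDatum.equivariant_iff (hG : IsTameDatum p f f' n act η)
    (hσ : IsFrobeniusSystem p f σ) {c d : ℤ → ZMod n} (hc : Function.Periodic c f')
    (hd : Function.Periodic d f') (x : BreuilRing p e k kE) :
    (∀ g, twist p e kE (act g) (η g) x * underZ p e f σ (η g) d =
      underZ p e f σ (η g) c * x) ↔
    (∀ i j, coef (σ i) j x ≠ 0 → (j : ZMod n) + d i = c i) ∧
      ∀ i j, coef (σ (i + f')) j x = coef (σ i) j x := by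
  have := hG.neZero
  have hcomm : ∀ a b : BreuilRing p e k kE, a * b = b * a := fun a b => mul_comm a b
  have hL : ∀ g i j, coef (σ i) j (twist p e kE (act g) (η g) x * underZ p e f σ (η g) d) =
      σ i (η g) ^ (d i).val * coef (σ i) j (twist p e kE (act g) (η g) x) := by
    intro g i j
    rw [hcomm, hσ.coef_underZ_mul (hG.periodic hd)]
  have hR : ∀ g i j, coef (σ i) j (underZ p e f σ (η g) c * x) =
      σ i (η g) ^ (c i).val * coef (σ i) j x := by
    intro g i j
    rw [hσ.coef_underZ_mul (hG.periodic hc)]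
  constructor
  · intro h
    have h1 : ∀ i j, coef (σ i) j x ≠ 0 → (j : ZMod n) + d i = c i := by
      intro i j hx
      -- Here n - c_i stands for -c_i, the representative of c_i being less than n.
      have h2 : n ∣ j + (d i).val + (n - (c i).val) := by
        refine hG.dvd_of_inertia _ fun g hg => ?_
        have h3 := hσ.coef_twist (e := e) (act g) (η g) 0 (by simpa using hg) i j x
        have h4 := congrArg (coef (σ i) j) (h g)
        simp only [Nat.cast_zero, add_zero] at h3
        rw [hL, hR, h3, ← mul_assoc, mul_left_inj' hx, ← pow_add, ← map_pow, ← map_pow] at h4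
        have h5 := (σ i).injective h4
        rw [← Units.val_pow_eq_pow_val, ← Units.val_pow_eq_pow_val] at h5
        have h6 := Units.ext h5
        rw [pow_add, add_comm, h6, ← pow_add, Nat.add_sub_cancel' (ZMod.val_lt (c i)).le,
          hG.eta_pow]
      rw [← ZMod.natCast_eq_zero_iff] at h2
      have h3 : (c i).val ≤ n := (ZMod.val_lt (c i)).le
      push_cast [Nat.cast_sub h3] at h2
      simp only [ZMod.natCast_zmod_val, ZMod.natCast_self] at h2
      linear_combination h2
    refine ⟨h1, fun i j => ?_⟩
    -- A lift of the p^{f'}-power Frobenius exists because such lifts number n > 0.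
    have hne : Nonempty {g : G // ∀ x, act g x = x ^ p ^ (f' * 1)} := by
      by_contra h2
      rw [not_nonempty_iff] at h2
      have := hG.card_frob 1
      rw [Nat.card_of_isEmpty] at this
      exact hG.pos.ne this
    obtain ⟨g, hg⟩ := hne
    have h3 := hσ.coef_twist (e := e) (act g) (η g) (f' * 1) hg i j x
    rw [mul_one] at h3
    have h4 := congrArg (coef (σ (i + f')) j) (h g)
    rw [hL, hR, h3, ← mul_assoc, ← pow_add] at h4
    have hz : σ (i + f') (η g) ≠ 0 := (_root_.map_ne_zero _).2 (Units.ne_zero _)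
    by_cases h5 : coef (σ i) j x = 0
    · rw [h5, mul_zero] at h4
      rw [h5]
      exact (mul_eq_zero.1 h4.symm).resolve_left (pow_ne_zero _ hz)
    · have h6 := h1 i j h5
      rw [hG.pow_eq_pow g _ (b := (c (i + f')).val) (by
        push_cast
        rw [ZMod.natCast_zmod_val, ZMod.natCast_zmod_val, hd, hc, add_comm, h6])] at h4
      exact (mul_left_cancel₀ (pow_ne_zero _ hz) h4).symm
  · rintro ⟨h1, h2⟩ g
    refine hσ.coef_ext fun i j _ => ?_
    obtain ⟨l, -, hlt⟩ := hG.exists_coef_twist (e := e) hσ g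
    have h3 : coef (σ (i - f' * l)) j x = coef (σ i) j x := by
      have h4 : Function.Periodic (fun i => coef (σ i) j x) f' := fun i => h2 i j
      have h5 := h4.nat_mul l (i - f' * l)
      rw [← h5]
      congr 2
      ring
    rw [hL, hR, hlt, h3, ← mul_assoc, ← pow_add]
    by_cases h5 : coef (σ i) j x = 0
    · rw [h5, mul_zero, mul_zero]
    · rw [hG.pow_eq_pow g _ (b := (c i).val) (by
        push_cast
        rw [ZMod.natCast_zmod_val, ZMod.natCast_zmod_val, add_comm, h1 i j h5])]

end Descent

/-! ### The coefficient ring meets the hypotheses of the abstract theory -/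

section Coefficients

variable {p : ℕ} [Fact p.Prime] {k kE : Type*} [Field k] [Field kE]
variable [Algebra (ZMod p) k] [Algebra (ZMod p) kE]
variable {G : Type*} [Group G]
variable {e f f' n : ℕ} {σ : ℤ → k →+* kE}
variable {act : G →* RingAut k} {η : G → kˣ}

theorem BreuilRing.mul_comm' (x y : BreuilRing p e k kE) : x * y = y * x := mul_comm x y

theorem BreuilRing.mul_one' (x : BreuilRing p e k kE) : x * 1 = x := mul_one x

namespace IsFrobeniusSystem

variable (hσ : IsFrobeniusSystem p f σ)
include hσ

theorem coef_mul_underU {r : ℤ → ℕ} (hr : Function.Periodic r f) (i : ℤ) (j : ℕ)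
    (y : BreuilRing p e k kE) : coef (σ i) j (y * underU p e f σ r) =
      if r i ≤ j ∧ j < e * p then coef (σ i) (j - r i) y else 0 := by
  rw [BreuilRing.mul_comm', hσ.coef_underU_mul hr]

theorem coef_underU {r : ℤ → ℕ} (hr : Function.Periodic r f) (i : ℤ) (j : ℕ) :
    coef (σ i) j (underU p e f σ r) = if j = r i ∧ j < e * p then 1 else 0 := by
  rw [← BreuilRing.mul_one' (underU p e f σ r), hσ.coef_underU_mul hr, coef_one]
  by_cases h : j = r i ∧ j < e * p
  · rw [if_pos ⟨h.1.ge, h.2⟩, if_pos h, if_pos ⟨by omega, by omega⟩]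
  · rw [if_neg h]
    split_ifs with h1 h2
    · exact absurd ⟨by omega, h1.2⟩ h
    · rfl
    · rfl

theorem coef_underA {a : ℤ → kEˣ} (ha : Function.Periodic a f) (i : ℤ) (j : ℕ) :
    coef (σ i) j (underA p e f σ a) = if j = 0 ∧ 0 < e * p then (a i : kE) else 0 := by
  rw [← BreuilRing.mul_one' (underA p e f σ a), hσ.coef_underA_mul ha, coef_one]
  split_ifs <;> simp

theorem coef_underZ {c : ℤ → ZMod n} (hc : Function.Periodic c f) (z : kˣ) (i : ℤ) (j : ℕ) :
    coef (σ i) j (underZ p e f σ z c) =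
      if j = 0 ∧ 0 < e * p then σ i z ^ (c i).val else 0 := by
  rw [← BreuilRing.mul_one' (underZ p e f σ z c), hσ.coef_underZ_mul hc, coef_one]
  split_ifs <;> simp

variable [Finite kE]

theorem underA_mul_inv {a : ℤ → kEˣ} (ha : Function.Periodic a f) :
    underA p e f σ a * underA p e f σ (fun i => (a i)⁻¹) = 1 := by
  refine hσ.coef_ext fun i j _ => ?_
  rw [hσ.coef_underA_mul ha, hσ.coef_underA (fun i => by simp only [ha i]), coef_one]
  split_ifs <;> simp

theorem underZ_mul_inv {c : ℤ → ZMod n} (hc : Function.Periodic c f) (z : kˣ) :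
    underZ p e f σ z c * underZ p e f σ z⁻¹ c = 1 := by
  refine hσ.coef_ext fun i j _ => ?_
  rw [hσ.coef_underZ_mul hc, hσ.coef_underZ hc, coef_one]
  split_ifs
  · rw [← mul_pow, ← map_mul, Units.mul_inv, map_one, one_pow]
  · rw [mul_zero]

/-- The hypothesis kills the coefficients of y at index i in degrees below ep - r_i ≥ e, and modulo
u^{ep} the map φ sees only degrees below e. -/
theorem phi_eq_zero_of_mul_underU {r : ℤ → ℕ} (hr : Function.Periodic r f) (hre : ∀ i, r i ≤ e)
    {y : BreuilRing p e k kE} (hy : y * underU p e f σ r = 0) : phi p e k kE y = 0 := by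
  refine hσ.coef_ext fun i j hj => ?_
  have h1 := hσ.coef_phi (i - 1) j y
  rw [sub_add_cancel] at h1
  rw [h1, coef_zero]
  split_ifs with h
  · obtain ⟨⟨q, rfl⟩, -⟩ := h
    have hp := (Fact.out : p.Prime).two_le
    rw [Nat.mul_div_cancel_left _ (by omega)]
    have h2 := congrArg (coef (σ (i - 1)) (q + r (i - 1))) hy
    have h3 : q < e := by
      by_contra h4
      rw [not_lt] at h4
      nlinarith
    have h4 : q + r (i - 1) < e * p := by
      have := hre (i - 1)
      nlinarith
    rw [hσ.coef_mul_underU hr, if_pos ⟨by omega, h4⟩, Nat.add_sub_cancel, coef_zero] at h2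
    exact h2
  · rfl

theorem exists_mul_underU {r : ℤ → ℕ} (hr : Function.Periodic r f) {x : BreuilRing p e k kE}
    (hx : ∀ i j, j < r i → coef (σ i) j x = 0) : ∃ z, x = z * underU p e f σ r := by
  obtain ⟨z, hz⟩ := hσ.exists_coef (e := e) (F := fun i j => coef (σ i) (j + r i) x)
    (fun i => by funext j; simp only [hσ.periodic i, hr i])
  refine ⟨z, hσ.coef_ext fun i j hj => ?_⟩
  rw [hσ.coef_mul_underU hr]
  split_ifs with h
  · rw [hz, if_pos (by omega), Nat.sub_add_cancel h.1]
  · exact hx i j (by omega)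

/-- If x has its lowest term at index i in degree j < r_i, take y = u^{r_i-j} e_i. Then y x = ε u^r
with ε having a nonzero constant term at i. As φ(y) has no constant term, ω = u^{ep-1} annihilates
φ(y) but not φ(ε). -/
theorem saturated {r : ℤ → ℕ} (hr : Function.Periodic r f) (x : BreuilRing p e k kE) :
    (∃ z, x = z * underU p e f σ r) ∨ ∃ y ε ω : BreuilRing p e k kE,
      y * x = ε * underU p e f σ r ∧ ω * phi p e k kE y = 0 ∧ ω * phi p e k kE ε ≠ 0 := by
  classical
  have hfin := hσ.finite
  by_cases hx : ∀ i j, j < r i → coef (σ i) j x = 0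
  · exact Or.inl (hσ.exists_mul_underU hr hx)
  right
  push Not at hx
  obtain ⟨i, hi⟩ := hx
  have hj1 := (Nat.find_spec hi).1
  have hj2 := (Nat.find_spec hi).2
  have hj3 := fun l hl => Nat.find_min hi (m := l) hl
  generalize Nat.find hi = j at *
  have hjN : j < e * p := by
    by_contra h
    exact hj2 (coef_of_le _ (by omega) x)
  obtain ⟨ε, hε⟩ := hσ.exists_coef (e := e)
    (F := fun i' l => if σ i = σ i' then coef (σ i) (j + l) x else 0)
    (fun i' => by simp only [hσ.periodic i'])
  have hp := (Fact.out : p.Prime)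
  have hassoc : ∀ a b c : BreuilRing p e k kE, a * b * c = a * (b * c) := fun a b c =>
    mul_assoc a b c
  refine ⟨uElt p e k kE ^ (r i - j) * Ideal.Quotient.mk _ (C (idem p (σ i))), ε,
    uElt p e k kE ^ (e * p - 1), ?_, ?_, ?_⟩
  · refine hσ.coef_ext fun i' l hl => ?_
    rw [hassoc, coef_u_pow_mul, coef_C_mul, component_idem, hσ.coef_mul_underU hr, hε]
    by_cases h1 : σ i = σ i'
    · have h2 : r i = r i' := by
        have := (hσ.eq_iff).1 h1
        obtain ⟨q, hq⟩ := this
        have h3 := hr.int_mul q i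
        rw [← h3]
        congr 1
        simp only [Int.cast_id]
        linear_combination -hq
      rw [if_pos h1, if_pos h1, one_mul, ← h1, ← h2]
      by_cases h3 : r i ≤ l
      · rw [if_pos ⟨by omega, hl⟩, if_pos ⟨h3, hl⟩, if_pos (by omega)]
        congr 1
        omega
      · rw [if_neg (show ¬ (r i ≤ l ∧ l < e * p) by omega)]
        split_ifs with h4
        · have h5 := hj3 (l - (r i - j)) (by omega)
          push Not at h5
          exact h5 (by omega)
        · rfl
    · simp [h1]
  · refine hσ.coef_ext fun i' l hl => ?_
    rw [coef_u_pow_mul, coef_zero]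
    split_ifs with h
    · have h1 := hσ.coef_phi (i' - 1) (l - (e * p - 1))
        (uElt p e k kE ^ (r i - j) * Ideal.Quotient.mk _ (C (idem p (σ i))))
      rw [sub_add_cancel] at h1
      rw [h1, coef_u_pow_mul, show l - (e * p - 1) = 0 by omega, Nat.zero_div,
        if_neg (show ¬ (r i - j ≤ 0 ∧ 0 < e * p) by omega)]
      simp
    · rfl
  · intro h
    have h1 := congrArg (coef (σ (i + 1)) (e * p - 1)) h
    rw [coef_u_pow_mul, if_pos ⟨le_rfl, by omega⟩, Nat.sub_self, hσ.coef_phi,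
      if_pos ⟨dvd_zero _, by omega⟩, Nat.zero_div, hε, if_pos (by omega), if_pos rfl, add_zero,
      coef_zero] at h1
    exact hj2 h1

/-- A proper J lies in a maximal ideal Q, which contains the nilpotent u and misses some e_i. Every
x ∈ J then has zero constant term at σ_i, since otherwise e_i ∈ Q. So elements of φ(J) have zero
constant term at σ_{i+1} and cannot generate 1. -/
theorem eq_top_of_span_phi (J : Ideal (BreuilRing p e k kE))
    (hJ : Ideal.span (phi p e k kE '' (J : Set (BreuilRing p e k kE))) = ⊤) : J = ⊤ := by
  have hfin := hσ.finite
  have hp := (Fact.out : p.Prime)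
  -- For e = 0 the ring is zero.
  rcases Nat.eq_zero_or_pos e with he | he
  · rw [Ideal.eq_top_iff_one]
    have : (1 : BreuilRing p e k kE) = 0 := hσ.coef_ext fun i j hj => by
      rw [he, zero_mul] at hj; omega
    rw [this]
    exact J.zero_mem
  have hN : 0 < e * p := Nat.mul_pos he hp.pos
  by_contra hne
  obtain ⟨Q, hQ, hJQ⟩ := J.exists_le_maximal hne
  obtain ⟨i, hi⟩ : ∃ i : ℕ, (Ideal.Quotient.mk _ (C (idem p (σ i))) : BreuilRing p e k kE) ∉ Q := by
    by_contra hall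
    push Not at hall
    apply hQ.ne_top
    rw [Ideal.eq_top_iff_one]
    have h1 : under p e f σ (fun _ => (1 : BreuilRing p e k kE)) = 1 := by
      refine hσ.coef_ext fun i j _ => ?_
      have := hσ.coef_under_mul (fun _ => (1 : BreuilRing p e k kE)) i j 1
      rwa [BreuilRing.mul_one', BreuilRing.mul_one'] at this
    rw [← h1]
    exact Q.sum_mem fun j _ => Q.mul_mem_left _ (hall j)
  have hu : uElt p e k kE ∈ Q := by
    refine (@Ideal.IsMaximal.isPrime (BreuilRing p e k kE) _ Q hQ).mem_of_pow_mem (e * p) ?_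
    have : uElt p e k kE ^ (e * p) = 0 := by
      rw [uElt, ← map_pow, Ideal.Quotient.eq_zero_iff_mem]
      exact Ideal.mem_span_singleton_self _
    rw [this]
    exact Q.zero_mem
  have key : ∀ x ∈ J, coef (σ i) 0 x = 0 := by
    intro x hx
    by_contra hc
    apply hi
    obtain ⟨y, hy⟩ := hσ.exists_coef (e := e) (F := fun l j => coef (σ l) (j + 1) x)
      (fun l => by simp only [hσ.periodic l])
    -- With y the quotient by u of x minus its constant terms, this solves e_i x = (constant term)
    -- e_i + u e_i y for e_i.
    have h1 : (Ideal.Quotient.mk _ (C (idem p (σ i))) : BreuilRing p e k kE) =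
        scalar p e k (coef (σ i) 0 x)⁻¹ * (Ideal.Quotient.mk _ (C (idem p (σ i))) * x) -
        uElt p e k kE ^ 1 * (scalar p e k (coef (σ i) 0 x)⁻¹ *
          (Ideal.Quotient.mk _ (C (idem p (σ i))) * y)) := by
      refine hσ.coef_ext fun l j hj => ?_
      rw [coef_sub, coef_u_pow_mul, coef_scalar_mul, coef_scalar_mul, coef_C_mul, coef_C_mul,
        component_idem]
      have h2 := coef_C_mul (σ l) j (idem p (σ i)) (1 : BreuilRing p e k kE)
      rw [BreuilRing.mul_one', component_idem, coef_one] at h2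
      rw [h2]
      by_cases h3 : σ i = σ l
      · rw [if_pos h3, ← h3]
        rcases Nat.eq_zero_or_pos j with rfl | hj0
        · simp [hN, hc]
        · have h4 := hy i (j - 1)
          rw [Nat.sub_add_cancel hj0, if_pos (by omega)] at h4
          rw [h4]
          simp [hj0.ne', Nat.one_le_iff_ne_zero, hj]
      · simp [h3]
    rw [h1]
    rw [BreuilRing.mul_comm' (uElt p e k kE ^ 1)]
    refine Q.sub_mem (Q.mul_mem_left _ (Q.mul_mem_left _ (hJQ hx))) (Q.mul_mem_left _ ?_)
    exact Q.pow_mem_of_mem hu 1 one_pos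
  have h1 : (1 : BreuilRing p e k kE) ∈
      Ideal.span (phi p e k kE '' (J : Set (BreuilRing p e k kE))) := hJ ▸ Submodule.mem_top
  have h2 : ∀ z ∈ Ideal.span (phi p e k kE '' (J : Set (BreuilRing p e k kE))),
      coef (σ (i + 1)) 0 z = 0 := by
    intro z hz
    induction hz using Submodule.span_induction with
    | mem z hz =>
      obtain ⟨x, hx, rfl⟩ := hz
      rw [hσ.coef_phi, if_pos ⟨dvd_zero _, hN⟩, Nat.zero_div, key x hx]
    | zero => exact coef_zero _ _
    | add x y _ _ hx hy =>
      refine (coef_add _ _ _ _).trans ?_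
      rw [hx, hy, add_zero]
    | smul c x _ hx =>
      refine (coef_zero_mul _ c x).trans ?_
      rw [hx, mul_zero]
  have h3 := h2 1 h1
  rw [coef_one, if_pos ⟨rfl, hN⟩] at h3
  exact one_ne_zero h3

/-- The coefficient of the generator of `N` in `φ₁` of the extension is well defined. -/
theorem phi_eq_zero_of_add {r s : ℤ → ℕ} (hr : Function.Periodic r f) (hs : Function.Periodic s f)
    (hre : ∀ i, r i ≤ e) (hse : ∀ i, s i ≤ e) {h : BreuilRing p e k kE}
    (hh : ∀ i j, j < r i + s i - e → coef (σ i) j h = 0) (y z : BreuilRing p e k kE)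
    (hy : y * underU p e f σ r = 0) (hz : y * h + z * underU p e f σ s = 0) :
    phi p e k kE z = 0 := by
  have hp := (Fact.out : p.Prime).two_le
  have hep : e + e ≤ e * p := by nlinarith
  have hv : Function.Periodic (fun i => r i + s i - e) f := fun i => by simp only [hr i, hs i]
  have hw : Function.Periodic (fun i => e * p - r i) f := fun i => by simp only [hr i]
  obtain ⟨h', rfl⟩ := hσ.exists_mul_underU hv hh
  obtain ⟨y', rfl⟩ := hσ.exists_mul_underU hw (x := y) (fun i j hj => by
    have := congrArg (coef (σ i) (j + r i)) hy
    rwa [hσ.coef_mul_underU hr, if_pos ⟨by omega, by omega⟩, Nat.add_sub_cancel, coef_zero] at this)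
  have hassoc : ∀ a b c d : BreuilRing p e k kE, a * b * (c * d) = a * c * b * d := fun a b c d =>
    by rw [mul_assoc a c b, mul_comm c b, ← mul_assoc a b c, mul_assoc (a * b) c d]
  -- As y is divisible by u^{ep-r} and h by u^{max(0, r+s-e)}, the product y h has no terms of
  -- degree below s + e. So z has none below e, and φ(z) depends on no others.
  have hz0 : ∀ i j, j < e → coef (σ i) j z = 0 := by
    intro i j hj
    have h1 := hse i
    have h2 := hre i
    have := congrArg (coef (σ i) (j + s i)) hz
    rw [coef_add, hσ.coef_mul_underU hs, if_pos ⟨by omega, by omega⟩, Nat.add_sub_cancel, hassoc,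
      hσ.coef_mul_underU hv, coef_zero] at this
    split_ifs at this with h3
    · rw [hσ.coef_mul_underU hw, if_neg (by omega), zero_add] at this
      exact this
    · rwa [zero_add] at this
  refine hσ.coef_ext fun i j hj => ?_
  have h1 := hσ.coef_phi (i - 1) j z
  rw [sub_add_cancel] at h1
  rw [h1, coef_zero]
  split_ifs with h
  · obtain ⟨⟨q, rfl⟩, -⟩ := h
    rw [Nat.mul_div_cancel_left _ (by omega)]
    exact hz0 _ _ (by by_contra h4; rw [not_lt] at h4; nlinarith)
  · rfl

end IsFrobeniusSystem

variable [Finite kE]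

theorem isUnit_of_mul_eq_one' {R : Type*} [CommRing R] {a b : R} (h : a * b = 1) : IsUnit a :=
  IsUnit.of_mul_eq_one b h

theorem periodic_sub_mul {α : Type*} {F : ℤ → α} (hF : Function.Periodic F f') (i : ℤ) (l : ℕ) :
    F (i - f' * l) = F i := by
  rw [← hF.nat_mul l (i - f' * l)]
  congr 1
  ring

/-- The recursion c_{i+1} = p(c_i + r_i) is precisely φ(η^{c+r}) = η^c, where η^{c+r} is the
character on u^r m. The period f' of the sequences makes a̲ invariant and u^r̲ an eigenvector. -/
theorem IsTameDatum.isCoefficients (hG : IsTameDatum p f f' n act η)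
    (hσ : IsFrobeniusSystem p f σ) {r : ℤ → ℕ} {a : ℤ → kEˣ} {c : ℤ → ZMod n}
    (h : RankOneParams p e f' n r a c) :
    IsCoefficients (R := BreuilRing p e k kE) (phi p e k kE)
      (fun g => twist p e kE (act g) (η g)) (underU p e f σ r) (underA p e f σ a)
      (fun g => underZ p e f σ (η g) c) (fun g => underZ p e f σ (η g) fun i => c i + (r i : ZMod n)) := by
  have := hG.neZero
  have hr := hG.periodic h.r_periodic
  have ha := hG.periodic h.a_periodic
  have hc := hG.periodic h.c_periodic
  have hcr : Function.Periodic (fun i => c i + (r i : ZMod n)) f := fun i => by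
    simp only [hc i, hr i]
  have h_tw : ∀ g, twist p e kE (act g) (η g) (underA p e f σ a) = underA p e f σ a := by
    intro g
    refine hσ.coef_ext fun i j _ => ?_
    obtain ⟨l, -, hl⟩ := hG.exists_coef_twist (e := e) hσ g
    rw [hl, hσ.coef_underA ha, hσ.coef_underA ha, periodic_sub_mul h.a_periodic]
    split_ifs with h1
    · rw [h1.1, pow_zero, one_mul]
    · rw [mul_zero]
  have h_phi : ∀ g, phi p e k kE (underZ p e f σ (η g) fun i => c i + (r i : ZMod n)) =
      underZ p e f σ (η g) c := by
    intro g
    refine hσ.coef_ext fun i j hj => ?_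
    have h1 := hσ.coef_phi (i - 1) j (underZ p e f σ (η g) fun i => c i + (r i : ZMod n))
    have h2 := hσ.frob (i - 1) (η g)
    rw [sub_add_cancel] at h1 h2
    rw [h1, hσ.coef_underZ hcr, hσ.coef_underZ hc]
    rcases Nat.eq_zero_or_pos j with rfl | hj0
    · rw [if_pos ⟨dvd_zero _, hj⟩, Nat.zero_div, if_pos ⟨rfl, hj⟩, if_pos ⟨rfl, hj⟩, ← h2,
        ← pow_mul]
      refine hG.pow_eq_pow g _ ?_
      have h3 := h.c_succ (i - 1)
      rw [sub_add_cancel] at h3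
      push_cast
      rw [ZMod.natCast_zmod_val, ZMod.natCast_zmod_val, h3]
    · rw [if_neg (show ¬ (j = 0 ∧ 0 < e * p) by omega)]
      split_ifs with h3 h4
      · have := Nat.le_of_dvd hj0 h3.1
        rw [Nat.div_eq_zero_iff_lt (Fact.out : p.Prime).pos] at h4
        omega
      · rfl
      · rfl
  have h_U : ∀ g, twist p e kE (act g) (η g) (underU p e f σ r) * underZ p e f σ (η g) c =
      underZ p e f σ (η g) (fun i => c i + (r i : ZMod n)) * underU p e f σ r := by
    intro g
    refine hσ.coef_ext fun i j hj => ?_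
    obtain ⟨l, -, hl⟩ := hG.exists_coef_twist (e := e) hσ g
    rw [BreuilRing.mul_comm', hσ.coef_underZ_mul hc, hσ.coef_underZ_mul hcr, hl,
      hσ.coef_underU hr, hσ.coef_underU hr, periodic_sub_mul h.r_periodic]
    split_ifs with h1
    · rw [mul_one, mul_one, ← pow_add]
      refine hG.pow_eq_pow g _ ?_
      push_cast
      rw [ZMod.natCast_zmod_val, ZMod.natCast_zmod_val, h1.1]
    · simp
  have h_co : ∀ g₁ g₂, underZ p e f σ (η (g₁ * g₂)) (fun i => c i + (r i : ZMod n)) =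
      twist p e kE (act g₁) (η g₁) (underZ p e f σ (η g₂) fun i => c i + (r i : ZMod n)) *
        underZ p e f σ (η g₁) (fun i => c i + (r i : ZMod n)) := by
    intro g₁ g₂
    refine hσ.coef_ext fun i j hj => ?_
    obtain ⟨l, hl1, hl⟩ := hG.exists_coef_twist (e := e) hσ g₁
    have h1 : σ i (act g₁ (η g₂)) = σ (i - f' * l) (η g₂) := by
      rw [hl1]
      have := hσ.apply_pow (i - f' * l) (f' * l) (η g₂)
      push_cast at this
      rwa [sub_add_cancel] at this
    rw [BreuilRing.mul_comm', hσ.coef_underZ_mul hcr, hσ.coef_underZ hcr, hl,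
      hσ.coef_underZ hcr, hG.eta_mul, map_mul, h1, periodic_sub_mul h.r_periodic, periodic_sub_mul h.c_periodic]
    split_ifs with h2
    · rw [h2.1, pow_zero, one_mul, mul_pow, mul_comm]
    · simp
  exact
    { isUnit := isUnit_of_mul_eq_one' (R := BreuilRing p e k kE) (hσ.underA_mul_inv ha)
      tw_eq := h_tw
      isUnit_Z' := fun g => isUnit_of_mul_eq_one' (R := BreuilRing p e k kE) (hσ.underZ_mul_inv hcr (η g))
      phi_Z' := h_phi
      tw_U := h_U
      cocycle := h_co
      phi_eq_zero := fun y hy => hσ.phi_eq_zero_of_mul_underU hr h.r_le hy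
      saturated := fun x => hσ.saturated hr x }

end Coefficients

/-! ### Morphisms between rank one objects, and bases of extensions -/

namespace PhiModule

universe u'

variable {R : Type u'} [CommRing R] {φ : R →+* R} {G : Type t} [Group G] {tw : G → R →+* R}

/-- Nonzero homomorphisms between rank one objects. -/
theorem IsStandard.exists_hom_iff {M N : PhiModule.{t, w} φ tw} {U A V B A' : R}
    {Z W : G → R} {m : M.carrier} {n : N.carrier} (hM : M.IsStandard U A Z m)
    (hN : N.IsStandard V B W n) (hA : A * A' = 1) :
    (∃ F : M.carrier →ₗ[R] N.carrier, M.IsHom N F ∧ F ≠ 0) ↔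
      ∃ z, z * V = U * (A' * (B * φ z)) ∧
        (∀ g, tw g (A' * (B * φ z)) * W g = Z g * (A' * (B * φ z))) ∧ A' * (B * φ z) ≠ 0 := by
  constructor
  · rintro ⟨F, hF, hF0⟩
    -- If F(m) = x n and F(U m) = z V n, then φ₁ gives A x = B φ(z). These are the equations for a
    -- change of lift that leaves h unchanged.
    obtain ⟨x, hx⟩ := hN.exists_smul (F m)
    have h1 : F (U • m) = (U * x) • n := by rw [map_smul, hx, mul_smul]
    obtain ⟨z, hz⟩ := hN.mem_fil.1 (h1 ▸ hF.map_fil _ hM.gen_mem)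
    have h2 := hF.map_phi₁ ⟨_, hM.gen_mem⟩
    have h3 : F (U • m) = z • V • n := by rw [h1, hz, mul_smul]
    rw [hM.phi₁_eq, N.phi₁_congr h3 _ (N.fil.smul_mem _ hN.gen_mem), hN.phi₁_apply, map_smul, hx,
      smul_smul, smul_smul] at h2
    have h4 : A' * (B * φ z) = x := by
      rw [mul_comm B, ← hN.smul_inj h2, ← mul_assoc, mul_comm A', hA, one_mul]
    refine ⟨z, by rw [h4, hz], fun g => ?_, ?_⟩
    · rw [h4]
      have h5 := hF.map_hat g m
      rw [hM.hat_eq, map_smul, hx, N.hat_smul, hN.hat_eq, smul_smul, smul_smul] at h5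
      exact (hN.smul_inj h5).symm
    · rw [h4]
      rintro rfl
      apply hF0
      refine LinearMap.ext fun y => ?_
      obtain ⟨y, rfl⟩ := hM.exists_smul y
      rw [map_smul, hx, zero_smul, smul_zero, LinearMap.zero_apply]
  · rintro ⟨z, hz, hg, h0⟩
    generalize hx : A' * (B * φ z) = x at *
    let b : R ≃ₗ[R] M.carrier :=
      LinearEquiv.ofBijective (LinearMap.toSpanSingleton R _ m) hM.generator
    let F : M.carrier →ₗ[R] N.carrier :=
      LinearMap.toSpanSingleton R _ (x • n) ∘ₗ b.symm.toLinearMap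
    have hF : ∀ y : R, F (y • m) = (y * x) • n := by
      intro y
      have : b.symm (y • m) = y := b.symm_apply_apply y
      change b.symm (y • m) • x • n = _
      rw [this, mul_smul]
    have hfil : ∀ y : R, F (y • U • m) = (y * z) • V • n := by
      intro y
      rw [← mul_smul, hF, ← mul_smul, mul_assoc, ← hz, mul_assoc]
    refine ⟨F, ⟨?_, ?_, ?_⟩, ?_⟩
    · intro y hy
      obtain ⟨q, rfl⟩ := hM.exists_smul y
      obtain ⟨q, rfl⟩ := hM.mem_fil.1 hy
      rw [mul_smul, hfil]
      exact N.fil.smul_mem _ hN.gen_mem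
    · rintro ⟨y, hy⟩
      obtain ⟨q, rfl⟩ := hM.exists_smul y
      obtain ⟨q, rfl⟩ := hM.mem_fil.1 hy
      have h1 : F ((q * U) • m) = (q * z) • V • n := by rw [mul_smul, hfil]
      rw [M.phi₁_congr (mul_smul q U m) _ (M.fil.smul_mem _ hM.gen_mem), hM.phi₁_apply,
        N.phi₁_congr h1 _ (N.fil.smul_mem _ hN.gen_mem), hN.phi₁_apply, smul_smul, hF, smul_smul]
      congr 1
      rw [← hx, map_mul]
      linear_combination (φ q * B * φ z) * hA
    · intro g y
      obtain ⟨q, rfl⟩ := hM.exists_smul y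
      rw [M.hat_smul, hM.hat_eq, smul_smul, hF, hF, N.hat_smul, hN.hat_eq, smul_smul, map_mul]
      congr 1
      linear_combination (-(tw g q)) * hg g
    · intro hF0
      apply h0
      have := hF 1
      rw [hF0, LinearMap.zero_apply, one_mul] at this
      exact hN.smul_inj (by rw [← this, zero_smul])

section Finiteness

variable {M N P : PhiModule.{t, w} φ tw} {U A V B : R} {Z W : G → R} {m : M.carrier}
  {n : N.carrier} {ι : N.carrier →ₗ[R] P.carrier} {π : P.carrier →ₗ[R] M.carrier} {h : R}
  {m' : P.carrier}

theorem IsForm.free (hF : IsForm P ι π U A Z m n h m') (hE : IsExtension ι π)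
    (hM : M.IsStandard U A Z m) (hN : N.IsStandard V B W n) : Module.Free R P.carrier :=
  Module.Free.of_equiv (hF.basis hE hM hN)

theorem IsForm.finite (hF : IsForm P ι π U A Z m n h m') (hE : IsExtension ι π)
    (hM : M.IsStandard U A Z m) (hN : N.IsStandard V B W n) : Module.Finite R P.carrier :=
  Module.Finite.equiv (hF.basis hE hM hN)

end Finiteness

end PhiModule

/-! ### Translation to Breuil modules -/

section Concrete

variable {p e : ℕ} [Fact p.Prime] {k : Type u} {kE : Type v} [Field k] [Field kE]
variable [Algebra (ZMod p) k] [Algebra (ZMod p) kE]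
variable {G : Type t} [Group G] {act : G →* RingAut k} {η : G → kˣ}

/-- The filtered `φ`-module underlying a Breuil module. -/
@[reducible] def BreuilModule.toPhiModule (M : BreuilModule.{u, v, t, w} p e kE act η) :
    PhiModule.{t, w} (R := BreuilRing p e k kE) (phi p e k kE)
      (fun g => twist p e kE (act g) (η g)) :=
  { M with }

variable {M N : BreuilModule.{u, v, t, w} p e kE act η}

theorem isMorphism_iff {F : M.carrier →ₗ[BreuilRing p e k kE] N.carrier} :
    IsMorphism M N F ↔ M.toPhiModule.IsHom N.toPhiModule F :=
  ⟨fun h => ⟨h.map_fil, h.map_phi₁, h.map_hat⟩, fun h => ⟨h.map_fil, h.map_phi₁, h.map_hat⟩⟩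

theorem Extension.isExtension (E : Extension M N) :
    PhiModule.IsExtension (M := M.toPhiModule) (N := N.toPhiModule) (P := E.mid.toPhiModule)
      E.incl E.proj :=
  ⟨isMorphism_iff.1 E.incl_isMorphism, isMorphism_iff.1 E.proj_isMorphism, E.incl_injective,
    E.proj_surjective, E.exact⟩

variable {f f' n : ℕ} {σ : ℤ → k →+* kE} {r s : ℤ → ℕ} {a b : ℤ → kEˣ} {c d : ℤ → ZMod n}
variable {m : M.carrier} {n₀ : N.carrier}

theorem IsRankOne.isStandard (hM : IsRankOne M f σ r a c m) :
    M.toPhiModule.IsStandard (underU p e f σ r) (underA p e f σ a)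
      (fun g => underZ p e f σ (η g) c) m :=
  ⟨hM.generator, hM.fil_eq, hM.phi₁_eq, hM.hat_eq⟩

/-- The extension `E` is given by the element `h` of `(k ⊗ k_E)[u]/u^{ep}`. -/
def Extension.HasForm (E : Extension M N) (f : ℕ) {n : ℕ} (σ : ℤ → k →+* kE)
    (r : ℤ → ℕ) (a : ℤ → kEˣ) (c : ℤ → ZMod n) (m : M.carrier) (n₀ : N.carrier)
    (h : BreuilRing p e k kE) : Prop :=
  ∃ m' : E.mid.carrier, PhiModule.IsForm (M := M.toPhiModule) (N := N.toPhiModule)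
    E.mid.toPhiModule E.incl E.proj (underU p e f σ r) (underA p e f σ a)
    (fun g => underZ p e f σ (η g) c) m n₀ h m'

variable [Finite kE] (hσ : IsFrobeniusSystem p f σ) (hG : IsTameDatum p f f' n act η)
variable (hr : RankOneParams p e f' n r a c) (hs : RankOneParams p e f' n s b d)
variable (hM : IsRankOne M f σ r a c m) (hN : IsRankOne N f σ s b d n₀)

include hσ hG hs hM hN in
-- Once m' is a suitable lift, the generators of P and of Fil¹ P and the structure on n are
-- automatic from exactness and Fil¹ P ∩ N = Fil¹ N.
theorem Extension.hasNormalForm_iff (E : Extension M N) (h : ℤ → kE[X]) :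
    E.HasNormalForm f σ r a c m s b d n₀ h ↔ E.HasForm f σ r a c m n₀ (underH p e f σ h) := by
  have hE := E.isExtension
  have hb := hG.isCoefficients (e := e) hσ hs
  constructor
  · rintro ⟨m', n', h1, rfl, -, h4, -, h6, -, h8⟩
    refine ⟨m', h1, ?_, h6, h8⟩
    change _ ∈ E.mid.fil
    rw [h4]
    exact Submodule.subset_span (by simp)
  · rintro ⟨m', hF⟩
    refine ⟨m', E.incl n₀, hF.proj_eq, rfl, ?_, ?_, hE.phi₁_incl hN.isStandard, hF.phi₁_eq,
      hE.hat_incl hN.isStandard, hF.hat_eq⟩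
    · rw [eq_top_iff]
      intro x _
      obtain ⟨y, z, hx⟩ := hF.exists_repr hE hM.isStandard hN.isStandard x
      exact Submodule.mem_span_pair.2 ⟨y, z, hx.symm⟩
    · ext x
      refine (hF.mem_fil_iff hE hM.isStandard hN.isStandard hb).trans ?_
      rw [Submodule.mem_span_pair]
      constructor
      · rintro ⟨y, z, rfl⟩
        exact ⟨z, y, add_comm _ _⟩
      · rintro ⟨z, y, rfl⟩
        exact ⟨y, z, add_comm _ _⟩

include hσ hG hs hM hN in
theorem Extension.HasForm.equivalent {E₁ E₂ : Extension M N} {h : BreuilRing p e k kE}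
    (h₁ : E₁.HasForm f σ r a c m n₀ h) (h₂ : E₂.HasForm f σ r a c m n₀ h) :
    E₁.Equivalent E₂ := by
  obtain ⟨m₁, hF₁⟩ := h₁
  obtain ⟨m₂, hF₂⟩ := h₂
  obtain ⟨F, h1, h2, h3, h4⟩ := hF₁.exists_equiv E₁.isExtension hF₂ E₂.isExtension hM.isStandard
    hN.isStandard (hG.isCoefficients hσ hs)
  exact ⟨F, isMorphism_iff.2 h1, isMorphism_iff.2 h2, h3, h4⟩

theorem Extension.HasForm.of_isScalarMultiple {E₁ E₂ : Extension M N} {h : BreuilRing p e k kE}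
    {x : kE} (hx : IsScalarMultiple x E₁ E₂) (h₁ : E₁.HasForm f σ r a c m n₀ h) :
    E₂.HasForm f σ r a c m n₀ (scalar p e k x * h) := by
  obtain ⟨F, h1, h2, h3⟩ := hx
  obtain ⟨m₁, hF₁⟩ := h₁
  exact ⟨F m₁, hF₁.map (isMorphism_iff.1 h1) h2 h3⟩

theorem Extension.HasForm.of_equivalent {E₁ E₂ : Extension M N} {h : BreuilRing p e k kE}
    (hE : E₁.Equivalent E₂) (h₁ : E₁.HasForm f σ r a c m n₀ h) :
    E₂.HasForm f σ r a c m n₀ h := by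
  obtain ⟨F, h1, -, h2, h3⟩ := hE
  obtain ⟨m₁, hF₁⟩ := h₁
  have h4 : ∀ y, F.toLinearMap (E₁.incl y) = E₂.incl ((1 : BreuilRing p e k kE) • y) :=
    fun y => (h2 y).trans (congrArg E₂.incl (one_smul _ y).symm)
  have h5 : PhiModule.IsForm (M := M.toPhiModule) (N := N.toPhiModule) E₂.mid.toPhiModule E₂.incl
      E₂.proj _ _ _ _ _ (1 * h) _ := hF₁.map (isMorphism_iff.1 h1) h4 h3
  rw [one_mul (M := BreuilRing p e k kE)] at h5
  exact ⟨F m₁, h5⟩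

include hσ hG hs hM hN in
theorem Extension.HasForm.isScalarMultiple {E₁ E₂ : Extension M N} {h : BreuilRing p e k kE}
    {x : kE} (h₁ : E₁.HasForm f σ r a c m n₀ h)
    (h₂ : E₂.HasForm f σ r a c m n₀ (scalar p e k x * h)) : IsScalarMultiple x E₁ E₂ := by
  obtain ⟨m₁, hF₁⟩ := h₁
  obtain ⟨m₂, hF₂⟩ := h₂
  obtain ⟨F, h1, h2, h3, -⟩ := hF₁.exists_map E₁.isExtension hF₂ E₂.isExtension hM.isStandard
    hN.isStandard (hG.isCoefficients hσ hs) (phi_scalar hσ x) (fun g => hG.twist_scalar hσ g x)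
  exact ⟨F, isMorphism_iff.2 h1, h2, h3⟩

theorem Extension.HasForm.of_isBaerSum {E₁ E₂ E₃ : Extension M N} {h₁ h₂ : BreuilRing p e k kE}
    (hE : IsBaerSum E₁ E₂ E₃) (hF₁ : E₁.HasForm f σ r a c m n₀ h₁)
    (hF₂ : E₂.HasForm f σ r a c m n₀ h₂) : E₃.HasForm f σ r a c m n₀ (h₁ + h₂) := by
  obtain ⟨F, h1, h2, h3, h4⟩ := hE
  obtain ⟨m₁, hF₁⟩ := hF₁
  obtain ⟨m₂, hF₂⟩ := hF₂
  unfold Extension.HasForm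
  refine PhiModule.IsForm.baer (M := M.toPhiModule) (N := N.toPhiModule)
    (P₃ := E₃.mid.toPhiModule) hF₁ hF₂ h1 h2 ?_ ?_ E₁.isExtension E₂.isExtension
  · exact h3
  · exact h4

include hσ hG hr hs hM hN in
theorem Extension.HasForm.isBaerSum {E₁ E₂ E₃ : Extension M N} {h₁ h₂ : BreuilRing p e k kE}
    (hF₁ : E₁.HasForm f σ r a c m n₀ h₁) (hF₂ : E₂.HasForm f σ r a c m n₀ h₂)
    (hF₃ : E₃.HasForm f σ r a c m n₀ (h₁ + h₂)) : IsBaerSum E₁ E₂ E₃ := by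
  obtain ⟨m₁, hF₁⟩ := hF₁
  obtain ⟨m₂, hF₂⟩ := hF₂
  obtain ⟨m₃, hF₃⟩ := hF₃
  exact hF₁.exists_baer hF₂ hF₃ E₁.isExtension E₂.isExtension E₃.isExtension hM.isStandard
    hN.isStandard (hG.isCoefficients hσ hr) (hG.isCoefficients hσ hs)

include hσ hG hr hs hM hN in
theorem Extension.HasForm.iff {E : Extension M N} {h : BreuilRing p e k kE}
    (hF : E.HasForm f σ r a c m n₀ h) (h' : BreuilRing p e k kE) :
    E.HasForm f σ r a c m n₀ h' ↔ ∃ z : BreuilRing p e k kE,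
      h' = h + z * underU p e f σ s - underU p e f σ r *
        (underA p e f σ (fun i => (a i)⁻¹) * (underA p e f σ b * phi p e k kE z)) ∧
      ∀ g, twist p e kE (act g) (η g)
          (underA p e f σ (fun i => (a i)⁻¹) * (underA p e f σ b * phi p e k kE z)) *
          underZ p e f σ (η g) d =
        underZ p e f σ (η g) c *
          (underA p e f σ (fun i => (a i)⁻¹) * (underA p e f σ b * phi p e k kE z)) := by
  obtain ⟨m₁, hF⟩ := hF
  exact hF.exists_form_iff E.isExtension hM.isStandard hN.isStandard (hG.isCoefficients hσ hs)
    (hσ.underA_mul_inv (hG.periodic hr.a_periodic)) h'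

include hσ hG hr hM hN in
theorem Extension.exists_hasForm [Finite G] (E : Extension M N) : ∃ h : BreuilRing p e k kE,
    E.HasForm f σ r a c m n₀ h ∧ ∀ g, twist p e kE (act g) (η g) h * underZ p e f σ (η g) d =
      underZ p e f σ (η g) (fun i => c i + (r i : ZMod n)) * h := by
  have := Fintype.ofFinite G
  obtain ⟨ε, hε⟩ := hG.exists_trace_one (e := e) hσ
  obtain ⟨h, m', hF, hh⟩ := E.isExtension.exists_isForm hM.isStandard hN.isStandard
    (hG.isCoefficients hσ hr) hσ.eq_top_of_span_phi (fun g h x => hG.twist_mul hσ g h x) hε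
  exact ⟨h, ⟨m', hF⟩, hh⟩

include hσ hG hr hs hN in
-- Since u^e m' ∈ Fil¹ P, multiplying u^r m' + h n by u^{e-r} puts u^{e-r} h n into Fil¹ P ∩ N = u^s
-- N.
theorem Extension.HasForm.coef_eq_zero {E : Extension M N} {h : BreuilRing p e k kE}
    (hF : E.HasForm f σ r a c m n₀ h) (i : ℤ) (j : ℕ) (hj : j < r i + s i - e) :
    coef (σ i) j h = 0 := by
  obtain ⟨m', hF⟩ := hF
  have hp := (Fact.out : p.Prime).two_le
  have hrp := hG.periodic hr.r_periodic
  have hsp := hG.periodic hs.r_periodic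
  have her : Function.Periodic (fun i => e - r i) f := fun i => by simp only [hrp i]
  have h1 : underU p e f σ (fun i => e - r i) * underU p e f σ r = uElt p e k kE ^ e := by
    refine hσ.coef_ext fun i j _ => ?_
    rw [hσ.coef_underU_mul her, hσ.coef_underU hrp, ← BreuilRing.mul_one' (uElt p e k kE ^ e),
      coef_u_pow_mul, coef_one]
    have := hr.r_le i
    split_ifs <;> first | rfl | omega
  obtain ⟨z, hz⟩ := hF.exists_mul_eq E.isExtension hN.isStandard (hG.isCoefficients hσ hs)
    (T := underU p e f σ fun i => e - r i) (fun x => by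
      rw [h1]; exact E.mid.u_pow_smul_mem x)
  have h2 := congrArg (coef (σ i) (j + (e - r i))) hz
  have h3 := hr.r_le i
  have h4 := hs.r_le i
  have h5 : e + e ≤ e * p := by nlinarith
  rw [hσ.coef_underU_mul her, if_pos ⟨by omega, by omega⟩, Nat.add_sub_cancel,
    hσ.coef_mul_underU hsp, if_neg (by omega)] at h2
  exact h2

include hσ hG hr hs hM hN in
-- Divisibility of h is used twice: it makes φ₁ well defined (`phi_eq_zero_of_add`), and it makes
-- u^{e-r} h a multiple of u^s, whence u^e P ⊆ Fil¹ P. Equivariance is for the character η^{c+r}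
-- because h n accompanies u^r m.
theorem exists_extension {h : BreuilRing p e k kE}
    (hv : ∀ i j, j < r i + s i - e → coef (σ i) j h = 0)
    (hh : ∀ g, twist p e kE (act g) (η g) h * underZ p e f σ (η g) d =
      underZ p e f σ (η g) (fun i => c i + (r i : ZMod n)) * h) :
    ∃ E : Extension M N, E.HasForm f σ r a c m n₀ h := by
  have hp := (Fact.out : p.Prime).two_le
  have hrp := hG.periodic hr.r_periodic
  have hsp := hG.periodic hs.r_periodic
  have her : Function.Periodic (fun i => e - r i) f := fun i => by simp only [hrp i]
  have hes : Function.Periodic (fun i => e - s i) f := fun i => by simp only [hsp i]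
  have hT : ∀ {r : ℤ → ℕ} (_ : ∀ i, r i ≤ e) (_ : Function.Periodic r f)
      (_ : Function.Periodic (fun i => e - r i) f),
      underU p e f σ (fun i => e - r i) * underU p e f σ r = uElt p e k kE ^ e := by
    intro r hre hrp her
    refine hσ.coef_ext fun i j _ => ?_
    rw [hσ.coef_underU_mul her, hσ.coef_underU hrp, ← BreuilRing.mul_one' (uElt p e k kE ^ e),
      coef_u_pow_mul, coef_one]
    have := hre i
    split_ifs <;> first | rfl | omega
  have hq : ∃ q, underU p e f σ (fun i => e - r i) * h = q * underU p e f σ s := by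
    refine hσ.exists_mul_underU hsp fun i j hj => ?_
    rw [hσ.coef_underU_mul her]
    split_ifs with h1
    · refine hv i _ ?_
      have := hr.r_le i
      have := h1.1
      omega
    · rfl
  obtain ⟨q, hq⟩ := hq
  have ha := hG.isCoefficients (e := e) hσ hr
  have hb := hG.isCoefficients (e := e) hσ hs
  have hcomm : ∀ g x, phi p e k kE (twist p e kE (act g) (η g) x) =
      twist p e kE (act g) (η g) (phi p e k kE x) := fun g x => hG.phi_twist hσ g x
  have hwd := hσ.phi_eq_zero_of_add hrp hsp hr.r_le hs.r_le hv
  let Q := PhiModule.extensionOf hM.isStandard hN.isStandard ha hb hcomm h hwd hh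
  have hE := PhiModule.extensionOf_isExtension hM.isStandard hN.isStandard ha hb hcomm h hwd hh
  have hF := PhiModule.extensionOf_isForm hM.isStandard hN.isStandard ha hb hcomm h hwd hh
  let P : BreuilModule.{u, v, t, w} p e kE act η :=
    { carrier := Q.carrier
      addCommGroup := Q.addCommGroup
      module := Q.module
      free := hF.free hE hM.isStandard hN.isStandard
      finite := hF.finite hE hM.isStandard hN.isStandard
      fil := Q.fil
      u_pow_smul_mem := fun x => by
        have := PhiModule.extensionOf_smul_mem hM.isStandard hN.isStandard ha hb hcomm h hwd hh
          ((hT hr.r_le hrp her).trans (hT hs.r_le hsp hes).symm) hq x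
        rw [hT hr.r_le hrp her] at this
        exact this
      phi₁ := Q.phi₁
      span_range_phi₁ := Q.span_range_phi₁
      hat := Q.hat
      hat_one := Q.hat_one
      hat_mul := Q.hat_mul
      hat_smul := Q.hat_smul
      hat_mem := Q.hat_mem
      hat_phi₁ := Q.hat_phi₁ }
  let ι : N.carrier →ₗ[BreuilRing p e k kE] P.carrier :=
    LinearMap.inr (BreuilRing p e k kE) M.toPhiModule.carrier N.toPhiModule.carrier
  let π : P.carrier →ₗ[BreuilRing p e k kE] M.carrier :=
    LinearMap.fst (BreuilRing p e k kE) M.toPhiModule.carrier N.toPhiModule.carrier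
  have hι : IsMorphism N P ι := isMorphism_iff.2 hE.hom_incl
  have hπ : IsMorphism P M π := isMorphism_iff.2 hE.hom_proj
  let E : Extension M N := ⟨P, ι, π, hι, hπ, hE.injective, hE.surjective, hE.exact⟩
  exact ⟨E, _, hF⟩

include hσ hG hr hM hN in
theorem hasNonzeroMorphism_iff : HasNonzeroMorphism M N ↔ ∃ z : BreuilRing p e k kE,
      z * underU p e f σ s = underU p e f σ r *
        (underA p e f σ (fun i => (a i)⁻¹) * (underA p e f σ b * phi p e k kE z)) ∧
      (∀ g, twist p e kE (act g) (η g)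
          (underA p e f σ (fun i => (a i)⁻¹) * (underA p e f σ b * phi p e k kE z)) *
          underZ p e f σ (η g) d =
        underZ p e f σ (η g) c *
          (underA p e f σ (fun i => (a i)⁻¹) * (underA p e f σ b * phi p e k kE z))) ∧
      underA p e f σ (fun i => (a i)⁻¹) * (underA p e f σ b * phi p e k kE z) ≠ 0 := by
  refine Iff.trans ?_ (hM.isStandard.exists_hom_iff hN.isStandard
    (hσ.underA_mul_inv (hG.periodic hr.a_periodic)))
  exact ⟨fun ⟨F, h1, h2⟩ => ⟨F, isMorphism_iff.1 h1, h2⟩,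
    fun ⟨F, h1, h2⟩ => ⟨F, isMorphism_iff.2 h1, h2⟩⟩

end Concrete

/-! ### Chains of exponents and the shift operator -/

section Chains

/-- From i to i + 1 the sum is multiplied by p, loses the leading p^f r_i and gains r_{i+f} = r_i.
-/
theorem alpha_succ {p f : ℕ} (hp : 1 < p) (hf : 0 < f) {r : ℤ → ℕ} (hr : Function.Periodic r f)
    (i : ℤ) : alpha p f r (i + 1) = p * (alpha p f r i - r i) := by
  obtain ⟨f, rfl⟩ := Nat.exists_eq_succ_of_ne_zero hf.ne'
  have h1 : ((p : ℚ) ^ (f + 1) - 1) ≠ 0 := by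
    have : (1 : ℚ) < (p : ℚ) ^ (f + 1) := one_lt_pow₀ (by exact_mod_cast hp) (by omega)
    linarith
  have h2 : ∑ j ∈ Finset.range (f + 1), (p : ℚ) ^ (f + 1 - 1 - j) * r (i + 1 + j) =
      p * ∑ j ∈ Finset.range (f + 1), (p : ℚ) ^ (f + 1 - 1 - j) * r (i + j) -
        ((p : ℚ) ^ (f + 1) - 1) * r i := by
    have h3 : r (i + 1 + f) = r i := by
      rw [← hr i]; congr 1; push_cast; ring
    rw [Finset.sum_range_succ, Finset.sum_range_succ' _ f, h3, mul_add, Finset.mul_sum]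
    have h4 : ∑ j ∈ Finset.range f, (p : ℚ) ^ (f + 1 - 1 - j) * r (i + 1 + j) =
        ∑ j ∈ Finset.range f, (p : ℚ) * ((p : ℚ) ^ (f + 1 - 1 - (j + 1)) * r (i + (j + 1 : ℕ))) := by
      refine Finset.sum_congr rfl fun j hj => ?_
      have hj := Finset.mem_range.1 hj
      rw [← mul_assoc, ← pow_succ', show f + 1 - 1 - (j + 1) + 1 = f + 1 - 1 - j by omega]
      congr 3
      push_cast
      ring
    rw [h4]
    simp only [Nat.add_sub_cancel, Nat.sub_self, Nat.sub_zero, pow_zero, Nat.cast_zero, add_zero]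
    ring
  rw [alpha, alpha, h2]
  field_simp

/-- The common denominator p^f - 1 turns the divisibility argument of `eq_of_chain` into one about
integers. -/
theorem alpha_mul (p f : ℕ) (hp : 1 < p) (hf : 0 < f) (r : ℤ → ℕ) (i : ℤ) :
    ∃ z : ℤ, alpha p f r i * ((p : ℚ) ^ f - 1) = z := by
  have : (1 : ℚ) < (p : ℚ) ^ f := one_lt_pow₀ (by exact_mod_cast hp) (by omega)
  refine ⟨p * ∑ j ∈ Finset.range f, (p : ℤ) ^ (f - 1 - j) * r (i + j), ?_⟩
  rw [alpha, div_mul_cancel₀ _ (by linarith)]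
  push_cast
  rfl

variable {p f f' n : ℕ} {r s : ℤ → ℕ}

theorem periodic_add_mul {α : Type*} {x : ℤ → α} (hx : Function.Periodic x f') (i k : ℤ) :
    x (i + k * f') = x i := by
  simpa using hx.int_mul k i

/-- The only possible value on an infinite chain of preimages under `w ↦ r - s + p w`. -/
theorem eq_of_chain (hp : 1 < p) (hf : 0 < f) (hr : Function.Periodic r f)
    (hs : Function.Periodic s f) {S : ℤ → ℕ → Prop}
    (hS : ∀ i w, S i w → ∃ w', w + s i = r i + p * w' ∧ S (i - 1) w') {i : ℤ} {w : ℕ}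
    (h : S i w) : ((w + s i : ℕ) : ℚ) = r i + alpha p f s i - alpha p f r i := by
  have hq : (1 : ℚ) < (p : ℚ) ^ f := one_lt_pow₀ (by exact_mod_cast hp) (by omega)
  -- By `alpha_succ` the deviation w + s_i - r_i - β_i + α_i is p times the deviation at the
  -- preimage. After m steps back, its multiple by p^f - 1 is an integer divisible by p^m.
  have h1 : ∀ m : ℕ, ∀ i w, S i w → ∃ z : ℤ,
      (w + s i - r i - alpha p f s i + alpha p f r i) * ((p : ℚ) ^ f - 1) = p ^ m * z := by
    intro m
    induction m with
    | zero =>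
      intro i w _
      obtain ⟨x, hx⟩ := alpha_mul p f hp hf r i
      obtain ⟨y, hy⟩ := alpha_mul p f hp hf s i
      refine ⟨(w + s i - r i) * (p ^ f - 1) - y + x, ?_⟩
      push_cast
      rw [← hx, ← hy]
      ring
    | succ m ih =>
      intro i w hw
      obtain ⟨w', h2, h3⟩ := hS i w hw
      obtain ⟨z, hz⟩ := ih _ _ h3
      refine ⟨z, ?_⟩
      have h4 := alpha_succ hp hf hr (i - 1)
      have h5 := alpha_succ hp hf hs (i - 1)
      rw [sub_add_cancel] at h4 h5
      have h6 : (w : ℚ) + s i = r i + p * w' := by exact_mod_cast h2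
      rw [h4, h5, h6]
      linear_combination (p : ℚ) * hz
  obtain ⟨z, hz⟩ := h1 0 i w h
  have h2 : z = 0 := by
    -- The exponent |z| suffices: p^{|z|} > |z| cannot divide a nonzero z.
    obtain ⟨y, hy⟩ := h1 z.natAbs i w h
    rw [hy, pow_zero, one_mul] at hz
    have h3 : ((p ^ z.natAbs : ℕ) : ℤ) ∣ z := ⟨y, by exact_mod_cast hz.symm⟩
    by_contra h0
    have h4 := Nat.le_of_dvd (Int.natAbs_pos.2 h0) (Int.natCast_dvd.1 h3)
    exact absurd (Nat.lt_pow_self hp (n := z.natAbs)) (by omega)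
  rw [h2, Int.cast_zero, mul_zero] at hz
  have h3 := (mul_eq_zero.1 hz).resolve_right (by linarith)
  push_cast
  linarith

variable {F : Type*} [Field F] {lam : ℤ → F} {γ : ℤ → ZMod n}

/-- A periodic chain of exponents `w` and nonzero coefficients `θ`, fixed by the shift operator. -/
structure IsCycle (p f' : ℕ) {n : ℕ} (r s : ℤ → ℕ) (lam : ℤ → F) (γ : ℤ → ZMod n) (w : ℤ → ℕ)
    (θ : ℤ → F) : Prop where
  periodic : Function.Periodic w f'
  periodic' : Function.Periodic θ f'
  ne_zero : ∀ i, θ i ≠ 0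
  add_eq : ∀ i, w i + s i = r i + p * w (i - 1)
  mul_eq : ∀ i, θ i = lam i * θ (i - 1)
  congr : ∀ i, ((w i + s i : ℕ) : ZMod n) = γ i

theorem IsCycle.eq_alpha (hp : 1 < p) (hf : 0 < f) (hr : Function.Periodic r f)
    (hs : Function.Periodic s f) {w : ℤ → ℕ} {θ : ℤ → F} (h : IsCycle p f' r s lam γ w θ) (i : ℤ) :
    ((w i + s i : ℕ) : ℚ) = r i + alpha p f s i - alpha p f r i :=
  eq_of_chain (S := fun i x => x = w i) hp hf hr hs
    (by rintro i _ rfl; exact ⟨_, h.add_eq i, rfl⟩) rfl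

/-- If w_i ≥ e, then w_{i+1} ≥ 3 w_i - e > w_i, so the exponents would grow forever, against
periodicity. For p = 2 the constant cycle w = e with r = 0, s = e is a counterexample; this is where
p must be odd. -/
theorem IsCycle.lt {e : ℕ} (hp : 2 < p) (he : 0 < e) (hf' : 0 < f')
    (hse : ∀ i, s i ≤ e) {w : ℤ → ℕ} {θ : ℤ → F} (h : IsCycle p f' r s lam γ w θ) (i : ℤ) :
    w i < e := by
  by_contra! hi
  have h1 : ∀ k : ℕ, w i + k ≤ w (i + k) := by
    intro k
    induction k with
    | zero => simp
    | succ k ih =>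
      have h2 := h.add_eq (i + (k + 1 : ℕ))
      rw [show i + (k + 1 : ℕ) - 1 = i + k by push_cast; ring] at h2
      have h3 := hse (i + (k + 1 : ℕ))
      have h4 : 3 * w (i + k) ≤ p * w (i + k) := Nat.mul_le_mul_right _ hp
      omega
  have := h1 f'
  rw [h.periodic i] at this
  omega

/-- Every nonzero entry has a nonzero preimage, so it starts an infinite chain and `eq_of_chain`
allows only one per index. Going back and using periodicity, every index is reached, and the unique
positions form the cycle. -/
theorem exists_isCycle (hp : 1 < p) (hf : 0 < f) (hf' : 0 < f') (hr : Function.Periodic r f)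
    (hs : Function.Periodic s f) {ζ : ℤ → ℕ → F} (hζ : Function.Periodic ζ f')
    (h : ∀ i w, ζ i w ≠ 0 → ∃ w', w + s i = r i + p * w' ∧ ζ i w = lam i * ζ (i - 1) w')
    (hγ : ∀ i w, ζ i w ≠ 0 → ((w + s i : ℕ) : ZMod n) = γ i) {i₀ : ℤ} {w₀ : ℕ}
    (h₀ : ζ i₀ w₀ ≠ 0) :
    ∃ w, IsCycle p f' r s lam γ w (fun i => ζ i (w i)) ∧ ∀ i x, ζ i x ≠ 0 → x = w i := by
  have hS : ∀ i w, ζ i w ≠ 0 → ∃ w', w + s i = r i + p * w' ∧ ζ (i - 1) w' ≠ 0 := by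
    intro i w hw
    obtain ⟨w', h1, h2⟩ := h i w hw
    exact ⟨w', h1, fun h3 => hw (by rw [h2, h3, mul_zero])⟩
  have hu : ∀ i x y, ζ i x ≠ 0 → ζ i y ≠ 0 → x = y := by
    intro i x y hx hy
    have h1 := eq_of_chain (S := fun i w => ζ i w ≠ 0) hp hf hr hs hS hx
    have h2 := eq_of_chain (S := fun i w => ζ i w ≠ 0) hp hf hr hs hS hy
    have h3 : x + s i = y + s i := by exact_mod_cast h1.trans h2.symm
    omega
  have hback : ∀ m : ℕ, ∃ w, ζ (i₀ - m) w ≠ 0 := by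
    intro m
    induction m with
    | zero => exact ⟨w₀, by simpa using h₀⟩
    | succ m ih =>
      obtain ⟨w, hw⟩ := ih
      obtain ⟨w', -, h2⟩ := hS _ _ hw
      refine ⟨w', ?_⟩
      rwa [show i₀ - (m + 1 : ℕ) = i₀ - m - 1 by push_cast; ring]
  have hall : ∀ i, ∃ w, ζ i w ≠ 0 := by
    intro i
    -- Going back (i₀ - i) mod f' steps from i₀ ends at an index congruent to i modulo f'.
    obtain ⟨w, hw⟩ := hback ((i₀ - i) % f').toNat
    refine ⟨w, ?_⟩
    have h1 := Int.emod_nonneg (i₀ - i) (b := f') (by omega)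
    have h2 := Int.mul_ediv_add_emod (i₀ - i) f'
    rw [Int.toNat_of_nonneg h1,
      show i₀ - (i₀ - i) % f' = i + ((i₀ - i) / f') * f' by linear_combination -h2] at hw
    rwa [periodic_add_mul hζ] at hw
  choose w hw using hall
  refine ⟨w, ⟨fun i => ?_, fun i => ?_, hw, fun i => ?_, fun i => ?_, fun i => hγ _ _ (hw i)⟩,
    fun i x hx => hu i x _ hx (hw i)⟩
  · refine hu i _ _ ?_ (hw i)
    rw [← hζ i]
    exact hw _
  · rw [hζ i]
    congr 1
    refine hu i _ _ ?_ (hw i)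
    rw [← hζ i]
    exact hw _
  · obtain ⟨w', h1, h2⟩ := hS _ _ (hw i)
    rw [h1, hu _ _ _ h2 (hw (i - 1))]
  · obtain ⟨w', h1, h2⟩ := h _ _ (hw i)
    have h3 : ζ (i - 1) w' ≠ 0 := fun h3 => hw i (by rw [h2, h3, mul_zero])
    rw [h2, hu _ _ _ h3 (hw (i - 1))]

open Classical in
/-- The operator on families of coefficients induced by `u^w ↦ u^{r - s + p w}`. -/
noncomputable def shift (p : ℕ) (r s : ℤ → ℕ) (lam : ℤ → F) : (ℤ → ℕ → F) →ₗ[F] (ℤ → ℕ → F) where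
  toFun ζ i w := if r i ≤ w + s i ∧ p ∣ w + s i - r i then
    lam i * ζ (i - 1) ((w + s i - r i) / p) else 0
  map_add' ζ ξ := by
    funext i w
    simp only [Pi.add_apply]
    split_ifs <;> ring
  map_smul' t ζ := by
    funext i w
    simp only [Pi.smul_apply, smul_eq_mul, RingHom.id_apply]
    split_ifs <;> ring

theorem shift_apply (hp : 0 < p) {ζ : ℤ → ℕ → F} {i : ℤ} {w w' : ℕ}
    (h : w + s i = r i + p * w') : shift p r s lam ζ i w = lam i * ζ (i - 1) w' := by
  have h1 : w + s i - r i = p * w' := by omega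
  change (if _ then _ else _) = _
  rw [if_pos ⟨by omega, h1 ▸ dvd_mul_right _ _⟩, h1, Nat.mul_div_cancel_left _ hp]

theorem exists_of_shift_ne_zero {ζ : ℤ → ℕ → F} {i : ℤ} {w : ℕ} (h : shift p r s lam ζ i w ≠ 0) :
    ∃ w', w + s i = r i + p * w' ∧ shift p r s lam ζ i w = lam i * ζ (i - 1) w' := by
  change (if _ then _ else _) ≠ (0 : F) at h
  split_ifs at h with h1
  · refine ⟨(w + s i - r i) / p, ?_, if_pos h1⟩
    rw [Nat.mul_div_cancel' h1.2]
    omega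
  · exact absurd rfl h

theorem shift_periodic (hr : Function.Periodic r f') (hs : Function.Periodic s f')
    (hlam : Function.Periodic lam f') {ζ : ℤ → ℕ → F} (hζ : Function.Periodic ζ f') :
    Function.Periodic (shift p r s lam ζ) f' := by
  intro i
  funext w
  change (if _ then _ else _) = (if _ then _ else _)
  rw [hr i, hs i, hlam i, show i + (f' : ℤ) - 1 = i - 1 + f' by ring, hζ (i - 1)]

/-- The exceptional positions of the normal form. -/
def IsExceptional (p f f' : ℕ) (Q : Prop) (r s : ℤ → ℕ) (i : ℤ) (w : ℕ) : Prop :=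
  Q ∧ (f' : ℤ) ∣ i ∧ ((w + s i : ℕ) : ℚ) = r 0 + alpha p f s 0 - alpha p f r 0

variable {Q : Prop}

theorem periodic_of_dvd {α : Type*} {x : ℤ → α} (hx : Function.Periodic x f') {i : ℤ}
    (hi : (f' : ℤ) ∣ i) : x i = x 0 := by
  obtain ⟨k, rfl⟩ := hi
  rw [mul_comm, ← zero_add (k * (f' : ℤ)), periodic_add_mul hx]

theorem IsCycle.eq_of_isExceptional (hp : 1 < p) (hf : 0 < f) (hr : Function.Periodic r f)
    (hs : Function.Periodic s f) (hs' : Function.Periodic s f') {w : ℤ → ℕ} {θ : ℤ → F}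
    (h : IsCycle p f' r s lam γ w θ) {i : ℤ} {x : ℕ}
    (hx : IsExceptional p f f' Q r s i x) : x = w i := by
  obtain ⟨-, h1, h2⟩ := hx
  rw [← h.eq_alpha hp hf hr hs 0, periodic_of_dvd hs' h1] at h2
  have h3 : x + s 0 = w 0 + s 0 := by exact_mod_cast h2
  rw [periodic_of_dvd h.periodic h1]
  omega

/-- Invariance under the shift at the exceptional positions follows from invariance elsewhere. -/
theorem eq_shift_of_isExceptional (hp : 1 < p) (hf : 0 < f) (hf' : 0 < f')
    (hr : Function.Periodic r f)
    (hs : Function.Periodic s f) (hs' : Function.Periodic s f')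
    (hQ : Q → ∃ w θ, IsCycle p f' r s lam γ w θ)
    {B : ℤ → ℕ → Prop} (hB : ∀ w θ, IsCycle p f' r s lam γ w θ → ∀ i, B i (w i)) {ζ : ℤ → ℕ → F}
    (hζ : Function.Periodic ζ f')
    (h : ∀ i w, B i w → ¬IsExceptional p f f' Q r s i w → ζ i w = shift p r s lam ζ i w)
    (i : ℤ) (w : ℕ) (hw : B i w) : ζ i w = shift p r s lam ζ i w := by
  by_cases hx : IsExceptional p f f' Q r s i w
  swap
  · exact h i w hw hx
  obtain ⟨c, θ, hc⟩ := hQ hx.1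
  obtain rfl := hc.eq_of_isExceptional hp hf hr hs hs' hx
  rw [shift_apply (by omega) (hc.add_eq i)]
  -- Walking along the cycle from the exceptional index i, the next exceptional index is i + f', so
  -- ζ is shift-invariant at each intermediate step and stays proportional to θ. At k = f' - 1 this
  -- compares indices i - 1 and i, where θ is invariant; hence so is ζ.
  have h1 : ∀ k : ℕ, k < f' → ζ (i + k) (c (i + k)) * θ i = θ (i + k) * ζ i (c i) := by
    intro k
    induction k with
    | zero => intro _; simp [mul_comm]
    | succ k ih =>
      intro hk
      have h2 := hc.add_eq (i + (k + 1 : ℕ))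
      have h3 := hc.mul_eq (i + (k + 1 : ℕ))
      rw [show i + (k + 1 : ℕ) - 1 = i + k by push_cast; ring] at h2 h3
      have h4 : ¬IsExceptional p f f' Q r s (i + (k + 1 : ℕ)) (c (i + (k + 1 : ℕ))) := by
        rintro ⟨-, h5, -⟩
        have h6 := (dvd_add_right hx.2.1).1 h5
        have := Nat.le_of_dvd (by omega) (Int.natCast_dvd_natCast.1 h6)
        omega
      rw [h _ _ (hB _ _ hc _) h4, shift_apply (w' := c (i + k)) (by omega) h2,
        show i + (k + 1 : ℕ) - 1 = i + k by push_cast; ring, h3]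
      linear_combination lam (i + (k + 1 : ℕ)) * ih (by omega)
  have h2 := h1 (f' - 1) (by omega)
  rw [show i + (f' - 1 : ℕ) = i - 1 + f' by push_cast [Nat.cast_sub (show 1 ≤ f' by omega)]; ring,
    hζ (i - 1), hc.periodic (i - 1), hc.periodic' (i - 1)] at h2
  have h3 := hc.mul_eq i
  refine mul_right_cancel₀ (hc.ne_zero i) ?_
  linear_combination ζ i (c i) * h3 - lam i * h2

/-- The operator 1 - cut ∘ shift on the finite-dimensional space Z is injective, hence surjective. A
kernel element is shift-invariant away from the exceptional positions, therefore everywhere, and so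
is supported on a cycle. But every cycle passes through the exceptional position at index 0, where
the kernel element has been cut to 0. -/
theorem exists_solution (hp : 2 < p) (hf : 0 < f) (hf' : 0 < f') {e : ℕ} (he : 0 < e)
    (hse : ∀ i, s i ≤ e) (hr' : Function.Periodic r f')
    (hr : Function.Periodic r f) (hs : Function.Periodic s f) (hs' : Function.Periodic s f')
    (hlam : Function.Periodic lam f') (hγ : ∀ i, γ i = r i + p * (γ (i - 1) - s (i - 1)))
    (hQ : Q ↔ ∃ w θ, IsCycle p f' r s lam γ w θ) {h : ℤ → ℕ → F} (hh : Function.Periodic h f')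
    (hhγ : ∀ i w, h i w ≠ 0 → ((w + s i : ℕ) : ZMod n) = γ i) :
    ∃ ζ : ℤ → ℕ → F, Function.Periodic ζ f' ∧
      (∀ i w, ζ i w ≠ 0 → w + s i < e * p ∧ ((w + s i : ℕ) : ZMod n) = γ i) ∧
      ∀ i w, w + s i < e * p → ¬IsExceptional p f f' Q r s i w →
        ζ i w = shift p r s lam ζ i w + h i w := by
  classical
  let Z : Submodule F (ℤ → ℕ → F) :=
    { carrier := {ζ | Function.Periodic ζ f' ∧
        ∀ i w, ζ i w ≠ 0 → w + s i < e * p ∧ ((w + s i : ℕ) : ZMod n) = γ i}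
      zero_mem' := ⟨fun _ => rfl, fun i w h => absurd rfl h⟩
      add_mem' := by
        rintro ζ ξ ⟨h1, h2⟩ ⟨h3, h4⟩
        refine ⟨h1.add h3, fun i w h5 => ?_⟩
        by_cases h6 : ζ i w = 0
        · refine h4 i w fun h7 => h5 ?_
          rw [Pi.add_apply, Pi.add_apply, h6, h7, add_zero]
        · exact h2 i w h6
      smul_mem' := by
        rintro t ζ ⟨h1, h2⟩
        refine ⟨fun i => ?_, fun i w h5 => h2 i w fun h6 => h5 ?_⟩
        · rw [Pi.smul_apply, Pi.smul_apply, h1 i]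
        · rw [Pi.smul_apply, Pi.smul_apply, h6, smul_zero] }
  have hZ : ∀ ζ, ζ ∈ Z ↔ Function.Periodic ζ f' ∧
    ∀ i w, ζ i w ≠ 0 → w + s i < e * p ∧ ((w + s i : ℕ) : ZMod n) = γ i := fun _ => Iff.rfl
  -- A member of Z is determined by its values for 0 ≤ i < f' and w < ep.
  have hfin : FiniteDimensional F Z := by
    let res : Z →ₗ[F] (Fin f' → Fin (e * p) → F) :=
      { toFun := fun ζ i w => ζ.1 (i : ℕ) w
        map_add' := fun _ _ => rfl
        map_smul' := fun _ _ => rfl }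
    refine FiniteDimensional.of_injective res ?_
    rw [← LinearMap.ker_eq_bot, LinearMap.ker_eq_bot']
    rintro ⟨ζ, hζ⟩ h0
    obtain ⟨h1, h2⟩ := (hZ ζ).1 hζ
    refine Subtype.ext (funext fun i => funext fun w => ?_)
    by_contra h3
    have h4 := (h2 i w h3).1
    have h5 := Int.emod_nonneg i (b := f') (by omega)
    have h6 := Int.emod_lt_of_pos i (b := f') (by omega)
    have h7 := congrFun (congrFun h0 ⟨(i % f').toNat, by omega⟩) ⟨w, by omega⟩
    change ζ ((i % f').toNat : ℕ) w = 0 at h7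
    rw [Int.toNat_of_nonneg h5, Int.emod_def, mul_comm,
      show i - i / f' * f' = i + (-(i / f')) * f' by ring,
      periodic_add_mul h1] at h7
    exact h3 h7
  -- The positions to be cleared.
  let E : ℤ → ℕ → Prop := fun i w => w + s i < e * p ∧ ¬IsExceptional p f f' Q r s i w
  have hE : ∀ i w, E (i + f') w ↔ E i w := by
    intro i w
    simp only [E, IsExceptional, hs' i, dvd_add_self_right]
  let cut : (ℤ → ℕ → F) →ₗ[F] (ℤ → ℕ → F) :=
    { toFun := fun ζ i w => if E i w then ζ i w else 0
      map_add' := fun ζ ξ => by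
        funext i w
        simp only [Pi.add_apply]
        split_ifs <;> simp
      map_smul' := fun t ζ => by
        funext i w
        simp only [Pi.smul_apply, RingHom.id_apply]
        split_ifs <;> simp }
  have hcut : ∀ ζ i w, cut ζ i w = if E i w then ζ i w else 0 := fun _ _ _ => rfl
  have hcutp : ∀ ζ : ℤ → ℕ → F, Function.Periodic ζ f' → Function.Periodic (cut ζ) f' := by
    intro ζ h1 i
    funext w
    simp only [hcut, hE, h1 i]
  have hmaps : ∀ ζ ∈ Z, (cut ∘ₗ shift p r s lam) ζ ∈ Z := by
    intro ζ hζ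
    obtain ⟨h1, h2⟩ := (hZ ζ).1 hζ
    refine (hZ _).2 ⟨hcutp _ (shift_periodic hr' hs' hlam h1), fun i w h3 => ?_⟩
    rw [LinearMap.comp_apply, hcut] at h3
    split_ifs at h3 with h4
    · refine ⟨h4.1, ?_⟩
      obtain ⟨w', h5, h6⟩ := exists_of_shift_ne_zero h3
      have h7 : ζ (i - 1) w' ≠ 0 := fun h7 => h3 (by rw [h6, h7, mul_zero])
      -- The recursion for γ says that the shift respects the prescribed residues.
      rw [h5, hγ, ← (h2 _ _ h7).2]
      push_cast
      ring
    · exact absurd rfl h3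
  let T : Z →ₗ[F] Z := LinearMap.id - (cut ∘ₗ shift p r s lam).restrict hmaps
  have hT : ∀ ζ : Z, ∀ i w, (T ζ).1 i w = ζ.1 i w - cut (shift p r s lam ζ.1) i w :=
    fun _ _ _ => rfl
  have hinj : Function.Injective T := by
    rw [← LinearMap.ker_eq_bot, LinearMap.ker_eq_bot']
    rintro ⟨ζ, hζ⟩ h0
    obtain ⟨h1, h2⟩ := (hZ ζ).1 hζ
    have h3 : ∀ i w, ζ i w = if E i w then shift p r s lam ζ i w else 0 := by
      intro i w
      have h4 := hT ⟨ζ, hζ⟩ i w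
      rw [h0] at h4
      exact (sub_eq_zero.1 h4.symm).trans (hcut _ _ _)
    have h5 := eq_shift_of_isExceptional (B := fun i w => w + s i < e * p) (by omega) hf hf' hr hs
      hs' hQ.1 (fun w θ hc i => by
        have := hc.lt hp he hf' hse i
        have := hse i
        nlinarith) h1
      (fun i w h6 h7 => by rw [h3, if_pos ⟨h6, h7⟩])
    refine Subtype.ext (funext fun i => funext fun w => ?_)
    by_contra h6
    obtain ⟨c, hc, -⟩ := exists_isCycle (lam := lam) (show 1 < p by omega) hf hf' hr hs h1
      (fun i w h7 => by
        have h8 := h5 i w (h2 i w h7).1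
        obtain ⟨w', h9, h10⟩ := exists_of_shift_ne_zero (h8 ▸ h7)
        exact ⟨w', h9, h8.trans h10⟩) (fun i w h7 => (h2 i w h7).2) h6
    apply hc.ne_zero 0
    rw [h3, if_neg]
    rintro ⟨-, h7⟩
    exact h7 ⟨hQ.2 ⟨_, _, hc⟩, dvd_zero _, hc.eq_alpha (by omega) hf hr hs 0⟩
  have hh' : cut h ∈ Z := by
    refine (hZ _).2 ⟨hcutp _ hh, fun i w h3 => ?_⟩
    rw [hcut] at h3
    split_ifs at h3 with h4
    · exact ⟨h4.1, hhγ _ _ h3⟩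
    · exact absurd rfl h3
  obtain ⟨⟨ζ, hζ⟩, h1⟩ := (LinearMap.injective_iff_surjective.1 hinj) ⟨cut h, hh'⟩
  obtain ⟨h2, h3⟩ := (hZ ζ).1 hζ
  refine ⟨ζ, h2, h3, fun i w h4 h5 => ?_⟩
  have h6 := hT ⟨ζ, hζ⟩ i w
  rw [h1] at h6
  change cut h i w = ζ i w - cut (shift p r s lam ζ) i w at h6
  rw [hcut, hcut, if_pos ⟨h4, h5⟩, if_pos ⟨h4, h5⟩] at h6
  rw [h6]
  ring

end Chains

/-! ### The change-of-lift operator in coordinates -/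

section ShiftCoordinates

variable {p e : ℕ} [Fact p.Prime] {k : Type u} {kE : Type v} [Field k] [Field kE]
variable [Algebra (ZMod p) k] [Algebra (ZMod p) kE]
variable {G : Type t} [Group G] {act : G →* RingAut k} {η : G → kˣ}
variable {f f' n : ℕ} {σ : ℤ → k →+* kE} {r s : ℤ → ℕ} {a b : ℤ → kEˣ} {c d : ℤ → ZMod n}

/-- The element `a⁻¹ b φ(z)`. -/
noncomputable def twistedPhi (p e f : ℕ) [Fact p.Prime] {k : Type u} {kE : Type v} [Field k]
    [Field kE] [Algebra (ZMod p) k] [Algebra (ZMod p) kE] (σ : ℤ → k →+* kE) (a b : ℤ → kEˣ)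
    (z : BreuilRing p e k kE) : BreuilRing p e k kE :=
  underA p e f σ (fun i => (a i)⁻¹) * (underA p e f σ b * phi p e k kE z)

/-- The scalars `b_i / a_i`. -/
def ratio (a b : ℤ → kEˣ) (i : ℤ) : kE := (((a i)⁻¹ : kEˣ) : kE) * (b i : kE)

theorem ratio_ne_zero (a b : ℤ → kEˣ) (i : ℤ) : ratio a b i ≠ 0 :=
  mul_ne_zero (Units.ne_zero _) (Units.ne_zero _)

theorem ratio_periodic (ha : Function.Periodic a f') (hb : Function.Periodic b f') :
    Function.Periodic (ratio a b) f' := fun i => by rw [ratio, ratio, ha i, hb i]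

/-- The residues of the degrees that occur in normal forms. -/
def degreeResidue (r : ℤ → ℕ) (c d : ℤ → ZMod n) (i : ℤ) : ZMod n := r i + c i - d i

/-- This follows from the recursions for c and d, and provides the compatibility of residues with
the shift required in `exists_solution`. -/
theorem RankOneParams.degreeResidue_eq (hr : RankOneParams p e f' n r a c)
    (hs : RankOneParams p e f' n s b d) (i : ℤ) :
    degreeResidue r c d i = r i + p * (degreeResidue r c d (i - 1) - s (i - 1)) := by
  have h1 := hr.c_succ (i - 1)
  have h2 := hs.c_succ (i - 1)
  rw [sub_add_cancel] at h1 h2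
  rw [degreeResidue, degreeResidue, h1, h2]
  ring

theorem IsTameDatum.cast_mul_cancel (hG : IsTameDatum p f f' n act η) {x y : ZMod n}
    (h : (p : ZMod n) * x = p * y) : x = y :=
  ((ZMod.isUnit_iff_coprime p n).2
    (((Fact.out : p.Prime).coprime_iff_not_dvd).2 hG.not_dvd)).mul_left_cancel h

variable [Finite kE] (hσ : IsFrobeniusSystem p f σ) (hG : IsTameDatum p f f' n act η)
variable (hr : RankOneParams p e f' n r a c) (hs : RankOneParams p e f' n s b d)

include hσ in
theorem coef_twistedPhi (ha : Function.Periodic a f) (hb : Function.Periodic b f) (i : ℤ) (j : ℕ)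
    (z : BreuilRing p e k kE) : coef (σ i) j (twistedPhi p e f σ a b z) =
      if p ∣ j ∧ j < e * p then ratio a b i * coef (σ (i - 1)) (j / p) z else 0 := by
  have h1 := hσ.coef_phi (i - 1) j z
  rw [sub_add_cancel] at h1
  have ha' : Function.Periodic (fun i => (a i)⁻¹) f := fun i => by simp only [ha i]
  rw [twistedPhi, hσ.coef_underA_mul ha', hσ.coef_underA_mul hb, h1, ratio]
  split_ifs <;> ring

include hσ hG hr hs in
theorem coef_twistedPhi_mul (i : ℤ) {w : ℕ} (hw : w < e) (z : BreuilRing p e k kE) :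
    coef (σ i) (p * w) (twistedPhi p e f σ a b z) = ratio a b i * coef (σ (i - 1)) w z := by
  have hp := (Fact.out : p.Prime).pos
  rw [coef_twistedPhi hσ (hG.periodic hr.a_periodic) (hG.periodic hs.a_periodic), if_pos,
    Nat.mul_div_cancel_left _ hp]
  exact ⟨dvd_mul_right _ _, by rw [mul_comm]; exact Nat.mul_lt_mul_of_pos_right hw hp⟩

include hσ hG hr hs in
theorem exists_of_coef_twistedPhi {i : ℤ} {j : ℕ} {z : BreuilRing p e k kE}
    (h : coef (σ i) j (twistedPhi p e f σ a b z) ≠ 0) :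
    ∃ w < e, j = p * w ∧ coef (σ (i - 1)) w z ≠ 0 := by
  have hp := (Fact.out : p.Prime).pos
  rw [coef_twistedPhi hσ (hG.periodic hr.a_periodic) (hG.periodic hs.a_periodic)] at h
  split_ifs at h with h1
  · exact ⟨j / p, Nat.div_lt_of_lt_mul (by rw [mul_comm]; exact h1.2),
      (Nat.mul_div_cancel' h1.1).symm, fun h2 => h (by rw [h2, mul_zero])⟩
  · exact absurd rfl h

include hσ hG hr hs in
theorem coef_mul_twistedPhi {i : ℤ} {j w : ℕ} (h : j = r i + p * w) (hj : j < e * p)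
    (z : BreuilRing p e k kE) :
    coef (σ i) j (underU p e f σ r * twistedPhi p e f σ a b z) =
      ratio a b i * coef (σ (i - 1)) w z := by
  have hw : w < e := by
    by_contra! hw
    have := Nat.mul_le_mul_left p hw
    rw [mul_comm p e] at this
    omega
  rw [hσ.coef_underU_mul (hG.periodic hr.r_periodic), if_pos ⟨by omega, hj⟩,
    show j - r i = p * w by omega, coef_twistedPhi_mul hσ hG hr hs i hw]

include hσ hG hr hs in
theorem exists_of_coef_mul_twistedPhi {i : ℤ} {j : ℕ} {z : BreuilRing p e k kE}
    (h : coef (σ i) j (underU p e f σ r * twistedPhi p e f σ a b z) ≠ 0) :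
    ∃ w < e, j = r i + p * w ∧ coef (σ (i - 1)) w z ≠ 0 := by
  rw [hσ.coef_underU_mul (hG.periodic hr.r_periodic)] at h
  split_ifs at h with h1
  · obtain ⟨w, h2, h3, h4⟩ := exists_of_coef_twistedPhi hσ hG hr hs h
    exact ⟨w, h2, by omega, h4⟩
  · exact absurd rfl h

include hσ hG hr hs in
/-- The coefficients of `u^r a⁻¹ b φ(z)` are described by the shift operator. -/
theorem coef_mul_twistedPhi_eq_shift {ζ : ℤ → ℕ → kE} {z : BreuilRing p e k kE}
    (hζ : ∀ i w, w < e → coef (σ i) w z = ζ i w) {i : ℤ} {w : ℕ} (hw : w + s i < e * p) :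
    coef (σ i) (w + s i) (underU p e f σ r * twistedPhi p e f σ a b z) =
      shift p r s (ratio a b) ζ i w := by
  have hp := (Fact.out : p.Prime).pos
  by_cases h : ∃ w', w + s i = r i + p * w'
  · obtain ⟨w', h⟩ := h
    have hw' : w' < e := by
      by_contra! hw'
      have := Nat.mul_le_mul_left p hw'
      rw [mul_comm p e] at this
      omega
    rw [coef_mul_twistedPhi hσ hG hr hs h hw, shift_apply hp h, hζ _ _ hw']
  · rw [not_exists] at h
    have h1 : coef (σ i) (w + s i) (underU p e f σ r * twistedPhi p e f σ a b z) = 0 := by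
      by_contra h1
      obtain ⟨w', -, h2, -⟩ := exists_of_coef_mul_twistedPhi hσ hG hr hs h1
      exact h w' h2
    rw [h1]
    by_contra h2
    obtain ⟨w', h3, -⟩ := exists_of_shift_ne_zero (Ne.symm h2)
    exact h w' h3

include hσ hG hr hs in
-- The coefficient of z at (i, w) reappears at (i + 1, pw), up to a unit, when w < e, and is lost
-- otherwise. Since p is invertible modulo n, the congruence for pw at i + 1 can be divided by p to
-- give one for w at i.
theorem twistedPhi_equivariant_iff (z : BreuilRing p e k kE) :
    (∀ g, twist p e kE (act g) (η g) (twistedPhi p e f σ a b z) * underZ p e f σ (η g) d =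
      underZ p e f σ (η g) c * twistedPhi p e f σ a b z) ↔
    (∀ i w, w < e → coef (σ (i + f')) w z = coef (σ i) w z) ∧
      ∀ i w, w < e → coef (σ i) w z ≠ 0 → ((w + s i : ℕ) : ZMod n) = degreeResidue r c d i := by
  have hlam := ratio_periodic hr.a_periodic hs.a_periodic
  have hmul := fun i w hw => coef_twistedPhi_mul hσ hG hr hs i (w := w) hw z
  rw [hG.equivariant_iff hσ hr.c_periodic hs.c_periodic]
  constructor
  · rintro ⟨h1, h2⟩
    refine ⟨fun i w hw => ?_, fun i w hw h0 => ?_⟩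
    · have h3 := h2 (i + 1) (p * w)
      rw [hmul _ _ hw, hmul _ _ hw, hlam (i + 1), add_sub_cancel_right,
        show i + 1 + (f' : ℤ) - 1 = i + f' by ring] at h3
      exact mul_left_cancel₀ (ratio_ne_zero a b _) h3
    · have h3 := h1 (i + 1) (p * w) (by
        rw [hmul _ _ hw, add_sub_cancel_right]
        exact mul_ne_zero (ratio_ne_zero a b _) h0)
      rw [hr.c_succ, hs.c_succ] at h3
      have h4 : (p : ZMod n) * (w + d i + s i) = p * (c i + r i) := by
        rw [← h3]; push_cast; ring
      have h5 := hG.cast_mul_cancel h4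
      rw [degreeResidue]
      push_cast
      linear_combination h5
  · rintro ⟨h1, h2⟩
    refine ⟨fun i j h0 => ?_, fun i j => ?_⟩
    · obtain ⟨w, hw, rfl, h3⟩ := exists_of_coef_twistedPhi hσ hG hr hs h0
      have h4 := h2 _ _ hw h3
      have h5 := hr.degreeResidue_eq hs i
      rw [← h4, degreeResidue] at h5
      push_cast at h5 ⊢
      linear_combination -h5
    · by_cases h3 : ∃ w < e, j = p * w
      · obtain ⟨w, hw, rfl⟩ := h3
        rw [hmul _ _ hw, hmul _ _ hw, hlam i, show i + (f' : ℤ) - 1 = i - 1 + f' by ring,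
          h1 _ _ hw]
      · have h4 : ∀ i, coef (σ i) j (twistedPhi p e f σ a b z) = 0 := by
          intro i
          by_contra h4
          obtain ⟨w, hw, h5, -⟩ := exists_of_coef_twistedPhi hσ hG hr hs h4
          exact h3 ⟨w, hw, h5⟩
        rw [h4, h4]

variable {M N : BreuilModule.{u, v, t, w} p e kE act η} {m : M.carrier} {n₀ : N.carrier}
variable (hM : IsRankOne M f σ r a c m) (hN : IsRankOne N f σ s b d n₀)

/-- The truncated coefficients of an element of `(k ⊗ k_E)[u]/u^{ep}`. -/
noncomputable def truncCoef (σ : ℤ → k →+* kE) (z : BreuilRing p e k kE) (i : ℤ) (w : ℕ) : kE :=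
  if w < e then coef (σ i) w z else 0

theorem truncCoef_of_lt {z : BreuilRing p e k kE} {i : ℤ} {w : ℕ} (h : w < e) :
    truncCoef σ z i w = coef (σ i) w z := if_pos h

theorem lt_of_truncCoef {z : BreuilRing p e k kE} {i : ℤ} {w : ℕ} (h : truncCoef σ z i w ≠ 0) :
    w < e := by
  by_contra h1
  exact h (if_neg h1)

theorem truncCoef_periodic {z : BreuilRing p e k kE}
    (h : ∀ i w, w < e → coef (σ (i + f')) w z = coef (σ i) w z) :
    Function.Periodic (truncCoef σ z) f' := by
  intro i
  funext w
  rw [truncCoef, truncCoef]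
  split_ifs with h1
  · exact h i w h1
  · rfl

/-- As p ≥ 2, degrees w + s_i with w < e escape truncation at u^{ep}. -/
theorem add_lt_of_lt (hp : 1 < p) {w x : ℕ} (hw : w < e) (hx : x ≤ e) : w + x < e * p := by
  have := Nat.mul_le_mul_left e hp
  omega

include hσ hG hr hs in
theorem truncCoef_chain {z : BreuilRing p e k kE}
    (h : ∀ i w, w < e →
      truncCoef σ z i w = shift p r s (ratio a b) (truncCoef σ z) i w) (i : ℤ) (w : ℕ)
    (hw : truncCoef σ z i w ≠ 0) : ∃ w', w + s i = r i + p * w' ∧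
      truncCoef σ z i w = ratio a b i * truncCoef σ z (i - 1) w' := by
  have h1 := h i w (lt_of_truncCoef hw)
  obtain ⟨w', h2, h3⟩ := exists_of_shift_ne_zero (h1 ▸ hw)
  exact ⟨w', h2, h1.trans h3⟩

include hσ hG hr hs hM hN in
-- For w < e, the equation z u^s = u^r a⁻¹ b φ(z) says that the coefficients of z are fixed by the
-- shift; they do not all vanish if the morphism is nonzero, so they contain a cycle. Conversely, a
-- cycle gives z with the single term θ_i u^{w_i} at each index.
theorem hasNonzeroMorphism_iff_exists_isCycle (hp2 : 2 < p) (he : 0 < e) :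
    HasNonzeroMorphism M N ↔
      ∃ w θ, IsCycle p f' r s (ratio a b) (degreeResidue r c d) w θ := by
  have hp := (Fact.out : p.Prime).one_lt
  have hrp := hG.periodic hr.r_periodic
  have hsp := hG.periodic hs.r_periodic
  rw [hasNonzeroMorphism_iff hσ hG hr hM hN]
  change (∃ z : BreuilRing p e k kE, z * underU p e f σ s =
    underU p e f σ r * twistedPhi p e f σ a b z ∧ (∀ g, twist p e kE (act g) (η g)
      (twistedPhi p e f σ a b z) * underZ p e f σ (η g) d =
      underZ p e f σ (η g) c * twistedPhi p e f σ a b z) ∧ twistedPhi p e f σ a b z ≠ 0) ↔ _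
  constructor
  · rintro ⟨z, hz, hg, h0⟩
    obtain ⟨h1, h2⟩ := (twistedPhi_equivariant_iff hσ hG hr hs z).1 hg
    have h3 : ∀ i w, w < e →
        truncCoef σ z i w = shift p r s (ratio a b) (truncCoef σ z) i w := by
      intro i w hw
      have h4 := add_lt_of_lt hp hw (hs.r_le i)
      rw [← coef_mul_twistedPhi_eq_shift hσ hG hr hs
        (fun i w hw => (truncCoef_of_lt hw).symm) h4, ← hz, hσ.coef_mul_underU hsp,
        if_pos ⟨by omega, h4⟩, Nat.add_sub_cancel, truncCoef_of_lt hw]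
    have h4 : ∃ i w, truncCoef σ z i w ≠ 0 := by
      by_contra! h4
      refine h0 (hσ.coef_ext fun i j _ => ?_)
      rw [coef_zero]
      by_contra h5
      obtain ⟨w, hw, -, h6⟩ := exists_of_coef_twistedPhi hσ hG hr hs h5
      exact h6 ((truncCoef_of_lt hw).symm.trans (h4 _ _))
    obtain ⟨i, w, h4⟩ := h4
    obtain ⟨c, hc, -⟩ := exists_isCycle (lam := ratio a b) (γ := degreeResidue r c d) hp hσ.pos
      hG.deg_pos hrp hsp (truncCoef_periodic h1) (truncCoef_chain hσ hG hr hs h3)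
      (fun i w h5 => by
        have h6 := lt_of_truncCoef h5
        exact h2 i w h6 (truncCoef_of_lt (σ := σ) (z := z) h6 ▸ h5)) h4
    exact ⟨_, _, hc⟩
  · rintro ⟨w, θ, hc⟩
    -- The bound w_i < e ensures that φ(z), and with it the morphism, is nonzero.
    have hwe := hc.lt hp2 he hG.deg_pos hs.r_le
    have hF : Function.Periodic (fun i j => if j = w i then θ i else 0) f := by
      refine hG.periodic fun i => ?_
      simp only [hc.periodic i, hc.periodic' i]
    obtain ⟨z, hz⟩ := hσ.exists_coef (e := e) hF
    have hz1 : ∀ i, coef (σ i) (w i) z = θ i := fun i => by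
      rw [hz, if_pos (by have := add_lt_of_lt hp (hwe i) (Nat.zero_le e); omega), if_pos rfl]
    have hz2 : ∀ i j, coef (σ i) j z ≠ 0 → j = w i := by
      intro i j h
      by_contra h1
      rw [hz, if_neg h1] at h
      simp at h
    refine ⟨z, hσ.coef_ext fun i j hj => ?_, (twistedPhi_equivariant_iff hσ hG hr hs z).2
      ⟨fun i j _ => ?_, fun i j _ h => ?_⟩, fun h0 => ?_⟩
    · rw [hσ.coef_mul_underU hsp]
      by_cases h : j = w i + s i
      · rw [coef_mul_twistedPhi hσ hG hr hs (h.trans (hc.add_eq i)) hj, hz1, ← hc.mul_eq,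
          if_pos ⟨by omega, hj⟩, show j - s i = w i by omega, hz1]
      · have h1 : coef (σ i) j (underU p e f σ r * twistedPhi p e f σ a b z) = 0 := by
          by_contra h1
          obtain ⟨x, -, h2, h3⟩ := exists_of_coef_mul_twistedPhi hσ hG hr hs h1
          rw [hz2 _ _ h3, ← hc.add_eq] at h2
          exact h h2
        rw [h1]
        split_ifs with h2
        · by_contra h3
          have := hz2 _ _ h3
          omega
        · rfl
    · simp only [hz, hc.periodic i, hc.periodic' i]
    · rw [hz2 _ _ h]
      exact hc.congr i
    · have h1 := coef_twistedPhi_mul hσ hG hr hs 0 (hwe (0 - 1)) z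
      rw [h0, coef_zero, hz1, ← hc.mul_eq] at h1
      exact hc.ne_zero _ h1.symm

end ShiftCoordinates

/-! ### Existence and uniqueness of normal forms -/

section NormalForm

variable {p e : ℕ} [Fact p.Prime] {k : Type u} {kE : Type v} [Field k] [Field kE]
variable [Algebra (ZMod p) k] [Algebra (ZMod p) kE]
variable {G : Type t} [Group G] {act : G →* RingAut k} {η : G → kˣ}
variable {f f' n : ℕ} {σ : ℤ → k →+* kE} {r s : ℤ → ℕ} {a b : ℤ → kEˣ} {c d : ℤ → ZMod n}

/-- The polynomials of degree `< ep` with the coefficients of `x`. -/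
noncomputable def toPoly (σ : ℤ → k →+* kE) (x : BreuilRing p e k kE) (i : ℤ) : kE[X] :=
  ∑ j ∈ Finset.range (e * p), monomial j (coef (σ i) j x)

theorem coeff_toPoly (x : BreuilRing p e k kE) (i : ℤ) (j : ℕ) :
    (toPoly σ x i).coeff j = coef (σ i) j x := by
  rw [toPoly, finsetSum_coeff]
  simp only [coeff_monomial, Finset.sum_ite_eq', Finset.mem_range]
  split_ifs with h
  · rfl
  · rw [coef_of_le _ (not_lt.1 h)]

variable [Finite kE] (hσ : IsFrobeniusSystem p f σ) (hG : IsTameDatum p f f' n act η)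
variable (hr : RankOneParams p e f' n r a c) (hs : RankOneParams p e f' n s b d)

include hσ in
theorem underH_toPoly (x : BreuilRing p e k kE) : underH p e f σ (toPoly σ x) = x := by
  refine hσ.coef_ext fun i j hj => ?_
  rw [hσ.coef_underH (fun i => by rw [toPoly, toPoly, hσ.periodic i]), if_pos hj, coeff_toPoly]

theorem Admissible.not_exceptional {Q : Prop} {h : ℤ → kE[X]}
    (hh : Admissible p e f f' n Q r c s d h) {i : ℤ} {w : ℕ}
    (hw : ¬IsExceptional p f f' Q r s i w) : (h i).coeff (w + s i) = 0 := by
  by_contra h0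
  rcases hh.degree _ _ h0 with h1 | h1
  · omega
  · exact hw h1

include hσ hG in
theorem Admissible.coef_underH {Q : Prop} {h : ℤ → kE[X]}
    (hh : Admissible p e f f' n Q r c s d h) (i : ℤ) (j : ℕ) :
    coef (σ i) j (underH p e f σ h) = (h i).coeff j := by
  rw [hσ.coef_underH (hG.periodic hh.periodic)]
  split_ifs with hj
  · rfl
  · refine (coeff_eq_zero_of_degree_lt ((hh.degree_lt i).trans_le ?_)).symm
    exact_mod_cast not_lt.1 hj

variable {M N : BreuilModule.{u, v, t, w} p e kE act η} {m : M.carrier} {n₀ : N.carrier}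
variable (hM : IsRankOne M f σ r a c m) (hN : IsRankOne N f σ s b d n₀)

include hσ hG hr hs hM hN in
-- Start from an equivariant h and change the lift by the z whose coefficients solve the shift
-- equation with right-hand side -h. All terms in degrees ≥ s_i disappear except the exceptional
-- ones, while the congruence and periodicity are preserved.
theorem exists_admissible [Finite G] (hp2 : 2 < p) (he : 0 < e) (E : Extension M N) :
    ∃ h, Admissible p e f f' n (HasNonzeroMorphism M N) r c s d h ∧
      E.HasForm f σ r a c m n₀ (underH p e f σ h) := by
  have hrp := hG.periodic hr.r_periodic
  have hsp := hG.periodic hs.r_periodic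
  obtain ⟨h, hF, hh⟩ := E.exists_hasForm hσ hG hr hM hN
  obtain ⟨h1, h2⟩ := (hG.equivariant_iff hσ (c := fun i => c i + (r i : ZMod n)) (fun i => by
    simp only [hr.c_periodic i, hr.r_periodic i]) hs.c_periodic h).1 hh
  have hγ : ∀ i j, coef (σ i) j h ≠ 0 → (j : ZMod n) = degreeResidue r c d i := by
    intro i j h3
    rw [degreeResidue]
    linear_combination h1 i j h3
  obtain ⟨ζ, h3, h4, h5⟩ := exists_solution (p := p) (lam := ratio a b) hp2 hσ.pos hG.deg_pos he
    hs.r_le hr.r_periodic hrp hsp hs.r_periodic (ratio_periodic hr.a_periodic hs.a_periodic)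
    (hr.degreeResidue_eq hs) (hasNonzeroMorphism_iff_exists_isCycle hσ hG hr hs hM hN hp2 he)
    (h := fun i w => -coef (σ i) (w + s i) h)
    (fun i => by simp only [hs.r_periodic i, h2]) (fun i w h3 => hγ _ _ (neg_ne_zero.1 h3))
  obtain ⟨z, hz⟩ := hσ.exists_coef (e := e) (hG.periodic h3)
  -- The support of ζ lies in w + s_i < ep, so truncation loses nothing.
  replace hz : ∀ i w, coef (σ i) w z = ζ i w := by
    intro i w
    rw [hz]
    split_ifs with h6
    · rfl
    · by_contra h7
      have := (h4 i w (Ne.symm h7)).1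
      omega
  have hX := (twistedPhi_equivariant_iff hσ hG hr hs z).2
    ⟨fun i w _ => by rw [hz, hz, h3 i], fun i w _ h6 => (h4 i w (hz i w ▸ h6)).2⟩
  obtain ⟨hX1, hX2⟩ := (hG.equivariant_iff hσ hr.c_periodic hs.c_periodic _).1 hX
  obtain ⟨g, hg⟩ : ∃ g : BreuilRing p e k kE, g = h + z * underU p e f σ s -
    underU p e f σ r * twistedPhi p e f σ a b z := ⟨_, rfl⟩
  have hgF : E.HasForm f σ r a c m n₀ g := (hF.iff hσ hG hr hs hM hN g).2 ⟨z, hg, hX⟩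
  have hgc : ∀ i j, coef (σ i) j g = coef (σ i) j h +
      (if s i ≤ j ∧ j < e * p then ζ i (j - s i) else 0) -
      (if r i ≤ j ∧ j < e * p then coef (σ i) (j - r i) (twistedPhi p e f σ a b z) else 0) := by
    intro i j
    rw [hg, coef_sub, coef_add, hσ.coef_mul_underU hsp, hσ.coef_underU_mul hrp, hz]
  refine ⟨toPoly σ g, ⟨fun i => ?_, fun i => ?_, fun i => ?_, fun i j h6 => ?_, fun i j h6 => ?_⟩,
    by rwa [underH_toPoly hσ]⟩
  · rw [degree_lt_iff_coeff_zero]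
    intro j hj
    rw [coeff_toPoly, coef_of_le _ hj]
  · rw [X_pow_dvd_iff]
    intro j hj
    rw [coeff_toPoly]
    exact hgF.coef_eq_zero hσ hG hr hs hN i j hj
  · ext j
    rw [coeff_toPoly, coeff_toPoly, hgc, hgc, h2, hs.r_periodic i, hr.r_periodic i, h3 i, hX2]
  · rw [coeff_toPoly, hgc] at h6
    change (j : ZMod n) = degreeResidue r c d i
    by_cases h7 : coef (σ i) j h = 0
    · rw [h7, zero_add] at h6
      by_cases h8 : s i ≤ j ∧ j < e * p ∧ ζ i (j - s i) ≠ 0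
      · have := (h4 _ _ h8.2.2).2
        rwa [Nat.sub_add_cancel h8.1] at this
      · have h9 : (if s i ≤ j ∧ j < e * p then ζ i (j - s i) else 0) = 0 := by
          split_ifs with h9
          · by_contra h10
            exact h8 ⟨h9.1, h9.2, h10⟩
          · rfl
        rw [h9, zero_sub, neg_ne_zero] at h6
        split_ifs at h6 with h10
        · have h11 := hX1 _ _ h6
          rw [Nat.cast_sub h10.1] at h11
          rw [degreeResidue]
          linear_combination h11
        · exact absurd rfl h6
    · exact hγ _ _ h7
  · rw [coeff_toPoly] at h6
    by_contra! h7
    obtain ⟨h7, h8⟩ := h7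
    have h9 : j < e * p := by
      by_contra h9
      exact h6 (coef_of_le _ (not_lt.1 h9) _)
    obtain ⟨w, rfl⟩ := Nat.exists_eq_add_of_le' h7
    have h10 := h5 i w h9 fun ⟨h11, h12, h13⟩ => h8 h11 h12 h13
    apply h6
    rw [hg, coef_sub, coef_add, hσ.coef_mul_underU hsp, if_pos ⟨h7, h9⟩, Nat.add_sub_cancel, hz,
      coef_mul_twistedPhi_eq_shift hσ hG hr hs (fun i w _ => hz i w) h9, h10]
    ring

include hσ hG hr hs hM hN in
-- Two normal forms differ by z u^s - u^r a⁻¹ b φ(z). Both vanish at non-exceptional degrees ≥ s_i,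
-- so the coefficients of z in degrees below e are shift-invariant there, hence at the exceptional
-- positions as well. The forms then agree for w < e in degrees w + s_i. Below s_i only u^r φ(z)
-- could contribute, but its terms lie on a cycle, in degrees w_i + s_i ≥ s_i.
theorem Admissible.eq_of_hasForm (hp2 : 2 < p) (he : 0 < e) {E : Extension M N} {h h' : ℤ → kE[X]}
    (hh : Admissible p e f f' n (HasNonzeroMorphism M N) r c s d h)
    (hh' : Admissible p e f f' n (HasNonzeroMorphism M N) r c s d h')
    (hF : E.HasForm f σ r a c m n₀ (underH p e f σ h))
    (hF' : E.HasForm f σ r a c m n₀ (underH p e f σ h')) : h' = h := by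
  have hp := (Fact.out : p.Prime).one_lt
  have hrp := hG.periodic hr.r_periodic
  have hsp := hG.periodic hs.r_periodic
  have hQ := hasNonzeroMorphism_iff_exists_isCycle hσ hG hr hs hM hN hp2 he
  obtain ⟨z, hz, hX⟩ := (hF.iff hσ hG hr hs hM hN _).1 hF'
  change _ = _ - underU p e f σ r * twistedPhi p e f σ a b z at hz
  obtain ⟨h1, h2⟩ := (twistedPhi_equivariant_iff hσ hG hr hs z).1 hX
  have h3 : ∀ i j, (h' i).coeff j = (h i).coeff j + coef (σ i) j (z * underU p e f σ s) -
      coef (σ i) j (underU p e f σ r * twistedPhi p e f σ a b z) := by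
    intro i j
    rw [← hh'.coef_underH hσ hG, ← hh.coef_underH hσ hG, hz, coef_sub, coef_add]
  have h4 : ∀ i w, w < e → (h' i).coeff (w + s i) = (h i).coeff (w + s i) +
      truncCoef σ z i w - shift p r s (ratio a b) (truncCoef σ z) i w := by
    intro i w hw
    have h4 := add_lt_of_lt hp hw (hs.r_le i)
    rw [h3, hσ.coef_mul_underU hsp, if_pos ⟨by omega, h4⟩, Nat.add_sub_cancel,
      coef_mul_twistedPhi_eq_shift hσ hG hr hs (fun i w hw => (truncCoef_of_lt hw).symm) h4,
      truncCoef_of_lt hw]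
  have h5 := eq_shift_of_isExceptional (B := fun _ w => w < e) hp hσ.pos hG.deg_pos hrp hsp
    hs.r_periodic hQ.1 (fun w θ hc i => hc.lt hp2 he hG.deg_pos hs.r_le i)
    (truncCoef_periodic h1) (fun i w h5 h6 => by
      have h7 := h4 i w h5
      rw [hh.not_exceptional h6, hh'.not_exceptional h6] at h7
      linear_combination -h7)
  funext i
  ext j
  by_cases hj : s i ≤ j
  · obtain ⟨w, rfl⟩ := Nat.exists_eq_add_of_le' hj
    by_cases hw : w < e
    · rw [h4 i w hw, ← h5 i w hw, add_sub_cancel_right]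
    -- For w ≥ e neither form has a term: an exceptional position lies on a cycle and so has w < e.
    · have h6 : ¬IsExceptional p f f' (HasNonzeroMorphism M N) r s i w := by
        intro h6
        obtain ⟨c, θ, hc⟩ := hQ.1 h6.1
        rw [hc.eq_of_isExceptional hp hσ.pos hrp hsp hs.r_periodic h6] at hw
        exact hw (hc.lt hp2 he hG.deg_pos hs.r_le i)
      rw [hh.not_exceptional h6, hh'.not_exceptional h6]
  · rw [h3, hσ.coef_mul_underU hsp, if_neg (fun h => hj h.1), add_zero]
    suffices coef (σ i) j (underU p e f σ r * twistedPhi p e f σ a b z) = 0 by rw [this, sub_zero]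
    by_contra h6
    obtain ⟨w, hw, h7, h8⟩ := exists_of_coef_mul_twistedPhi hσ hG hr hs h6
    rw [← truncCoef_of_lt (σ := σ) hw] at h8
    obtain ⟨c, hc, h9⟩ := exists_isCycle (lam := ratio a b) (γ := degreeResidue r c d) hp hσ.pos
      hG.deg_pos hrp hsp (truncCoef_periodic h1) (truncCoef_chain hσ hG hr hs h5)
      (fun i w h5 => by
        have h6 := lt_of_truncCoef h5
        exact h2 i w h6 (truncCoef_of_lt (σ := σ) (z := z) h6 ▸ h5)) h8
    rw [h9 _ _ h8, ← hc.add_eq] at h7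
    omega

include hσ hG hr hs hM hN in
theorem Admissible.exists_extension {Q : Prop} {h : ℤ → kE[X]}
    (hh : Admissible p e f f' n Q r c s d h) :
    ∃ E : Extension M N, E.HasForm f σ r a c m n₀ (underH p e f σ h) := by
  refine BrMod.exists_extension hσ hG hr hs hM hN (fun i j hj => ?_) ?_
  · rw [hh.coef_underH hσ hG]
    exact X_pow_dvd_iff.1 (hh.dvd i) j hj
  · refine (hG.equivariant_iff hσ (c := fun i => c i + (r i : ZMod n)) (fun i => by
      simp only [hr.c_periodic i, hr.r_periodic i]) hs.c_periodic _).2 ⟨fun i j h1 => ?_,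
      fun i j => ?_⟩
    · rw [hh.coef_underH hσ hG] at h1
      rw [hh.congr i j h1]
      ring
    · rw [hh.coef_underH hσ hG, hh.coef_underH hσ hG, hh.periodic i]

end NormalForm

/-! ### Vector spaces of periodic polynomial sequences -/

section PeriodicPolynomials

variable {F : Type*} [Field F] {f' B : ℕ} {P : ℤ → ℕ → Prop}

/-- The periodic sequences of polynomials whose nonzero terms are in positions satisfying `P`. -/
def periodicPolynomials (F : Type*) [Field F] (f' : ℕ) (P : ℤ → ℕ → Prop) :
    Submodule F (ℤ → F[X]) where
  carrier := {h | Function.Periodic h f' ∧ ∀ i j, (h i).coeff j ≠ 0 → P i j}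
  zero_mem' := ⟨fun _ => rfl, fun i j h => absurd (coeff_zero j) h⟩
  add_mem' := by
    rintro h h' ⟨h1, h2⟩ ⟨h3, h4⟩
    refine ⟨h1.add h3, fun i j h5 => ?_⟩
    by_cases h6 : (h i).coeff j = 0
    · refine h4 i j fun h7 => h5 ?_
      rw [Pi.add_apply, coeff_add, h6, h7, add_zero]
    · exact h2 i j h6
  smul_mem' := by
    rintro t h ⟨h1, h2⟩
    refine ⟨fun i => by rw [Pi.smul_apply, Pi.smul_apply, h1 i], fun i j h5 => h2 i j fun h6 => h5 ?_⟩
    rw [Pi.smul_apply, coeff_smul, h6, smul_zero]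

theorem mem_periodicPolynomials {h : ℤ → F[X]} : h ∈ periodicPolynomials F f' P ↔
    Function.Periodic h f' ∧ ∀ i j, (h i).coeff j ≠ 0 → P i j := Iff.rfl

open Classical in
-- By periodicity a sequence is determined by its coefficients at the allowed positions with 0 ≤ i <
-- f', and these can be prescribed freely; the bound B makes their number finite.
theorem periodicPolynomials_equiv (hf' : 0 < f') (hP : Function.Periodic P f')
    (hB : ∀ i j, P i j → j < B) :
    Nonempty (periodicPolynomials F f' P ≃ₗ[F]
      (((Finset.range f' ×ˢ Finset.range B).filter fun x => P (x.1 : ℕ) x.2) → F)) := by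
  set I := (Finset.range f' ×ˢ Finset.range B).filter fun x => P (x.1 : ℕ) x.2 with hI
  have hmod : ∀ i : ℤ, ∃ i₀ : ℕ, i₀ < f' ∧ ∃ k : ℤ, i = i₀ + k * f' := by
    intro i
    have h1 := Int.emod_nonneg i (b := f') (by omega)
    have h2 := Int.emod_lt_of_pos i (b := f') (by omega)
    refine ⟨(i % f').toNat, by omega, i / f', ?_⟩
    rw [Int.toNat_of_nonneg h1]
    linear_combination -(Int.mul_ediv_add_emod i f')
  let L : periodicPolynomials F f' P →ₗ[F] (I → F) :=
    { toFun := fun h x => (h.1 (x.1.1 : ℕ)).coeff x.1.2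
      map_add' := fun h h' => funext fun x => coeff_add _ _ _
      map_smul' := fun t h => funext fun x => coeff_smul _ _ _ }
  refine ⟨LinearEquiv.ofBijective L ⟨?_, fun y => ?_⟩⟩
  · rw [← LinearMap.ker_eq_bot, LinearMap.ker_eq_bot']
    rintro ⟨h, h1, h2⟩ h0
    refine Subtype.ext (funext fun i => ?_)
    change h i = 0
    ext j
    rw [coeff_zero]
    by_contra h3
    obtain ⟨i₀, h4, k, rfl⟩ := hmod i
    rw [periodic_add_mul h1] at h3
    have h5 := h2 _ _ h3
    exact h3 (congrFun h0 ⟨(i₀, j), Finset.mem_filter.2 ⟨Finset.mem_product.2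
      ⟨Finset.mem_range.2 h4, Finset.mem_range.2 (hB _ _ h5)⟩, h5⟩⟩)
  · let g : ℕ → F[X] := fun i => ∑ j ∈ Finset.range B,
      monomial j (if hx : (i, j) ∈ I then y ⟨(i, j), hx⟩ else 0)
    have hg : ∀ i j, (g i).coeff j = if hx : (i, j) ∈ I then y ⟨(i, j), hx⟩ else 0 := by
      intro i j
      simp only [g, finsetSum_coeff, coeff_monomial, Finset.sum_ite_eq', Finset.mem_range]
      split_ifs with h1 h2 h2
      · rfl
      · rfl
      · exact absurd (Finset.mem_range.1 (Finset.mem_product.1 (Finset.mem_filter.1 h2).1).2) h1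
      · rfl
    have hgI : ∀ i j, (g i).coeff j ≠ 0 → (i, j) ∈ I := by
      intro i j h1
      by_contra h2
      rw [hg, dif_neg h2] at h1
      exact h1 rfl
    have hper : Function.Periodic (fun i : ℤ => g (i % f').toNat) f' := fun i => by
      simp only [Int.add_emod_right]
    refine ⟨⟨fun i => g (i % f').toNat, hper, fun i j h1 => ?_⟩, ?_⟩
    · obtain ⟨i₀, h4, k, rfl⟩ := hmod i
      rw [periodic_add_mul hP]
      rw [show (fun i : ℤ => g (i % f').toNat) (i₀ + k * f') = g i₀ by
        refine (periodic_add_mul hper _ _).trans ?_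
        rw [Int.emod_eq_of_lt (by omega) (by omega), Int.toNat_natCast]] at h1
      exact (Finset.mem_filter.1 (hgI _ _ h1)).2
    · funext x
      obtain ⟨⟨i, j⟩, hx⟩ := x
      have h1 := Finset.mem_range.1 (Finset.mem_product.1 (Finset.mem_filter.1 hx).1).1
      change (g ((i : ℤ) % f').toNat).coeff j = _
      rw [Int.emod_eq_of_lt (by omega) (by omega), Int.toNat_natCast, hg, dif_pos hx]

end PeriodicPolynomials

/-! ### Counting the positions of a normal form -/

section Dimension

variable {p e : ℕ} [Fact p.Prime] {kE : Type v} [Field kE]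
variable {f f' n : ℕ} {r s : ℤ → ℕ} {a b : ℤ → kEˣ} {c d : ℤ → ZMod n} {Q : Prop}

/-- The positions of the terms of the polynomials in a normal form. -/
def IsAllowed (p e f f' : ℕ) {n : ℕ} (Q : Prop) (r : ℤ → ℕ) (c : ℤ → ZMod n) (s : ℤ → ℕ)
    (d : ℤ → ZMod n) (i : ℤ) (j : ℕ) : Prop :=
  j < e * p ∧ r i + s i - e ≤ j ∧ (j : ZMod n) = r i + c i - d i ∧
    (j < s i ∨ (Q ∧ (f' : ℤ) ∣ i ∧ (j : ℚ) = r 0 + alpha p f s 0 - alpha p f r 0))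

theorem admissible_iff {h : ℤ → kE[X]} : Admissible p e f f' n Q r c s d h ↔
    h ∈ periodicPolynomials kE f' (IsAllowed p e f f' Q r c s d) := by
  rw [mem_periodicPolynomials]
  constructor
  · intro hh
    refine ⟨hh.periodic, fun i j h0 => ⟨?_, ?_, hh.congr i j h0, hh.degree i j h0⟩⟩
    · by_contra h1
      exact h0 (coeff_eq_zero_of_degree_lt
        ((hh.degree_lt i).trans_le (by exact_mod_cast not_lt.1 h1)))
    · by_contra! h1
      exact h0 (X_pow_dvd_iff.1 (hh.dvd i) j h1)
  · rintro ⟨h1, h2⟩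
    refine ⟨fun i => ?_, fun i => ?_, h1, fun i j h0 => (h2 i j h0).2.2.1,
      fun i j h0 => (h2 i j h0).2.2.2⟩
    · rw [degree_lt_iff_coeff_zero]
      intro j hj
      by_contra h0
      exact absurd (h2 i j h0).1 (not_lt.2 hj)
    · rw [X_pow_dvd_iff]
      intro j hj
      by_contra h0
      exact absurd (h2 i j h0).2.1 (not_le.2 hj)

open Classical in
-- Positions with j < s_i give the sum over i. Any other allowed position requires Q, and then the
-- cycle shows that r_0 + β_0 - α_0 is the natural number w_0 + s_0, with the right residue and in
-- the right range. So (0, w_0 + s_0) is the only further position.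
theorem card_isAllowed (hf : 0 < f) (hf' : 0 < f') (hp2 : 2 < p) (he : 0 < e)
    (hr : RankOneParams p e f' n r a c) (hs : RankOneParams p e f' n s b d)
    (hrp : Function.Periodic r f) (hsp : Function.Periodic s f)
    (hQ : Q → ∃ w θ, IsCycle p f' r s (ratio a b) (degreeResidue r c d) w θ) :
    ((Finset.range f' ×ˢ Finset.range (e * p)).filter
      fun x => IsAllowed p e f f' Q r c s d (x.1 : ℕ) x.2).card =
    (if Q then 1 else 0) + ∑ i ∈ Finset.range f', ((Finset.Ico (r i + s i - e) (s i)).filter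
      fun j : ℕ => (j : ZMod n) = r i + c i - d i).card := by
  have hp : 1 < p := by omega
  rw [← Finset.card_filter_add_card_filter_not (fun x : ℕ × ℕ => x.2 < s (x.1 : ℕ)), add_comm,
    ← Finset.card_sigma]
  congr 1
  · split_ifs with hq
    · obtain ⟨w, θ, hc⟩ := hQ hq
      rw [Finset.card_eq_one]
      refine ⟨(0, w 0 + s 0), ?_⟩
      have h1 := hc.eq_alpha hp hf hrp hsp 0
      have h2 := add_lt_of_lt hp (hc.lt hp2 he hf' hs.r_le 0) (hs.r_le 0)
      ext ⟨i, j⟩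
      simp only [Finset.mem_filter, Finset.mem_product, Finset.mem_range, Finset.mem_singleton,
        Prod.mk.injEq, not_lt]
      constructor
      · rintro ⟨⟨⟨hi, -⟩, -, -, -, h3⟩, h4⟩
        obtain ⟨-, h5, h6⟩ := h3.resolve_left (not_lt.2 h4)
        obtain rfl : i = 0 := by
          by_contra hi0
          have := Nat.le_of_dvd (by omega) (Int.natCast_dvd_natCast.1 h5)
          omega
        refine ⟨rfl, ?_⟩
        rw [← h1] at h6
        exact_mod_cast h6
      · rintro ⟨rfl, rfl⟩
        have h3 := hr.r_le 0
        exact ⟨⟨⟨hf', h2⟩, h2, by simp only [Nat.cast_zero]; omega, hc.congr 0,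
          Or.inr ⟨hq, dvd_zero _, h1⟩⟩, by simp only [Nat.cast_zero]; omega⟩
    · rw [Finset.card_eq_zero, Finset.filter_eq_empty_iff]
      intro x hx h1
      exact hq (((Finset.mem_filter.1 hx).2.2.2.2.resolve_left h1).1)
  · refine Finset.card_bij' (fun x _ => ⟨x.1, x.2⟩) (fun x _ => (x.1, x.2)) ?_ ?_
      (fun _ _ => rfl) (fun _ _ => rfl)
    · rintro ⟨i, j⟩ hx
      simp only [Finset.mem_filter, Finset.mem_product, Finset.mem_range] at hx
      simp only [Finset.mem_sigma, Finset.mem_range, Finset.mem_filter, Finset.mem_Ico]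
      exact ⟨hx.1.1.1, ⟨hx.1.2.2.1, hx.2⟩, hx.1.2.2.2.1⟩
    · rintro ⟨i, j⟩ hx
      simp only [Finset.mem_sigma, Finset.mem_range, Finset.mem_filter, Finset.mem_Ico] at hx
      simp only [Finset.mem_filter, Finset.mem_product, Finset.mem_range]
      have h1 : j < e * p := by
        have := hs.r_le i
        have := Nat.mul_le_mul_left e hp
        omega
      exact ⟨⟨⟨hx.1, h1⟩, h1, hx.2.1.1, hx.2.2, Or.inl hx.2.1.2⟩, hx.2.1.2⟩

end Dimension

/-! ### The vector space structure on Ext¹ -/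

section ExtStructure

variable {p e : ℕ} [Fact p.Prime] {k : Type u} {kE : Type v} [Field k] [Field kE]
variable [Algebra (ZMod p) k] [Algebra (ZMod p) kE]
variable {G : Type t} [Group G] {act : G →* RingAut k} {η : G → kˣ}
variable {f f' n : ℕ} {σ : ℤ → k →+* kE} {r s : ℤ → ℕ} {a b : ℤ → kEˣ} {c d : ℤ → ZMod n}
variable [Finite kE] (hσ : IsFrobeniusSystem p f σ) (hG : IsTameDatum p f f' n act η)

include hσ hG in
theorem Admissible.underH_add {Q : Prop} {h h' : ℤ → kE[X]}
    (hh : Admissible p e f f' n Q r c s d h) (hh' : Admissible p e f f' n Q r c s d h')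
    (hs : Admissible p e f f' n Q r c s d (h + h')) :
    underH p e f σ (h + h') = underH p e f σ h + underH p e f σ h' :=
  hσ.coef_ext fun i j _ => by
    rw [hs.coef_underH hσ hG, coef_add, hh.coef_underH hσ hG, hh'.coef_underH hσ hG, Pi.add_apply,
      coeff_add]

include hσ hG in
theorem Admissible.underH_smul {Q : Prop} {h : ℤ → kE[X]} (x : kE)
    (hh : Admissible p e f f' n Q r c s d h) (hs : Admissible p e f f' n Q r c s d (x • h)) :
    underH p e f σ (x • h) = scalar p e k x * underH p e f σ h :=
  hσ.coef_ext fun i j _ => by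
    rw [hs.coef_underH hσ hG, coef_scalar_mul, hh.coef_underH hσ hG, Pi.smul_apply, coeff_smul,
      smul_eq_mul]

variable (hr : RankOneParams p e f' n r a c) (hs : RankOneParams p e f' n s b d)
variable {M N : BreuilModule.{u, v, t, w} p e kE act η} {m : M.carrier} {n₀ : N.carrier}
variable (hM : IsRankOne M f σ r a c m) (hN : IsRankOne N f σ s b d n₀)

/-- Normal forms of extensions. -/
noncomputable abbrev NormalForms (M N : BreuilModule.{u, v, t, w} p e kE act η) (f f' : ℕ) {n : ℕ}
    (r : ℤ → ℕ) (c : ℤ → ZMod n) (s : ℤ → ℕ) (d : ℤ → ZMod n) : Submodule kE (ℤ → kE[X]) :=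
  periodicPolynomials kE f' (IsAllowed p e f f' (HasNonzeroMorphism M N) r c s d)

include hσ hG hr hs hM hN in
-- Uniqueness of the normal form makes the map from classes well defined; extensions sharing a form
-- are isomorphic, which gives injectivity, and every normal form is realized.
theorem exists_equiv_normalForms [Finite G] (hp2 : 2 < p) (he : 0 < e) :
    ∃ Φ : Ext1 M N ≃ NormalForms M N f f' r c s d, ∀ (E : Extension M N)
      (h : NormalForms M N f f' r c s d), E.HasForm f σ r a c m n₀ (underH p e f σ h.1) ↔
        Φ E.cls = h := by
  have h1 : ∀ E : Extension M N, ∃ h : NormalForms M N f f' r c s d,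
      E.HasForm f σ r a c m n₀ (underH p e f σ h.1) := by
    intro E
    obtain ⟨h, h2, h3⟩ := exists_admissible hσ hG hr hs hM hN hp2 he E
    exact ⟨⟨h, admissible_iff.1 h2⟩, h3⟩
  choose nf hnf using h1
  have huniq : ∀ (E : Extension M N) (h : NormalForms M N f f' r c s d),
      E.HasForm f σ r a c m n₀ (underH p e f σ h.1) → nf E = h := fun E h h1 =>
    Subtype.ext (Admissible.eq_of_hasForm hσ hG hr hs hM hN hp2 he (admissible_iff.2 h.2)
      (admissible_iff.2 (nf E).2) h1 (hnf E))
  let Φ : Ext1 M N → NormalForms M N f f' r c s d := Quotient.lift nf fun E₁ E₂ h =>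
    (huniq E₁ _ (Extension.HasForm.of_equivalent (Setoid.symm h) (hnf E₂)))
  have hΦ : ∀ E : Extension M N, Φ E.cls = nf E := fun _ => rfl
  refine ⟨Equiv.ofBijective Φ ⟨?_, fun h => ?_⟩, fun E h => ⟨fun h1 => huniq E h h1, ?_⟩⟩
  · rintro ⟨E₁⟩ ⟨E₂⟩ h
    have h2 : nf E₁ = nf E₂ := h
    have h3 := hnf E₁
    rw [h2] at h3
    exact Quotient.sound (Extension.HasForm.equivalent hσ hG hs hM hN h3 (hnf E₂))
  · obtain ⟨E, hE⟩ := (admissible_iff.2 h.2).exists_extension hσ hG hr hs hM hN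
    exact ⟨E.cls, huniq E h hE⟩
  · rintro rfl
    exact hnf E

include hσ hG hr hs hM hN in
-- The structure is transported from the space of normal forms. It agrees with Baer sum and pushout
-- because these operations add and scale h, and conversely a form with the sum or multiple of h
-- provides the map required.
theorem exists_module_ext1 [Finite G] (hp2 : 2 < p) (he : 0 < e) :
    ∃ (_ : AddCommGroup (Ext1 M N)) (_ : Module kE (Ext1 M N)),
      (∀ E₁ E₂ E₃ : Extension M N, IsBaerSum E₁ E₂ E₃ ↔ E₃.cls = E₁.cls + E₂.cls) ∧
      (∀ (t : kE) (E₁ E₂ : Extension M N), IsScalarMultiple t E₁ E₂ ↔ E₂.cls = t • E₁.cls) ∧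
      Module.Finite kE (Ext1 M N) ∧
      Module.finrank kE (Ext1 M N) = (open Classical in if HasNonzeroMorphism M N then 1 else 0) +
        ∑ i ∈ Finset.range f', ((Finset.Ico (r i + s i - e) (s i)).filter
          fun j : ℕ => (j : ZMod n) = r i + c i - d i).card := by
  classical
  obtain ⟨Φ, hΦ⟩ := exists_equiv_normalForms hσ hG hr hs hM hN hp2 he
  let _ : AddCommGroup (Ext1 M N) := Φ.addCommGroup
  let _ : Module kE (Ext1 M N) := Φ.module kE
  let Ψ : Ext1 M N ≃ₗ[kE] NormalForms M N f f' r c s d := Φ.linearEquiv kE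
  have hΨ : ∀ x, Ψ x = Φ x := fun _ => rfl
  have hA : ∀ h : NormalForms M N f f' r c s d,
      Admissible p e f f' n (HasNonzeroMorphism M N) r c s d h.1 := fun h => admissible_iff.2 h.2
  obtain ⟨L⟩ := periodicPolynomials_equiv (F := kE) (B := e * p)
    (P := IsAllowed p e f f' (HasNonzeroMorphism M N) r c s d) hG.deg_pos (fun i => by
      funext j
      simp only [IsAllowed, hr.r_periodic i, hs.r_periodic i, hr.c_periodic i, hs.c_periodic i,
        dvd_add_self_right]) (fun i j h => h.1)
  refine ⟨inferInstance, inferInstance, fun E₁ E₂ E₃ => ?_, fun t E₁ E₂ => ?_,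
    Module.Finite.equiv (Ψ.trans L).symm, ?_⟩
  · have h1 := (hΦ E₁ _).2 rfl
    have h2 := (hΦ E₂ _).2 rfl
    have h3 : E₃.cls = E₁.cls + E₂.cls ↔ Φ E₃.cls = Φ E₁.cls + Φ E₂.cls := by
      rw [← hΨ, ← hΨ, ← hΨ, ← map_add, Ψ.injective.eq_iff]
    rw [h3, ← hΦ, Submodule.coe_add, (hA _).underH_add hσ hG (hA _) (hA (Φ E₁.cls + Φ E₂.cls))]
    exact ⟨fun h => Extension.HasForm.of_isBaerSum h h1 h2,
      fun h => Extension.HasForm.isBaerSum hσ hG hr hs hM hN h1 h2 h⟩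
  · have h1 := (hΦ E₁ _).2 rfl
    have h3 : E₂.cls = t • E₁.cls ↔ Φ E₂.cls = t • Φ E₁.cls := by
      rw [← hΨ, ← hΨ, ← map_smul, Ψ.injective.eq_iff]
    rw [h3, ← hΦ, Submodule.coe_smul, (hA _).underH_smul hσ hG t (hA (t • Φ E₁.cls))]
    exact ⟨fun h => Extension.HasForm.of_isScalarMultiple h h1,
      fun h => Extension.HasForm.isScalarMultiple hσ hG hs hM hN h1 h⟩
  · rw [(Ψ.trans L).finrank_eq, Module.finrank_pi, Fintype.card_coe,
      card_isAllowed hσ.pos hG.deg_pos hp2 he hr hs (hG.periodic hr.r_periodic)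
        (hG.periodic hs.r_periodic)
        (hasNonzeroMorphism_iff_exists_isCycle hσ hG hr hs hM hN hp2 he).1]

include hσ hG hr hs hM hN in
theorem existsUnique_normalForm [Finite G] (hp2 : 2 < p) (he : 0 < e) (E : Extension M N) :
    ∃! h : ℤ → kE[X], Admissible p e f f' n (HasNonzeroMorphism M N) r c s d h ∧
      E.HasNormalForm f σ r a c m s b d n₀ h := by
  obtain ⟨h, h1, h2⟩ := exists_admissible hσ hG hr hs hM hN hp2 he E
  refine ⟨h, ⟨h1, (E.hasNormalForm_iff hσ hG hs hM hN h).2 h2⟩, ?_⟩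
  rintro h' ⟨h3, h4⟩
  exact Admissible.eq_of_hasForm hσ hG hr hs hM hN hp2 he h1 h3 h2
    ((E.hasNormalForm_iff hσ hG hs hM hN h').1 h4)

include hσ hG hr hs hM hN in
theorem exists_extension_of_admissible {Q : Prop} {h : ℤ → kE[X]}
    (hh : Admissible p e f f' n Q r c s d h) :
    ∃ E : Extension M N, E.HasNormalForm f σ r a c m s b d n₀ h ∧
      ∀ E' : Extension M N, E'.HasNormalForm f σ r a c m s b d n₀ h → E'.Equivalent E := by
  obtain ⟨E, hE⟩ := hh.exists_extension hσ hG hr hs hM hN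
  exact ⟨E, (E.hasNormalForm_iff hσ hG hs hM hN h).2 hE, fun E' hE' =>
    Extension.HasForm.equivalent hσ hG hs hM hN
      ((E'.hasNormalForm_iff hσ hG hs hM hN h).1 hE') hE⟩

end ExtStructure

/-! ### Inertia in Galois extensions of local rings -/

section LocalRings

open IsLocalRing

variable {A B G : Type*} [CommRing A] [CommRing B] [IsLocalRing A] [IsLocalRing B] [Algebra A B]
variable [Group G] [Finite G] [MulSemiringAction G B]

/-- In u^n - 1 = (u - 1)(1 + u + ⋯ + u^{n-1}) the second factor reduces to n, hence is a unit. -/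
theorem eq_one_of_pow_eq_one {u : B} {n : ℕ} (hn : IsUnit (n : B)) (hu : u ^ n = 1)
    (h : residue B u = 1) : u = 1 := by
  have h1 : IsUnit (∑ i ∈ Finset.range n, u ^ i) := by
    rw [← residue_ne_zero_iff_isUnit, map_sum]
    simp only [map_pow, h, one_pow, Finset.sum_const, Finset.card_range, nsmul_eq_mul, mul_one]
    rw [← map_natCast (residue B)]
    exact (residue_ne_zero_iff_isUnit _).2 hn
  have h2 := geom_sum_mul u n
  rw [hu, sub_self] at h2
  exact sub_eq_zero.1 ((h1.mul_right_eq_zero).1 h2)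

/-- Elements of a tame inertia group that fix a uniformiser are trivial. -/
theorem eq_one_of_mem_inertia [IsNoetherianRing B] [FaithfulSMul G B] {ϖ : B}
    (hϖ : maximalIdeal B = Ideal.span {ϖ})
    (hn : IsUnit ((Nat.card ((maximalIdeal B).inertia G) : ℕ) : B)) {g : G}
    (hg : g ∈ (maximalIdeal B).inertia G) (hgϖ : g • ϖ = ϖ) : g = 1 := by
  have := Fintype.ofFinite (Subgroup.zpowers g)
  have hle : Subgroup.zpowers g ≤ (maximalIdeal B).inertia G := Subgroup.zpowers_le.2 hg
  have hN : IsUnit ((Fintype.card (Subgroup.zpowers g) : ℕ) : B) := by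
    rw [← Nat.card_eq_fintype_card]
    exact isUnit_of_dvd_unit (Nat.cast_dvd_cast (Subgroup.card_dvd_of_le hle)) hn
  have hτ : ∀ x, MulSemiringAction.toRingHom G B g x = g • x := fun _ => rfl
  -- Let N be the order of g. The trace of x over ⟨g⟩ is g-invariant and differs from N x by a
  -- multiple y ϖ, as ⟨g⟩ acts trivially modulo the maximal ideal. Since g fixes ϖ, this extracts a
  -- factor ϖ from N (g x - x).
  have h1 : ∀ x : B, ∃ x', (Fintype.card (Subgroup.zpowers g) : B) * (g • x - x) =
      ϖ * (g • x' - x') := by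
    intro x
    have h2 : ∑ h : Subgroup.zpowers g, (h : G) • x -
        (Fintype.card (Subgroup.zpowers g) : B) * x ∈ maximalIdeal B := by
      have : ∑ h : Subgroup.zpowers g, (h : G) • x -
          (Fintype.card (Subgroup.zpowers g) : B) * x =
          ∑ h : Subgroup.zpowers g, ((h : G) • x - x) := by
        rw [Finset.sum_sub_distrib, Finset.sum_const, Finset.card_univ, nsmul_eq_mul]
      rw [this]
      exact Ideal.sum_mem _ fun h _ => hle h.2 x
    have h3 : g • ∑ h : Subgroup.zpowers g, (h : G) • x =
        ∑ h : Subgroup.zpowers g, (h : G) • x := by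
      rw [Finset.smul_sum]
      refine Fintype.sum_equiv (Equiv.mulLeft ⟨g, Subgroup.mem_zpowers g⟩) _ _ fun h => ?_
      exact smul_smul _ _ _
    rw [hϖ, Ideal.mem_span_singleton'] at h2
    obtain ⟨y, hy⟩ := h2
    refine ⟨-y, ?_⟩
    have h4 : (Fintype.card (Subgroup.zpowers g) : B) * x =
        ∑ h : Subgroup.zpowers g, (h : G) • x - y * ϖ := by rw [hy]; ring
    have h5 := congrArg (MulSemiringAction.toRingHom G B g) h4
    rw [map_mul, map_natCast, map_sub, map_mul, hτ, hτ, hτ, hτ, h3, hgϖ] at h5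
    rw [mul_sub, h5, h4, smul_neg]
    ring
  -- Iterating, with N a unit, puts g x - x in every power of the maximal ideal; Krull's
  -- intersection theorem then gives g x = x.
  have h2 : ∀ (j : ℕ) (x : B), g • x - x ∈ maximalIdeal B ^ j := by
    intro j
    induction j with
    | zero => intro x; rw [pow_zero, Ideal.one_eq_top]; exact Submodule.mem_top
    | succ j ih =>
      intro x
      obtain ⟨x', hx⟩ := h1 x
      rw [← Ideal.unit_mul_mem_iff_mem _ hN, hx, pow_succ']
      refine Ideal.mul_mem_mul ?_ (ih x')
      rw [hϖ]
      exact Ideal.mem_span_singleton_self ϖ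
  refine FaithfulSMul.eq_of_smul_eq_smul fun x : B => ?_
  rw [one_smul, ← sub_eq_zero, ← Ideal.mem_bot,
    ← Ideal.iInf_pow_eq_bot_of_isLocalRing _ (maximalIdeal.isMaximal B).ne_top, Ideal.mem_iInf]
  exact fun j => h2 j x

variable [IsGaloisGroup G A B] [(maximalIdeal B).LiesOver (maximalIdeal A)]

theorem card_inertia_maximalIdeal [IsDomain A] [IsDomain B] [Module.Finite A B]
    [Module.Flat A B] [Finite (ResidueField A)] :
    Nat.card ((maximalIdeal B).inertia G) = (maximalIdeal B).ramificationIdx A := by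
  have : Finite (A ⧸ maximalIdeal A) := inferInstanceAs (Finite (ResidueField A))
  have : Finite (maximalIdeal A).ResidueField :=
    Finite.of_surjective _ (maximalIdeal A).bijective_algebraMap_quotient_residueField.surjective
  rw [Ideal.card_inertia_eq_ramificationIdxIn (maximalIdeal A),
    Ideal.ramificationIdxIn_eq_ramificationIdx _ (maximalIdeal B) G]

variable (A G) in
/-- Powers of the Frobenius automorphism of the residue field extension lift to the Galois group. -/
theorem exists_residue_smul_eq [Finite (ResidueField B)] (p : ℕ) [Fact p.Prime]
    [hB : CharP (ResidueField B) p] {q : ℕ} (hq : ∀ y : ResidueField A, y ^ p ^ q = y) (l : ℕ) :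
    ∃ g : G, ∀ x : B, residue B (g • x) = residue B x ^ p ^ (q * l) := by
  have : Finite (B ⧸ maximalIdeal B) := inferInstanceAs (Finite (ResidueField B))
  have : CharP (B ⧸ maximalIdeal B) p := hB
  have : IsReduced (B ⧸ maximalIdeal B) := inferInstanceAs (IsReduced (ResidueField B))
  have hpow : ∀ (l : ℕ) (y : A ⧸ maximalIdeal A), y ^ p ^ (q * l) = y := by
    intro l y
    induction l with
    | zero => rw [mul_zero, pow_zero, pow_one]
    | succ l ih => rw [Nat.mul_succ, pow_add, pow_mul, ih]; exact hq y
  -- The p^{ql}-power map is linear over the residue field of A, where y^{p^q} = y, and bijective by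
  -- finiteness. Automorphisms of the residue extension lift to the decomposition group.
  let ψ : (B ⧸ maximalIdeal B) →ₐ[A ⧸ maximalIdeal A] (B ⧸ maximalIdeal B) :=
    { iterateFrobenius (B ⧸ maximalIdeal B) p (q * l) with
      commutes' := fun y => by
        change algebraMap _ _ y ^ p ^ (q * l) = _
        rw [← map_pow, hpow] }
  have hψ : ∀ x, ψ x = x ^ p ^ (q * l) := fun _ => rfl
  have hinj : Function.Injective ψ := iterateFrobenius_inj (B ⧸ maximalIdeal B) p (q * l)
  obtain ⟨g, hg⟩ := Ideal.Quotient.stabilizerHom_surjective G (maximalIdeal A) (maximalIdeal B)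
    (AlgEquiv.ofBijective ψ (Finite.injective_iff_bijective.1 hinj))
  refine ⟨g, fun x => ?_⟩
  have h1 := DFunLike.congr_fun hg (Ideal.Quotient.mk (maximalIdeal B) x)
  exact h1

end LocalRings

/-! ### Embeddings and automorphisms of finite fields -/

section FrobeniusSystems

variable {p : ℕ} [Fact p.Prime] {k kE : Type*} [Field k] [Field kE] [Algebra (ZMod p) k]
  [Algebra (ZMod p) kE] [Finite kE]

theorem isFrobeniusSystem {σ : ℤ → k →+* kE} (hσ : ∀ i x, σ (i + 1) x ^ p = σ i x) :
    IsFrobeniusSystem p (Module.finrank (ZMod p) k) σ := by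
  have : Finite k := Finite.of_injective _ (σ 0).injective
  have := Fintype.ofFinite k
  refine ⟨?_, Module.finrank_pos, hσ⟩
  rw [Nat.card_eq_fintype_card, Module.card_eq_pow_finrank (K := ZMod p), ZMod.card]

theorem exists_eq_pow_of_ringAut [Finite k] (τ : RingAut k) :
    ∃ j : ℕ, ∀ x, τ x = x ^ p ^ j := by
  obtain ⟨j, hj⟩ := (FiniteField.bijective_frobeniusAlgHom_pow (ZMod p) k).2 (autAlgHom p τ)
  refine ⟨j, fun x => ?_⟩
  have h1 := DFunLike.congr_fun hj x
  simp only [AlgHom.coe_pow, FiniteField.coe_frobeniusAlgHom, pow_iterate, ZMod.card] at h1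
  exact h1.symm

end FrobeniusSystems

/-! ### Tame Galois extensions of p-adic fields -/

section PadicFields

open IsLocalRing

variable (p : ℕ) [Fact p.Prime] (K L : Type*) [Field K] [Field L] [Algebra ℚ_[p] K]
  [Algebra ℚ_[p] L] [FiniteDimensional ℚ_[p] K] [FiniteDimensional ℚ_[p] L]
  [Algebra L K] [IsScalarTower ℚ_[p] L K]

instance : IsDiscreteValuationRing (PadicInt.subring p) :=
  inferInstanceAs (IsDiscreteValuationRing ℤ_[p])

instance : IsFractionRing (PadicInt.subring p) ℚ_[p] :=
  inferInstanceAs (IsFractionRing ℤ_[p] ℚ_[p])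

instance : IsDedekindDomain (IntegerRing p K) :=
  IsIntegralClosure.isDedekindDomain (PadicInt.subring p) ℚ_[p] K _

instance : Module.Finite (PadicInt.subring p) (IntegerRing p K) :=
  IsIntegralClosure.finite (PadicInt.subring p) ℚ_[p] K _

instance : IsFractionRing (IntegerRing p K) K :=
  IsIntegralClosure.isFractionRing_of_finite_extension (PadicInt.subring p) ℚ_[p] K _

theorem absRamificationIdx_pos : 0 < absRamificationIdx p K :=
  Ideal.ramificationIdx_pos _ _

/-- The algebra structure of `𝒪_K` over `𝒪_L`. -/
noncomputable abbrev integerRingAlgebra : Algebra (IntegerRing p L) (IntegerRing p K) :=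
  (integerRingMap p K L).toAlgebra

/-- The action of the Galois group on `𝒪_K`. -/
noncomputable abbrev galIntegerAction : MulSemiringAction Gal(K/L) (IntegerRing p K) :=
  MulSemiringAction.compHom _ (galInteger p K L)

attribute [local instance] integerRingAlgebra galIntegerAction

theorem integerRingMap_injective : Function.Injective (integerRingMap p K L) := fun _ _ h =>
  Subtype.ext ((algebraMap L K).injective (congrArg Subtype.val h))

theorem integerRing_isScalarTower :
    IsScalarTower (PadicInt.subring p) (IntegerRing p L) (IntegerRing p K) :=
  IsScalarTower.of_algebraMap_eq fun x => Subtype.ext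
    (IsScalarTower.algebraMap_apply (PadicInt.subring p) L K x)

theorem integerRing_finite : Module.Finite (IntegerRing p L) (IntegerRing p K) := by
  have := integerRing_isScalarTower p K L
  exact Module.Finite.of_restrictScalars_finite (PadicInt.subring p) _ _

theorem flat_of_isDedekindDomain (A B : Type*) [CommRing A] [IsDedekindDomain A] [CommRing B]
    [IsDomain B] [Algebra A B] [FaithfulSMul A B] : Module.Flat A B := inferInstance

theorem integerRing_flat : Module.Flat (IntegerRing p L) (IntegerRing p K) := by
  have : FaithfulSMul (IntegerRing p L) (IntegerRing p K) :=
    (faithfulSMul_iff_algebraMap_injective _ _).2 (integerRingMap_injective p K L)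
  exact flat_of_isDedekindDomain _ _

theorem maximalIdeal_liesOver :
    (maximalIdeal (IntegerRing p K)).LiesOver (maximalIdeal (IntegerRing p L)) := by
  have := integerRing_finite p K L
  refine (Ideal.liesOver_iff _ _).2 (eq_maximalIdeal ?_).symm
  exact Ideal.isMaximal_comap_of_isIntegral_of_isMaximal _

theorem integerRing_isGaloisGroup [IsGalois L K] :
    IsGaloisGroup Gal(K/L) (IntegerRing p L) (IntegerRing p K) where
  faithful := ⟨fun {g h} hgh => by
    ext x
    obtain ⟨a, b, -, rfl⟩ := IsFractionRing.div_surjective (IntegerRing p K) x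
    have h1 := fun a : IntegerRing p K => congrArg Subtype.val (hgh a)
    rw [map_div₀, map_div₀]
    exact congrArg₂ (· / ·) (h1 a) (h1 b)⟩
  commutes := ⟨fun g a x => Subtype.ext (by
    change g (algebraMap L K a * x) = algebraMap L K a * g x
    rw [map_mul, AlgEquiv.commutes])⟩
  isInvariant := ⟨fun x hx => by
    have : FiniteDimensional L K := FiniteDimensional.right ℚ_[p] L K
    obtain ⟨y, hy⟩ := (IsGalois.mem_bot_iff_fixed (F := L) (x : K)).2 fun g =>
      congrArg Subtype.val (hx g)
    have h1 : IsIntegral (PadicInt.subring p) y :=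
      (isIntegral_algebraMap_iff (algebraMap L K).injective).1 (hy ▸ x.2)
    exact ⟨⟨y, h1⟩, Subtype.ext hy⟩⟩

theorem isLocalHom_integerRingMap : IsLocalHom (integerRingMap p K L) := by
  refine ⟨fun x hx => ?_⟩
  by_contra h
  have h1 : x ∈ maximalIdeal (IntegerRing p L) := h
  have := maximalIdeal_liesOver p K L
  rw [(Ideal.liesOver_iff (maximalIdeal (IntegerRing p K)) (maximalIdeal (IntegerRing p L))).1
    this] at h1
  exact h1 hx

variable {p K L}

theorem galResidue_residue (g : Gal(K/L)) (x : IntegerRing p K) :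
    galResidue p K L g (residue _ x) = residue _ (galInteger p K L g x) := rfl

theorem mem_inertia_iff (g : Gal(K/L)) :
    g ∈ (maximalIdeal (IntegerRing p K)).inertia Gal(K/L) ↔ ∀ x, galResidue p K L g x = x := by
  constructor
  · intro h x
    obtain ⟨x, rfl⟩ := residue_surjective x
    rw [galResidue_residue, ← sub_eq_zero, ← map_sub, residue_eq_zero_iff]
    exact h x
  · intro h x
    have h1 := h (residue _ x)
    rw [galResidue_residue, ← sub_eq_zero, ← map_sub, residue_eq_zero_iff] at h1
    exact h1

variable {π : IntegerRing p K} {hπ : Irreducible π}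

theorem galInteger_uniformiser (g : Gal(K/L)) :
    galInteger p K L g π = eta L π hπ g * π := by
  have h0 : (π : K) ≠ 0 := fun h => hπ.ne_zero (Subtype.ext h)
  exact Subtype.ext (div_mul_cancel₀ (g (π : K)) h0).symm

theorem coe_etaBar (g : Gal(K/L)) :
    (etaBar L π hπ g : ResField p K) = residue _ (eta L π hπ g : IntegerRing p K) := rfl

/-- This reduces g(h(π))/π = g(h(π)/π) · g(π)/π. -/
theorem etaBar_mul (g h : Gal(K/L)) : (etaBar L π hπ (g * h) : ResField p K) =
    galResidue p K L g (etaBar L π hπ h) * etaBar L π hπ g := by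
  rw [coe_etaBar, coe_etaBar, coe_etaBar, galResidue_residue, ← map_mul]
  congr 1
  have h0 : (π : K) ≠ 0 := fun h => hπ.ne_zero (Subtype.ext h)
  have h1 : g (π : K) ≠ 0 := fun h => h0 ((map_eq_zero g).1 h)
  refine Subtype.ext ?_
  change g (h (π : K)) / π = g (h (π : K) / π) * (g (π : K) / π)
  rw [map_div₀]
  field_simp

theorem eta_pow {n : ℕ} (hπL : ∃ x : L, algebraMap L K x = (π : K) ^ n) (g : Gal(K/L)) :
    (eta L π hπ g : IntegerRing p K) ^ n = 1 := by
  obtain ⟨x, hx⟩ := hπL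
  have h0 : (π : K) ≠ 0 := fun h => hπ.ne_zero (Subtype.ext h)
  refine Subtype.ext ?_
  change (g (π : K) / π) ^ n = 1
  rw [div_pow, ← map_pow, ← hx, AlgEquiv.commutes, hx, div_self (pow_ne_zero _ h0)]

variable (π hπ) in
/-- The Galois group of a tame extension acts on the residue field and on a uniformiser in the
expected way. -/
theorem isTameDatum [IsGalois L K] [Finite (ResField p K)] (tame : ¬p ∣ relRamificationIdx p K L)
    (hπL : ∃ x : L, algebraMap L K x = (π : K) ^ relRamificationIdx p K L)
    {kE : Type*} [Field kE] [Finite kE] [Algebra (ZMod p) kE] {σ : ℤ → ResField p K →+* kE}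
    (hσ : ∀ i x, σ (i + 1) x ^ p = σ i x) :
    IsTameDatum p (absInertiaDeg p K) (absInertiaDeg p L) (relRamificationIdx p K L)
      (galResidue p K L) (etaBar L π hπ) := by
  have := integerRing_finite p K L
  have := integerRing_flat p K L
  have := maximalIdeal_liesOver p K L
  have hGal := integerRing_isGaloisGroup p K L
  have := isLocalHom_integerRingMap p K L
  have : FiniteDimensional L K := FiniteDimensional.right ℚ_[p] L K
  let ρ : ResField p L →+* ResField p K := ResidueField.map (integerRingMap p K L)
  have hρ : ∀ x, ρ (residue _ x) = residue _ (integerRingMap p K L x) := fun _ => rfl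
  have : Finite (ResField p L) := Finite.of_injective ρ ρ.injective
  have hK := isFrobeniusSystem hσ
  have hL : IsFrobeniusSystem p (absInertiaDeg p L) fun i => (σ i).comp ρ :=
    isFrobeniusSystem fun i x => hσ i (ρ x)
  have hfix : ∀ (g : Gal(K/L)) y, galResidue p K L g (ρ y) = ρ y := by
    intro g y
    obtain ⟨y, rfl⟩ := residue_surjective y
    rw [hρ, galResidue_residue]
    congr 1
    exact Subtype.ext (g.commutes (y : L))
  have hcard : Nat.card ((maximalIdeal (IntegerRing p K)).inertia Gal(K/L)) =
      relRamificationIdx p K L := card_inertia_maximalIdeal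
  have hn0 : relRamificationIdx p K L ≠ 0 := fun h => tame (h ▸ dvd_zero p)
  have hn : IsUnit ((relRamificationIdx p K L : ℕ) : IntegerRing p K) := by
    rw [← residue_ne_zero_iff_isUnit, map_natCast, Ne, CharP.cast_eq_zero_iff (ResField p K) p]
    exact tame
  have hmax : maximalIdeal (IntegerRing p K) = Ideal.span {π} := by
    have hf : ¬IsField (IntegerRing p K) := by
      intro hf
      obtain ⟨y, hy⟩ := hf.mul_inv_cancel hπ.ne_zero
      exact hπ.not_isUnit (IsUnit.of_mul_eq_one y hy)
    have : IsDiscreteValuationRing (IntegerRing p K) :=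
      ((IsDiscreteValuationRing.TFAE (IntegerRing p K) hf).out 2 0 :
        IsDedekindDomain (IntegerRing p K) ↔ IsDiscreteValuationRing (IntegerRing p K)).1
        inferInstance
    exact hπ.maximalIdeal_eq
  refine ⟨Nat.pos_of_ne_zero hn0, tame, hL.pos, ?_, fun g => ?_, fun l => ?_, fun g => ?_,
    etaBar_mul, fun j hj => ?_⟩
  -- Elements of ℓ lie in k and so satisfy y^{p^f} = y.
  · refine hL.dvd_of_pow fun y => ρ.injective ?_
    rw [map_pow]
    exact hK.pow_card _
  · obtain ⟨j, hj⟩ := exists_eq_pow_of_ringAut (p := p) (galResidue p K L g)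
    obtain ⟨l, rfl⟩ : absInertiaDeg p L ∣ j := by
      refine hL.dvd_of_pow fun y => ρ.injective ?_
      rw [map_pow, ← hj, hfix]
    exact ⟨l, hj⟩
  · obtain ⟨g₀, hg₀⟩ := exists_residue_smul_eq (IntegerRing p L) (B := IntegerRing p K) Gal(K/L) p
      hL.pow_card l
    have hg₁ : ∀ x, galResidue p K L g₀ x = x ^ p ^ (absInertiaDeg p L * l) := by
      intro x
      obtain ⟨x, rfl⟩ := residue_surjective x
      exact hg₀ x
    rw [← hcard]
    -- The elements inducing the same automorphism of k as g₀ form the coset g₀ I of the inertia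
    -- group I, which has e(K/L) elements.
    refine Nat.card_congr ((Equiv.mulLeft g₀⁻¹).subtypeEquiv fun g => ?_)
    rw [mem_inertia_iff]
    have h1 : ∀ x, galResidue p K L (g₀⁻¹ * g) x = x ↔
        galResidue p K L g x = galResidue p K L g₀ x := by
      intro x
      rw [map_mul, map_inv]
      exact (galResidue p K L g₀).symm_apply_eq
    simp only [Equiv.coe_mulLeft, h1, hg₁]
  · refine Units.ext ?_
    rw [Units.val_pow_eq_pow_val, coe_etaBar, ← map_pow, eta_pow hπL, map_one, Units.val_one]
  · let I := (maximalIdeal (IntegerRing p K)).inertia Gal(K/L)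
    let ψ : I →* (ResField p K)ˣ := MonoidHom.mk' (fun g => etaBar L π hπ g) fun g h =>
      Units.ext <| by
        rw [Subgroup.coe_mul, etaBar_mul, (mem_inertia_iff _).1 g.2, Units.val_mul, mul_comm]
    -- If ηbar(g) = 1, then η(g) = 1, because η(g)^n = 1 with n prime to p. So g fixes π and is
    -- trivial by tameness. Hence inertia embeds into kˣ and is cyclic of order n, which gives the
    -- exact exponent of ηbar on it.
    have hψ : Function.Injective ((Units.coeHom _).comp ψ) := by
      refine Units.val_injective.comp ((injective_iff_map_eq_one ψ).2 fun g hg => ?_)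
      have h1 : (eta L π hπ g : IntegerRing p K) = 1 :=
        eq_one_of_pow_eq_one hn (eta_pow hπL g) (congrArg Units.val hg)
      have := hGal.faithful
      refine Subtype.ext (eq_one_of_mem_inertia hmax (hcard ▸ hn) g.2 ?_)
      exact (galInteger_uniformiser (hπ := hπ) (g : Gal(K/L))).trans (by rw [h1, one_mul])
    have := isCyclic_of_injective_ringHom _ hψ
    obtain ⟨g, hg⟩ := IsCyclic.exists_generator (α := I)
    rw [← hcard, ← orderOf_eq_card_of_forall_mem_zpowers hg]
    refine orderOf_dvd_of_pow_eq_one (hψ ?_)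
    rw [map_pow, map_one]
    exact congrArg Units.val (hj g ((mem_inertia_iff _).1 g.2))

end PadicFields

end BrMod

/-! ### The theorem for p-adic fields -/

theorem theorem1p7 (p : ℕ) [Fact p.Prime] (hp : p ≠ 2)
    {K L : Type*} [Field K] [Field L] [Algebra ℚ_[p] K] [Algebra ℚ_[p] L]
    [FiniteDimensional ℚ_[p] K] [FiniteDimensional ℚ_[p] L]
    [Algebra L K] [IsScalarTower ℚ_[p] L K] [IsGalois L K]
    (e f f' eKL : ℕ) (he : e = BrMod.absRamificationIdx p K) (hf : f = BrMod.absInertiaDeg p K)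
    (hf' : f' = BrMod.absInertiaDeg p L) (heKL : eKL = BrMod.relRamificationIdx p K L)
    (tame : ¬ p ∣ eKL)
    (π : BrMod.IntegerRing p K) (hπ : Irreducible π)
    (hπL : ∃ x : L, algebraMap L K x = (π : K) ^ eKL)
    {kE : Type*} [Field kE] [Finite kE] [Algebra (ZMod p) kE]
    (σ : ℤ → BrMod.ResField p K →+* kE) (hσ : ∀ i x, σ (i + 1) x ^ p = σ i x)
    (M N : BrMod.BreuilModule p e kE (BrMod.galResidue p K L) (BrMod.etaBar L π hπ))
    (r s : ℤ → ℕ) (a b : ℤ → kEˣ) (c d : ℤ → ZMod eKL)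
    (hrac : BrMod.RankOneParams p e f' eKL r a c) (hsbd : BrMod.RankOneParams p e f' eKL s b d)
    (m : M.carrier) (n : N.carrier)
    (hM : BrMod.IsRankOne M f σ r a c m) (hN : BrMod.IsRankOne N f σ s b d n) :
    (∀ E : BrMod.Extension M N, ∃! h : ℤ → Polynomial kE,
      BrMod.Admissible p e f f' eKL (BrMod.HasNonzeroMorphism M N) r c s d h ∧
        E.HasNormalForm f σ r a c m s b d n h) ∧
    (∀ h : ℤ → Polynomial kE,
      BrMod.Admissible p e f f' eKL (BrMod.HasNonzeroMorphism M N) r c s d h →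
        ∃ E : BrMod.Extension M N, E.HasNormalForm f σ r a c m s b d n h ∧
          ∀ E' : BrMod.Extension M N, E'.HasNormalForm f σ r a c m s b d n h →
            E'.Equivalent E) ∧
    ∃ (_ : AddCommGroup (BrMod.Ext1 M N)) (_ : Module kE (BrMod.Ext1 M N)),
      (∀ E₁ E₂ E₃ : BrMod.Extension M N,
        BrMod.IsBaerSum E₁ E₂ E₃ ↔ E₃.cls = E₁.cls + E₂.cls) ∧
      (∀ (t : kE) (E₁ E₂ : BrMod.Extension M N),
        BrMod.IsScalarMultiple t E₁ E₂ ↔ E₂.cls = t • E₁.cls) ∧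
      Module.Finite kE (BrMod.Ext1 M N) ∧
      Module.finrank kE (BrMod.Ext1 M N) =
        (open Classical in if BrMod.HasNonzeroMorphism M N then 1 else 0) +
          ∑ i ∈ Finset.range f',
            ((Finset.Ico (r i + s i - e) (s i)).filter
              fun j : ℕ => (j : ZMod eKL) = r i + c i - d i).card := by
  subst he hf hf' heKL
  have : Finite (BrMod.ResField p K) := Finite.of_injective _ (σ 0).injective
  have : FiniteDimensional L K := FiniteDimensional.right ℚ_[p] L K
  have hσ' := BrMod.isFrobeniusSystem hσ
  have hG := BrMod.isTameDatum π hπ tame hπL hσ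
  have hp2 : 2 < p := lt_of_le_of_ne (Fact.out : p.Prime).two_le hp.symm
  have he := BrMod.absRamificationIdx_pos p K
  exact ⟨BrMod.existsUnique_normalForm hσ' hG hrac hsbd hM hN hp2 he,
    fun _ => BrMod.exists_extension_of_admissible hσ' hG hrac hsbd hM hN,
    BrMod.exists_module_ext1 hσ' hG hrac hsbd hM hN hp2 he⟩
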